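/- Let $m\ge 1$, let $(\Omega_X,\mathcal F_X,P_X)$ and $(\Omega_\tau,\mathcal F_\tau,P_\tau)$ be probability spaces, and let $P_{X,\tau}=P_X\times P_\tau$ on $\Omega_X\times\Omega_\tau$. Let $X=X(t,\omega)$, $t\in\mathbb R^m$, $\omega\in\Omega_X$, be a real-valued random field which is jointly measurable in $(t,\omega)$ and (strict-sense) homogeneous, i.e. all its finite-dimensional distributions are invariant under the shifts of $\mathbb R^m$. Assume $E_X[X(0)^2]<\infty$ and $\mathrm{Var}_X[X(0)\mid\mathcal I_X]>0$ $P_X$-almost surely, where $\mathcal I_X$ is the $\sigma$-field of shift-invariant (mod $P_X$) events of the field: the events $\{\omega: X(\cdot,\omega)\in A\}$ where $A\subset\mathbb R^{\mathbb R^m}$ belongs to the $\sigma$-field generated by the coordinates and, for every $t\in\mathbb R^m$, $P_X\{\omega : X(\cdot,\omega)\in A\,\triangle\,\{x: x(\cdot+t)\in A\}\}=0$. Let $T_1\subset T_2\subset\cdots$ be bounded convex sets in $\mathbb R^m$ such that $T_n$ contains a ball of radius $r_n$, where $r_n\to\infty$. Let $k_n$ be positive integers with $k_n\uparrow\infty$.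 For each $n$ let $\tau_{n,1},\dots,\tau_{n,k_n}$ be independent random vectors over $(\Omega_\tau,\mathcal F_\tau,P_\tau)$, each uniformly distributed on $T_n$ with respect to Lebesgue measure $\lambda$. Put $$M_n=\frac1{\lambda(T_n)}\int_{T_n}X(t)\,\lambda(dt),\qquad V_n=\mathrm{Var}_\tau[X(\tau_{n,1})]=\frac1{\lambda(T_n)}\int_{T_n}(X(t)-M_n)^2\,\lambda(dt),$$ $$S_j=\sum_{r=1}^{j}\bigl(X(\tau_{n,r})-M_n\bigr),\qquad 0\le j\le k_n,$$ and let $Z_n=\{Z_n(t),\ t\in[0,1]\}$ be the continuous piecewise linear process on $\Omega_X\times\Omega_\tau$ with vertices $$\left(\frac{j}{k_n},\ \frac{S_j}{k_n^{1/2}V_n^{1/2}}\right),\qquad j=0,1,\dots,k_n$$ (with $Z_n$ read as $0$ where $V_n=0$). Let $W$ be standard Wiener measure on $C[0,1]$, i.e. the law under which the coordinate process is a centred Gaussian process with covariance $\min(s,t)$. Then: a) for $P_X$-almost all $\omega$, the laws of $Z_n(\omega,\cdot)$ under $P_\tau$ converge weakly in $C[0,1]$ to $W$; b) the laws of $Z_n$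 under $P_{X,\tau}$ converge weakly in $C[0,1]$ to $W$. -/

import Mathlib

open MeasureTheory ProbabilityTheory Filter Set
open scoped unitInterval Topology

noncomputable section

namespace RandomizedFCLT

/-- The Borel sigma-algebra of `C[0,1]` (with the topology of uniform convergence). -/
instance instMeasurableSpacePaths : MeasurableSpace C(I, ℝ) := borel _

instance instBorelSpacePaths : BorelSpace C(I, ℝ) := ⟨rfl⟩

/-- Standard Wiener measure on `C[0,1]`: the coordinate process is a centred Gaussian process
with covariance `min s t`. -/
structure IsWienerMeasure (W : Measure C(I, ℝ)) : Prop where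
  isGaussianProcess : IsGaussianProcess (fun (t : I) (x : C(I, ℝ)) ↦ x t) W
  mean_eq_zero : ∀ t : I, ∫ x : C(I, ℝ), x t ∂W = 0
  covariance_eq_min : ∀ s t : I,
    cov[fun x : C(I, ℝ) ↦ x s, fun x : C(I, ℝ) ↦ x t; W] = min (s : ℝ) (t : ℝ)

section Field

variable {E Ω : Type*} [MeasurableSpace Ω]

/-- Strict-sense homogeneity: all finite-dimensional distributions are shift-invariant. -/
def IsHomogeneous [Add E] (X : E → Ω → ℝ) (P : Measure Ω) : Prop :=
  ∀ (k : ℕ) (s : Fin k → E) (t : E) (A : Fin k → Set ℝ), (∀ i, MeasurableSet (A i)) →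
    P {ω | ∀ i, X (s i + t) ω ∈ A i} = P {ω | ∀ i, X (s i) ω ∈ A i}

/-- The shift `γ_t x = x (· + t)` on sample functions. -/
def shift [Add E] (t : E) (x : E → ℝ) : E → ℝ := fun s ↦ x (s + t)

lemma measurable_shift [Add E] (t : E) : Measurable (shift (E := E) t) :=
  measurable_pi_lambda _ fun s ↦ measurable_pi_apply (s + t)

/-- The sigma-algebra of the events of the space of sample functions (with the sigma-algebra
generated by the coordinates) that are invariant mod `ν` under all shifts. -/
@[reducible]
def pathInvariants [Add E] (ν : Measure (E → ℝ)) : MeasurableSpace (E → ℝ) where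
  MeasurableSet' A := MeasurableSet A ∧ ∀ t : E, shift t ⁻¹' A =ᵐ[ν] A
  measurableSet_empty := ⟨MeasurableSet.empty, fun _ ↦ EventuallyEq.rfl⟩
  measurableSet_compl A hA := ⟨hA.1.compl, fun t ↦ by
    rw [preimage_compl]
    exact (hA.2 t).compl⟩
  measurableSet_iUnion A hA := ⟨MeasurableSet.iUnion fun i ↦ (hA i).1, fun t ↦ by
    rw [preimage_iUnion]
    exact Filter.EventuallyEq.countable_iUnion fun i ↦ (hA i).2 t⟩

/-- The sigma-algebra of shift-invariant (mod `P`) events of the field `X`: the events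
`{ω | X(·, ω) ∈ A}` with `A` an event of the space of sample functions which is invariant under
all shifts modulo null sets of the law of `X`. -/
@[reducible]
def invariantEvents [Add E] (X : E → Ω → ℝ) (P : Measure Ω) : MeasurableSpace Ω :=
  (pathInvariants (P.map fun ω t ↦ X t ω)).comap fun ω t ↦ X t ω

end Field

/-- `M_n`: the spatial mean of the sample function over `T`. -/
def spatialMean {E Ω : Type*} [MeasureSpace E] (X : E → Ω → ℝ) (T : Set E) (ω : Ω) : ℝ :=
  ⨍ t in T, X t ω

/-- `V_n`: the spatial variance of the sample function over `T`, which is the variance of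
`X(τ, ω)` for fixed `ω` and `τ` uniformly distributed on `T`. -/
def spatialVar {E Ω : Type*} [MeasureSpace E] (X : E → Ω → ℝ) (T : Set E) (ω : Ω) : ℝ :=
  ⨍ t in T, (X t ω - spatialMean X T ω) ^ 2

/-- The polygonal function on `[0,1]` with vertices `(j / k, s j)`, `j = 0, ..., k`,
written as a sum of ramps; see `polygon_apply`. -/
def polygon (k : ℕ) (s : ℕ → ℝ) : C(I, ℝ) where
  toFun t := s 0 + ∑ j ∈ Finset.range k, (s (j + 1) - s j) * max 0 (min 1 (k * (t : ℝ) - j))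
  continuous_toFun := by fun_prop

/-- On `[j / k, (j + 1) / k]` the polygon is the affine interpolation of its vertices. -/
lemma polygon_apply {k : ℕ} (s : ℕ → ℝ) {j : ℕ} (hj : j < k) (t : I)
    (h₁ : (j : ℝ) ≤ k * (t : ℝ)) (h₂ : k * (t : ℝ) ≤ j + 1) :
    polygon k s t = s j + (k * (t : ℝ) - j) * (s (j + 1) - s j) := by
  obtain ⟨d, rfl⟩ := Nat.exists_eq_add_of_lt hj
  change s 0 + ∑ i ∈ Finset.range (j + d + 1), _ = _
  rw [show j + d + 1 = (j + 1) + d by ring] at *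
  rw [Finset.sum_range_add, Finset.sum_range_succ]
  have hlow : ∀ i ∈ Finset.range j, (s (i + 1) - s i) *
      max 0 (min 1 (((j + 1 + d : ℕ) : ℝ) * (t : ℝ) - i)) = s (i + 1) - s i := by
    intro i hi
    have hi' : (i : ℝ) + 1 ≤ j := by exact_mod_cast Finset.mem_range.1 hi
    rw [min_eq_left (by linarith), max_eq_right zero_le_one, mul_one]
  have hhigh : ∀ i ∈ Finset.range d, (s (j + 1 + i + 1) - s (j + 1 + i)) *
      max 0 (min 1 (((j + 1 + d : ℕ) : ℝ) * (t : ℝ) - ((j + 1 + i : ℕ) : ℝ))) = 0 := by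
    intro i _
    have hc : (j : ℝ) + 1 ≤ ((j + 1 + i : ℕ) : ℝ) := by
      push_cast
      linarith [(Nat.cast_nonneg i : (0 : ℝ) ≤ i)]
    rw [max_eq_left ((min_le_right _ _).trans (by linarith)), mul_zero]
  rw [Finset.sum_congr rfl hlow, Finset.sum_congr rfl hhigh, Finset.sum_range_sub,
    min_eq_right (by linarith), max_eq_right (by linarith), Finset.sum_const_zero]
  ring

section Construction

variable {E Ω Ω' : Type*} [MeasureSpace E]

/-- `S_j`: the sum of `X(τ_r, ω) - M` over the first `j` of the random points `τ_1, ..., τ_k`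
(the sample is indexed by `Fin k`, so `r` runs over `r < j`). -/
def partialSum (X : E → Ω → ℝ) (T : Set E) {k : ℕ} (τ : Fin k → Ω' → E) (j : ℕ)
    (p : Ω × Ω') : ℝ :=
  ∑ r ∈ Finset.univ.filter (fun r : Fin k ↦ (r : ℕ) < j), (X (τ r p.2) p.1 - spatialMean X T p.1)

/-- The random broken line with vertices `(j / k, S_j / (k V)^{1/2})`, `j = 0, ..., k`. -/
def brokenLine (X : E → Ω → ℝ) (T : Set E) {k : ℕ} (τ : Fin k → Ω' → E) (p : Ω × Ω') :
    C(I, ℝ) :=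
  polygon k fun j ↦ partialSum X T τ j p / √(k * spatialVar X T p.1)

end Construction

end RandomizedFCLT

end

/-! Freeze $\omega$. Under $P_\tau$ the values $X(\tau_{n,r},\omega)$ are i.i.d., and their law is
the distribution of the sample function over $T_n$. So $Z_n(\omega,\cdot)$ is the polygon of partial
sums of a row-wise i.i.d. array, and a functional central limit theorem applies once Lindeberg's
condition holds. For this it suffices that $M_n(\omega)$ converges, that $V_n(\omega)$ has a
positive limit, and that the spatial second moment over $\{|X|>K\}$ has a limit that is small for
suitable large $K$ (`isLindebergArray_of_sample`). The pointwise ergodic theorem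
`ae_tendsto_shiftAverage` supplies all three limits for almost every $\omega$: they are
$E[X(0)\mid\mathcal I_X]$, $\mathrm{Var}[X(0)\mid\mathcal I_X]>0$ and $E[X(0)^2
1_{|X(0)|>K}\mid\mathcal I_X]$, and Fatou's lemma makes the last one small for arbitrarily large
$K$. Since the limit law does not depend on $\omega$, b) follows from a) by Fubini and dominated
convergence.

The ergodic theorem combines a decomposition with a maximal inequality. In $L^2$ of the path law,
the orthogonal complement of the coboundaries $1_B-1_B\circ\gamma_t$ consists of invariant
functionals. Averages of invariant functionals are constant, and averages of bounded coboundaries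
vanish because a convex set with a large inscribed ball is almost translation invariant. The
$L^1$-small remainder is controlled by Wiener's covering argument (`volume_maximal_le`), transferred
to the field by homogeneity.

In the functional limit theorem, characteristic functions of weighted row sums give the
finite-dimensional limits. Tightness comes from Ottaviani's inequality and the Gaussian
fourth-moment tail of block sums. Prokhorov's theorem then provides cluster points, and their
characteristic functions identify them all. Wiener measure is thereby constructed as a limit rather
than assumed to exist. -/

set_option linter.unusedSectionVars false

section

open scoped Pointwise ENNReal NNReal

namespace RandomizedFCLT

/-! ### Volumes of convex sets and a covering inequality -/

section Geometry

variable {E : Type*} [NormedAddCommGroup E] [NormedSpace ℝ E] [FiniteDimensional ℝ E]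
  [MeasureSpace E] [BorelSpace E] [(volume : Measure E).IsAddHaarMeasure]

/-- Tonelli for $1_T(y)\,1_T(y-x)$. It turns a pointwise lower bound on overlaps into an upper bound
for the volume of the difference body. -/
lemma lintegral_volume_inter_vadd {T : Set E} (hT : MeasurableSet T) :
    ∫⁻ x : E, volume (T ∩ (x +ᵥ T)) = volume T * volume T := by
  have h1 : ∀ x : E, volume (T ∩ (x +ᵥ T)) =
      ∫⁻ y, T.indicator 1 y * T.indicator (1 : E → ℝ≥0∞) (y - x) := by
    intro x
    rw [← lintegral_indicator_one (hT.inter (hT.const_vadd x))]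
    refine lintegral_congr fun y ↦ ?_
    rw [inter_indicator_one, Pi.mul_apply]
    congr 1
    by_cases hy : y - x ∈ T
    · rw [indicator_of_mem hy, indicator_of_mem]
      · rfl
      · exact mem_vadd_set_iff_neg_vadd_mem.2 (by simpa [sub_eq_neg_add] using hy)
    · rw [indicator_of_notMem hy, indicator_of_notMem]
      intro h
      exact hy (by simpa [sub_eq_neg_add] using mem_vadd_set_iff_neg_vadd_mem.1 h)
  have hm : Measurable (T.indicator (1 : E → ℝ≥0∞)) := measurable_one.indicator hT
  simp_rw [h1]
  rw [lintegral_lintegral_swap]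
  · have h2 : ∀ y : E, ∫⁻ x, T.indicator 1 y * T.indicator (1 : E → ℝ≥0∞) (y - x) =
        T.indicator 1 y * volume T := by
      intro y
      rw [lintegral_const_mul _ (show Measurable fun x ↦ T.indicator (1 : E → ℝ≥0∞) (y - x) from
          hm.comp (measurable_const.sub measurable_id)),
        lintegral_sub_left_eq_self (T.indicator (1 : E → ℝ≥0∞)) y, lintegral_indicator_one hT]
    simp_rw [h2]
    rw [lintegral_mul_const _ hm, lintegral_indicator_one hT]
  · exact ((hm.comp measurable_snd).mul
      (hm.comp (measurable_snd.sub measurable_fst))).aemeasurable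

/-- The difference body of a convex set has comparable volume. -/
lemma volume_sub_self_le {T : Set E} (hT : Convex ℝ T) (hTo : IsOpen T)
    (hTb : Bornology.IsBounded T) :
    volume (T - T) ≤ 4 ^ Module.finrank ℝ E * volume T := by
  rcases T.eq_empty_or_nonempty with rfl | hne
  · simp
  set d := Module.finrank ℝ E
  set c : ℝ≥0∞ := ENNReal.ofReal ((1 / 2 : ℝ) ^ d)
  have hsm : ∀ A : Set E, volume ((1 / 2 : ℝ) • A) = c * volume A := by
    intro A
    rw [Measure.addHaar_smul, abs_of_pos (by positivity)]
  have hV0 : volume T ≠ 0 := (hTo.measure_pos volume hne).ne'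
  have hVt : volume T ≠ ∞ := hTb.measure_lt_top.ne
  -- For $x=(a-b)/2$ the half-size copy $(a+T)/2$ lies in $T$ by convexity, and in $x+T$ because
  -- $(a+t)/2=x+(b+t)/2$. Integrating over $(T-T)/2$ costs a second factor $2^{-d}$, whence $4^d$.
  have hlow : ∀ x ∈ (1 / 2 : ℝ) • (T - T), c * volume T ≤ volume (T ∩ (x +ᵥ T)) := by
    rintro _ ⟨_, ⟨a, ha, b, hb, rfl⟩, rfl⟩
    have hsub : ((1 / 2 : ℝ) • a) +ᵥ ((1 / 2 : ℝ) • T) ⊆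
        T ∩ (((1 / 2 : ℝ) • (a - b)) +ᵥ T) := by
      rintro _ ⟨_, ⟨t, ht, rfl⟩, rfl⟩
      refine ⟨?_, ?_⟩
      · exact hT ha ht (by norm_num) (by norm_num) (by norm_num)
      · refine ⟨(1 / 2 : ℝ) • b + (1 / 2 : ℝ) • t,
          hT hb ht (by norm_num) (by norm_num) (by norm_num), ?_⟩
        simp only [vadd_eq_add]
        module
    calc c * volume T = volume (((1 / 2 : ℝ) • a) +ᵥ ((1 / 2 : ℝ) • T)) := by
          rw [measure_vadd, hsm]
      _ ≤ _ := measure_mono hsub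
  have hmeas : MeasurableSet ((1 / 2 : ℝ) • (T - T)) :=
    ((hTo.sub_left).smul₀ (by norm_num)).measurableSet
  have key : c * volume T * (c * volume (T - T)) ≤ volume T * volume T := by
    rw [← lintegral_volume_inter_vadd hTo.measurableSet, ← hsm (T - T),
      ← setLIntegral_const]
    exact (setLIntegral_mono' hmeas hlow).trans (setLIntegral_le_lintegral _ _)
  have h4 : (4 : ℝ≥0∞) ^ d * (c * c) = 1 := by
    have : (4 : ℝ≥0∞) = ENNReal.ofReal 4 := by norm_num
    rw [this, ← ENNReal.ofReal_pow (by norm_num), ← ENNReal.ofReal_mul (by positivity),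
      ← ENNReal.ofReal_mul (by positivity), ← mul_pow, ← mul_pow]
    norm_num
  have key2 : c * c * volume (T - T) ≤ volume T := by
    have : volume T * (c * c * volume (T - T)) ≤ volume T * volume T := by
      calc _ = c * volume T * (c * volume (T - T)) := by ring
        _ ≤ _ := key
    exact (ENNReal.mul_le_mul_iff_right hV0 hVt).1 this
  calc volume (T - T) = 4 ^ d * (c * c * volume (T - T)) := by
        rw [← mul_assoc, h4, one_mul]
    _ ≤ _ := by gcongr

/-- A convex set that contains a large ball is almost invariant under translations. -/
lemma volume_inter_vadd_ge {T : Set E} (hT : Convex ℝ T) {c s : E} {r ρ : ℝ}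
    (hρ0 : 0 < ρ) (hρ1 : ρ ≤ 1) (hball : Metric.ball c r ⊆ T) (hr : ‖s‖ < ρ * r) :
    ENNReal.ofReal ((1 - ρ) ^ Module.finrank ℝ E) * volume T ≤ volume (T ∩ (s +ᵥ T)) := by
  have hr0 : 0 < r := by
    by_contra h
    push Not at h
    nlinarith [norm_nonneg s]
  -- A shrunken copy of $T$ fits into the overlap: $\rho c+s=\rho(c+s/\rho)$ with $c+s/\rho$ in the
  -- inscribed ball, and $\rho c+(1-\rho)t\in T$.
  have hsub : (ρ • c + s) +ᵥ ((1 - ρ) • T) ⊆ T ∩ (s +ᵥ T) := by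
    rintro _ ⟨_, ⟨t, ht, rfl⟩, rfl⟩
    refine ⟨?_, ?_⟩
    · have h1 : c + ρ⁻¹ • s ∈ T := by
        apply hball
        rw [mem_ball_iff_norm, add_sub_cancel_left, norm_smul, norm_inv, Real.norm_eq_abs,
          abs_of_pos hρ0, inv_mul_lt_iff₀ hρ0]
        exact hr
      have := hT h1 ht hρ0.le (sub_nonneg.2 hρ1) (by ring)
      convert this using 1
      simp only [vadd_eq_add, smul_add, smul_smul, mul_inv_cancel₀ hρ0.ne', one_smul]
    · refine ⟨ρ • c + (1 - ρ) • t, hT (hball (Metric.mem_ball_self hr0)) ht hρ0.le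
        (sub_nonneg.2 hρ1) (by ring), ?_⟩
      simp only [vadd_eq_add]
      module
  calc _ = volume ((ρ • c + s) +ᵥ ((1 - ρ) • T)) := by
        rw [measure_vadd, Measure.addHaar_smul, abs_of_nonneg (pow_nonneg (sub_nonneg.2 hρ1) _)]
    _ ≤ _ := measure_mono hsub

/-- Wiener's covering argument: a maximal inequality for translates of convex sets. -/
lemma volume_maximal_le {T : ℕ → Set E} (hmono : Monotone T) (hconv : ∀ n, Convex ℝ (T n))
    (hopen : ∀ n, IsOpen (T n)) (hbdd : ∀ n, Bornology.IsBounded (T n))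
    (hne : ∀ n, (T n).Nonempty) (φ : E → ℝ≥0∞) (α : ℝ≥0∞) (N : ℕ) {D U : Set E}
    (hD : ∀ s ∈ D, ∃ n ≤ N, α * volume (T n) ≤ ∫⁻ t in s +ᵥ T n, φ t)
    (hU : ∀ s ∈ D, ∀ n ≤ N, s +ᵥ T n ⊆ U) :
    α * volume D ≤ 4 ^ Module.finrank ℝ E * ∫⁻ t in U, φ t := by
  choose! n hnN hn using hD
  -- The sizes $2^{n(s)}$ with ratio $3/2<2$ force $n(a)\le n(b)$ whenever $b$ is selected for $a$.
  -- Nestedness of the sets then puts $a$ into $b+(T_{n(b)}-T_{n(b)})$.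
  obtain ⟨u, huD, hdisj, hcov⟩ := Vitali.exists_disjoint_subfamily_covering_enlargement
    (fun s ↦ s +ᵥ T (n s)) D (fun s ↦ (2 : ℝ) ^ n s) (3 / 2) (by norm_num)
    (fun _ _ ↦ by positivity) (2 ^ N)
    (fun a ha ↦ pow_le_pow_right₀ (by norm_num) (hnN a ha))
    (fun a _ ↦ (hne _).vadd_set)
  have hopen' : ∀ s, IsOpen (s +ᵥ T (n s)) := fun s ↦ (hopen _).vadd s
  have hcount : u.Countable := hdisj.countable_of_isOpen (fun s _ ↦ hopen' s)
    (fun s _ ↦ (hne _).vadd_set)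
  have hDsub : D ⊆ ⋃ b ∈ u, b +ᵥ (T (n b) - T (n b)) := by
    intro a ha
    obtain ⟨b, hb, ⟨y, ⟨p, hp, hpy⟩, ⟨q, hq, hqy⟩⟩, hle⟩ := hcov a ha
    have hnab : n a ≤ n b := by
      by_contra! hlt
      have h1 : (2 : ℝ) ^ (n b + 1) ≤ 2 ^ n a := pow_le_pow_right₀ (by norm_num) hlt
      have h2 : (0 : ℝ) < 2 ^ n b := by positivity
      rw [pow_succ] at h1
      linarith
    refine mem_iUnion₂.2 ⟨b, hb, q - p, ⟨q, hq, p, hmono hnab hp, rfl⟩, ?_⟩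
    simp only [vadd_eq_add] at hpy hqy ⊢
    have : b + q = a + p := by rw [hqy, hpy]
    rw [← add_sub_assoc, this, add_sub_cancel_right]
  have : Countable u := hcount.to_subtype
  calc α * volume D ≤ α * ∑' b : u, volume ((b : E) +ᵥ (T (n b) - T (n b))) := by
        gcongr
        refine (measure_mono hDsub).trans ?_
        exact measure_biUnion_le _ hcount _
    _ ≤ α * ∑' b : u, 4 ^ Module.finrank ℝ E * volume (T (n b)) := by
        gcongr with b
        rw [measure_vadd]
        exact volume_sub_self_le (hconv _) (hopen _) (hbdd _)
    _ = 4 ^ Module.finrank ℝ E * ∑' b : u, α * volume (T (n b)) := by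
        rw [ENNReal.tsum_mul_left, ENNReal.tsum_mul_left]
        ring
    _ ≤ 4 ^ Module.finrank ℝ E * ∑' b : u, ∫⁻ t in (b : E) +ᵥ T (n b), φ t := by
        gcongr with b
        exact hn b (huD b.2)
    _ = 4 ^ Module.finrank ℝ E * ∫⁻ t in ⋃ b ∈ u, (b : E) +ᵥ T (n b), φ t := by
        rw [lintegral_biUnion hcount (fun s _ ↦ (hopen' s).measurableSet) hdisj]
    _ ≤ _ := by
        gcongr
        exact iUnion₂_subset fun b hb ↦ hU b (huD hb) _ (hnN b (huD hb))

end Geometry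

/-- The sample function of the field. -/
def samplePath {E Ω : Type*} (X : E → Ω → ℝ) (ω : Ω) : E → ℝ := fun t ↦ X t ω

/-- The spatial average over `T` of the functional `F` along the shifts of `x`. -/
noncomputable def shiftAverage {E : Type*} [Add E] [MeasureSpace E] (F : (E → ℝ) → ℝ) (T : Set E)
    (x : E → ℝ) : ℝ :=
  ⨍ t in T, F (shift t x)

/-! ### Homogeneous fields and the law of the sample function -/

section Stationary

variable {E Ω : Type*} [MeasurableSpace Ω] {P : Measure Ω} [IsProbabilityMeasure P]
  {X : E → Ω → ℝ}

lemma shift_shift [AddSemigroup E] (s t : E) (x : E → ℝ) :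
    shift t (shift s x) = shift (t + s) x := by
  funext u
  simp [shift, add_assoc]

lemma shift_zero [AddMonoid E] (x : E → ℝ) : shift 0 x = x := by
  funext u
  simp [shift]

variable [AddCommGroup E] [MeasurableSpace E] [MeasurableAdd₂ E]

lemma measurable_shift_samplePath (hX : Measurable (Function.uncurry X)) :
    Measurable fun p : E × Ω ↦ shift p.1 (samplePath X p.2) :=
  measurable_pi_lambda _ fun _ ↦
    hX.comp ((measurable_const.add measurable_fst).prodMk measurable_snd)

lemma measurable_samplePath (hX : Measurable (Function.uncurry X)) :
    Measurable (samplePath X) :=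
  measurable_pi_lambda _ fun _ ↦ hX.comp (measurable_const.prodMk measurable_id)

/-- Homogeneity speaks only of finite-dimensional rectangles. They form a π-system generating the
product σ-algebra, and both measures are probabilities. -/
lemma measurePreserving_shift (hX : Measurable (Function.uncurry X))
    (hhom : IsHomogeneous X P) (t : E) :
    MeasurePreserving (shift t) (P.map (samplePath X)) (P.map (samplePath X)) := by
  refine ⟨measurable_shift t, ?_⟩
  have hpath := measurable_samplePath hX
  have : IsProbabilityMeasure (P.map (samplePath X)) :=
    Measure.isProbabilityMeasure_map hpath.aemeasurable
  have : IsProbabilityMeasure ((P.map (samplePath X)).map (shift t)) :=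
    Measure.isProbabilityMeasure_map (measurable_shift t).aemeasurable
  refine ext_of_generate_finite _ generateFrom_squareCylinders.symm
    (isPiSystem_squareCylinders (fun _ ↦ MeasurableSpace.isPiSystem_measurableSet)
      (fun _ ↦ by simp)) ?_ (by simp)
  rintro _ ⟨s, B, hB, rfl⟩
  have hsurj : ∀ i ∈ s, ∃ j, (s.equivFin.symm j : E) = i := fun i hi ↦
    ⟨s.equivFin ⟨i, hi⟩, by simp⟩
  have hBm : ∀ i, MeasurableSet (B i) := fun i ↦ hB i trivial
  have hS : MeasurableSet ((s : Set E).pi B) :=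
    MeasurableSet.pi s.countable_toSet fun i _ ↦ hBm i
  rw [Measure.map_apply (measurable_shift t) hS,
    Measure.map_apply hpath (measurable_shift t hS), Measure.map_apply hpath hS]
  have h := hhom s.card (fun i ↦ (s.equivFin.symm i : E)) t
    (fun i ↦ B (s.equivFin.symm i)) (fun i ↦ hBm _)
  convert h using 2
  · ext ω
    simp only [mem_preimage, Set.mem_pi, Finset.mem_coe, shift, samplePath, mem_ofPred_eq]
    refine ⟨fun h i ↦ h _ (s.equivFin.symm i).2, fun h i hi ↦ ?_⟩
    obtain ⟨j, rfl⟩ := hsurj i hi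
    exact h j
  · ext ω
    simp only [mem_preimage, Set.mem_pi, Finset.mem_coe, samplePath, mem_ofPred_eq]
    refine ⟨fun h i ↦ h _ (s.equivFin.symm i).2, fun h i hi ↦ ?_⟩
    obtain ⟨j, rfl⟩ := hsurj i hi
    exact h j

lemma lintegral_shift_samplePath (hX : Measurable (Function.uncurry X))
    (hhom : IsHomogeneous X P) (t : E) {G : (E → ℝ) → ℝ≥0∞} (hG : Measurable G) :
    ∫⁻ ω, G (shift t (samplePath X ω)) ∂P = ∫⁻ ω, G (samplePath X ω) ∂P := by
  have hpath := measurable_samplePath hX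
  rw [← lintegral_map hG hpath, ← (measurePreserving_shift hX hhom t).lintegral_comp hG]
  exact (lintegral_map (hG.comp (measurable_shift t)) hpath).symm

lemma measure_shift_samplePath (hX : Measurable (Function.uncurry X))
    (hhom : IsHomogeneous X P) (t : E) {A : Set (E → ℝ)} (hA : MeasurableSet A) :
    P {ω | shift t (samplePath X ω) ∈ A} = P {ω | samplePath X ω ∈ A} := by
  have hpath := measurable_samplePath hX
  have := (measurePreserving_shift hX hhom t).measure_preimage hA.nullMeasurableSet
  rwa [Measure.map_apply hpath hA, Measure.map_apply hpath (measurable_shift t hA)] at this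

lemma integrable_shift_samplePath (hX : Measurable (Function.uncurry X))
    (hhom : IsHomogeneous X P) (ρ : Measure E) [IsFiniteMeasure ρ] (s : E) {F : (E → ℝ) → ℝ}
    (hF : Measurable F) (hFi : Integrable F (P.map (samplePath X))) :
    Integrable (fun p : E × Ω ↦ F (shift p.1 (shift s (samplePath X p.2)))) (ρ.prod P) := by
  have hm : Measurable fun p : E × Ω ↦ F (shift p.1 (shift s (samplePath X p.2))) := by
    simp_rw [shift_shift]
    exact hF.comp ((measurable_shift_samplePath hX).comp
      ((measurable_fst.add measurable_const).prodMk measurable_snd))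
  refine ⟨hm.aestronglyMeasurable, ?_⟩
  rw [HasFiniteIntegral, lintegral_prod _ hm.enorm.aemeasurable]
  simp_rw [shift_shift]
  simp_rw [fun t ↦ lintegral_shift_samplePath hX hhom t (G := fun x ↦ ‖F x‖ₑ) hF.enorm]
  rw [lintegral_const, ← lintegral_map hF.enorm (measurable_samplePath hX)]
  exact ENNReal.mul_lt_top hFi.2 (measure_lt_top _ _)

lemma ae_integrable_shift_samplePath (hX : Measurable (Function.uncurry X))
    (hhom : IsHomogeneous X P) (ρ : Measure E) [IsFiniteMeasure ρ] (s : E) {F : (E → ℝ) → ℝ}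
    (hF : Measurable F) (hFi : Integrable F (P.map (samplePath X))) :
    ∀ᵐ ω ∂P, Integrable (fun t ↦ F (shift t (shift s (samplePath X ω)))) ρ :=
  (integrable_shift_samplePath hX hhom ρ s hF hFi).prod_left_ae

/-- By the strong law of large numbers, spatial averages are limits of averages over a fixed
sequence of points. -/
lemma exists_ae_tendsto_sample_mean (hX : Measurable (Function.uncurry X))
    (hhom : IsHomogeneous X P) (ρ : Measure E) [IsProbabilityMeasure ρ] (s : E)
    {F : (E → ℝ) → ℝ} (hF : Measurable F) (hFi : Integrable F (P.map (samplePath X))) :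
    ∀ᵐ u ∂Measure.infinitePi (fun _ : ℕ ↦ ρ), ∀ᵐ ω ∂P,
      Tendsto (fun n : ℕ ↦ (∑ i ∈ Finset.range n, F (shift (u i) (shift s (samplePath X ω)))) / n)
        atTop (𝓝 (∫ t, F (shift t (shift s (samplePath X ω))) ∂ρ)) := by
  have hm : Measurable fun p : Ω × E ↦ F (shift p.2 (shift s (samplePath X p.1))) := by
    simp_rw [shift_shift]
    exact hF.comp ((measurable_shift_samplePath hX).comp
      ((measurable_snd.add measurable_const).prodMk measurable_fst))
  -- The strong law is applied with $\omega$ frozen. Fubini then exchanges the quantifiers, so that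
  -- one sequence of points serves almost every $\omega$.
  rw [← Measure.ae_ae_comm]
  · filter_upwards [ae_integrable_shift_samplePath hX hhom ρ s hF hFi] with ω hω
    set f : E → ℝ := fun t ↦ F (shift t (shift s (samplePath X ω))) with hf
    have hfm : Measurable f := hm.comp (measurable_const.prodMk measurable_id)
    have hmp : ∀ i, MeasurePreserving (fun u : ℕ → E ↦ u i)
        (Measure.infinitePi fun _ : ℕ ↦ ρ) ρ := fun i ↦ measurePreserving_eval_infinitePi _ i
    have := strong_law_ae_real (μ := Measure.infinitePi fun _ : ℕ ↦ ρ)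
      (fun i u ↦ f (u i)) ((hmp 0).integrable_comp_of_integrable hω)
      (fun i j hij ↦ (iIndepFun_infinitePi (P := fun _ : ℕ ↦ ρ) (X := fun _ ↦ f)
        (fun _ ↦ hfm)).indepFun hij)
      (fun i ↦ ⟨(hfm.comp (measurable_pi_apply i)).aemeasurable,
        (hfm.comp (measurable_pi_apply 0)).aemeasurable, by
        have h1 := ((MeasurePreserving.mk hfm rfl : MeasurePreserving f ρ (ρ.map f)).comp
          (hmp i)).map_eq
        have h2 := ((MeasurePreserving.mk hfm rfl : MeasurePreserving f ρ (ρ.map f)).comp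
          (hmp 0)).map_eq
        exact h1.trans h2.symm⟩)
    rw [show ∫ u, f (u 0) ∂(Measure.infinitePi fun _ : ℕ ↦ ρ) = ∫ t, f t ∂ρ from by
      conv_rhs => rw [← (hmp 0).map_eq]
      rw [integral_map (hmp 0).measurable.aemeasurable hfm.aestronglyMeasurable]] at this
    exact this
  · refine measurableSet_tendsto_fun (fun n ↦ ?_) ?_
    · refine Measurable.div_const (Finset.measurable_sum _ fun i _ ↦ ?_) _
      exact hm.comp (measurable_fst.prodMk ((measurable_pi_apply i).comp measurable_snd))
    · exact (hm.stronglyMeasurable.integral_prod_right' (ν := ρ)).measurable.comp measurable_fst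

end Stationary

/-! ### The maximal inequality for spatial averages -/

section Maximal

variable {E : Type*} [NormedAddCommGroup E] [NormedSpace ℝ E] [FiniteDimensional ℝ E]
  [MeasureSpace E] [BorelSpace E] [(volume : Measure E).IsAddHaarMeasure]
  {Ω : Type*} [MeasurableSpace Ω] {P : Measure Ω} [IsProbabilityMeasure P]
  {X : E → Ω → ℝ}

lemma isProbabilityMeasure_cond_volume {T : Set E} (hTo : IsOpen T)
    (hTb : Bornology.IsBounded T) (hne : T.Nonempty) :
    IsProbabilityMeasure ((volume T)⁻¹ • (volume : Measure E).restrict T) :=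
  cond_isProbabilityMeasure_of_finite (hTo.measure_pos volume hne).ne' hTb.measure_lt_top.ne

lemma shiftAverage_eq_integral (F : (E → ℝ) → ℝ) (T : Set E) (x : E → ℝ) :
    shiftAverage F T x = ∫ t, F (shift t x) ∂((volume T)⁻¹ • (volume : Measure E).restrict T) := by
  rw [shiftAverage, average, Measure.restrict_apply_univ]

/-- Spatial averages of a field over finitely many sets are jointly homogeneous. -/
lemma measure_exists_shiftAverage_eq (hX : Measurable (Function.uncurry X))
    (hhom : IsHomogeneous X P) {T : ℕ → Set E}
    (hopen : ∀ n, IsOpen (T n)) (hbdd : ∀ n, Bornology.IsBounded (T n))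
    (hne : ∀ n, (T n).Nonempty) (s : E) {F : (E → ℝ) → ℝ} (hF : Measurable F)
    (hFi : Integrable F (P.map (samplePath X))) (N : ℕ) (a : ℝ) :
    P {ω | ∃ n ≤ N, a < |shiftAverage F (T n) (shift s (samplePath X ω))|} =
      P {ω | ∃ n ≤ N, a < |shiftAverage F (T n) (samplePath X ω)|} := by
  -- A spatial average involves uncountably many coordinates, so in general it is not measurable on
  -- path space and homogeneity does not apply to it directly. It is replaced by a limsup of
  -- averages over one fixed sequence of points. This is measurable and agrees almost surely with
  -- the spatial average, both along the field and along its shift.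
  have key : ∀ n, ∃ Φ : (E → ℝ) → ℝ, Measurable Φ ∧
      (∀ᵐ ω ∂P, shiftAverage F (T n) (shift s (samplePath X ω)) = Φ (shift s (samplePath X ω))) ∧
      ∀ᵐ ω ∂P, shiftAverage F (T n) (samplePath X ω) = Φ (samplePath X ω) := by
    intro n
    have := isProbabilityMeasure_cond_volume (hopen n) (hbdd n) (hne n)
    set ρ := (volume (T n))⁻¹ • (volume : Measure E).restrict (T n) with hρ
    obtain ⟨u, hu1, hu2⟩ := ((exists_ae_tendsto_sample_mean hX hhom ρ s hF hFi).and
      (exists_ae_tendsto_sample_mean hX hhom ρ 0 hF hFi)).exists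
    simp_rw [shift_zero] at hu2
    refine ⟨fun x ↦ limsup (fun n : ℕ ↦ (∑ i ∈ Finset.range n, F (shift (u i) x)) / n) atTop,
      ?_, ?_, ?_⟩
    · exact Measurable.limsup fun n ↦ (Finset.measurable_sum _ fun i _ ↦
        hF.comp (measurable_shift _)).div_const _
    · filter_upwards [hu1] with ω hω
      rw [hω.limsup_eq, shiftAverage_eq_integral]
    · filter_upwards [hu2] with ω hω
      rw [hω.limsup_eq, shiftAverage_eq_integral]
  choose Φ hΦm hΦ1 hΦ2 using key
  have hA : MeasurableSet {x | ∃ n ≤ N, a < |Φ n x|} := by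
    have : {x | ∃ n ≤ N, a < |Φ n x|} = ⋃ n, ⋃ (_ : n ≤ N), {x | a < |Φ n x|} := by
      ext; simp
    rw [this]
    exact MeasurableSet.iUnion fun n ↦ MeasurableSet.iUnion fun _ ↦
      measurableSet_lt measurable_const (measurable_norm.comp (hΦm n))
  calc _ = P {ω | shift s (samplePath X ω) ∈ {x | ∃ n ≤ N, a < |Φ n x|}} := by
        refine measure_congr ?_
        filter_upwards [ae_all_iff.2 hΦ1] with ω hω
        refine propext ?_
        change (∃ n ≤ N, a < |shiftAverage F (T n) (shift s (samplePath X ω))|) ↔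
          ∃ n ≤ N, a < |Φ n (shift s (samplePath X ω))|
        simp_rw [hω]
    _ = P {ω | samplePath X ω ∈ {x | ∃ n ≤ N, a < |Φ n x|}} :=
        measure_shift_samplePath hX hhom s hA
    _ = _ := by
        refine measure_congr ?_
        filter_upwards [ae_all_iff.2 hΦ2] with ω hω
        refine propext ?_
        change (∃ n ≤ N, a < |Φ n (samplePath X ω)|) ↔
          ∃ n ≤ N, a < |shiftAverage F (T n) (samplePath X ω)|
        simp_rw [hω]

lemma measurable_shiftAverage (hX : Measurable (Function.uncurry X)) {T : Set E}
    {F : (E → ℝ) → ℝ} (hF : Measurable F) :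
    Measurable fun p : E × Ω ↦ shiftAverage F T (shift p.1 (samplePath X p.2)) := by
  simp_rw [shiftAverage, setAverage_eq, shift_shift, smul_eq_mul]
  refine Measurable.const_mul ?_ _
  have : Measurable fun q : (E × Ω) × E ↦ F (shift (q.2 + q.1.1) (samplePath X q.1.2)) :=
    hF.comp ((measurable_shift_samplePath hX).comp
      ((measurable_snd.add (measurable_fst.comp measurable_fst)).prodMk
        (measurable_snd.comp measurable_fst)))
  exact (this.stronglyMeasurable.integral_prod_right' (ν := volume.restrict T)).measurable

/-- The maximal inequality for spatial averages over finitely many sets. -/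
lemma measure_maximal_le_of_finite (hX : Measurable (Function.uncurry X))
    (hhom : IsHomogeneous X P) {T : ℕ → Set E}
    (hmono : Monotone T) (hconv : ∀ n, Convex ℝ (T n))
    (hopen : ∀ n, IsOpen (T n)) (hbdd : ∀ n, Bornology.IsBounded (T n))
    (hne : ∀ n, (T n).Nonempty) {F : (E → ℝ) → ℝ} (hF : Measurable F)
    (hFi : Integrable F (P.map (samplePath X))) (N : ℕ) {a : ℝ} (ha : 0 < a) :
    ENNReal.ofReal a * P {ω | ∃ n ≤ N, a < |shiftAverage F (T n) (samplePath X ω)|} ≤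
      8 ^ Module.finrank ℝ E * ∫⁻ x, ‖F x‖ₑ ∂(P.map (samplePath X)) := by
  obtain ⟨R, hR0, hR⟩ := (hbdd N).subset_ball_lt 0 0
  set d := Module.finrank ℝ E
  set p := P {ω | ∃ n ≤ N, a < |shiftAverage F (T n) (samplePath X ω)|}
  set Q := Metric.ball (0 : E) R
  set M := ∫⁻ x, ‖F x‖ₑ ∂(P.map (samplePath X))
  -- Transference: the measure of this set is computed in two ways. For fixed $\omega$ the covering
  -- inequality bounds the section; for fixed $s\in Q$ homogeneity gives every section the same
  -- probability `p`.
  set B : Set (E × Ω) :=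
    {q | q.1 ∈ Q ∧ ∃ n ≤ N, a < |shiftAverage F (T n) (shift q.1 (samplePath X q.2))|} with hB
  have hBm : MeasurableSet B := by
    refine (measurable_fst measurableSet_ball).inter ?_
    have : {q : E × Ω | ∃ n ≤ N, a < |shiftAverage F (T n) (shift q.1 (samplePath X q.2))|} =
        ⋃ n, ⋃ (_ : n ≤ N), {q | a < |shiftAverage F (T n) (shift q.1 (samplePath X q.2))|} := by
      ext; simp
    change MeasurableSet {q : E × Ω | ∃ n ≤ N,
      a < |shiftAverage F (T n) (shift q.1 (samplePath X q.2))|}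
    rw [this]
    exact MeasurableSet.iUnion fun n ↦ MeasurableSet.iUnion fun _ ↦
      measurableSet_lt measurable_const (measurable_norm.comp (measurable_shiftAverage hX hF))
  have hpt : ∀ ω, ENNReal.ofReal a * volume {s | (s, ω) ∈ B} ≤
      4 ^ d * ∫⁻ t in Metric.ball (0 : E) (2 * R), ‖F (shift t (samplePath X ω))‖ₑ := by
    intro ω
    refine volume_maximal_le hmono hconv hopen hbdd hne _ _ N ?_ ?_
    · rintro s ⟨-, n, hn, han⟩
      refine ⟨n, hn, ?_⟩
      have hV0 : volume (T n) ≠ 0 := ((hopen n).measure_pos volume (hne n)).ne'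
      have hVt : volume (T n) ≠ ∞ := (hbdd n).measure_lt_top.ne
      have h1 : ENNReal.ofReal a * volume (T n) ≤
          ‖∫ t in T n, F (shift t (shift s (samplePath X ω)))‖ₑ := by
        rw [shiftAverage, setAverage_eq, smul_eq_mul, abs_mul, abs_of_nonneg (by positivity),
          lt_inv_mul_iff₀ (show 0 < volume.real (T n) from ENNReal.toReal_pos hV0 hVt)] at han
        rw [← ENNReal.ofReal_toReal hVt, ← ENNReal.ofReal_mul ha.le, Real.enorm_eq_ofReal_abs,
          mul_comm]
        exact ENNReal.ofReal_le_ofReal han.le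
      refine h1.trans ((enorm_integral_le_lintegral_enorm _).trans_eq ?_)
      have := (measurePreserving_vadd s (volume : Measure E)).setLIntegral_comp_emb
        (measurableEmbedding_const_vadd s) (fun t ↦ ‖F (shift t (samplePath X ω))‖ₑ) (T n)
      rw [image_vadd] at this
      rw [← this]
      refine lintegral_congr fun t ↦ ?_
      rw [shift_shift, vadd_eq_add, add_comm]
    · rintro s ⟨hs, -⟩ n hn
      rintro _ ⟨t, ht, rfl⟩
      have h1 := mem_ball_zero_iff.1 (hR (hmono hn ht))
      have h2 := mem_ball_zero_iff.1 hs
      rw [mem_ball_zero_iff]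
      calc ‖s + t‖ ≤ ‖s‖ + ‖t‖ := norm_add_le _ _
        _ < 2 * R := by linarith
  have hint1 : ∫⁻ ω, volume {s | (s, ω) ∈ B} ∂P = p * volume Q := by
    have h := Measure.prod_apply_symm (μ := (volume : Measure E)) (ν := P) hBm
    rw [Measure.prod_apply hBm] at h
    refine h.symm.trans ?_
    have : ∀ s, P (Prod.mk s ⁻¹' B) = Q.indicator (fun _ ↦ p) s := by
      intro s
      by_cases hs : s ∈ Q
      · rw [indicator_of_mem hs]
        refine Eq.trans ?_ (measure_exists_shiftAverage_eq hX hhom hopen hbdd hne s hF hFi N a)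
        congr 1
        ext ω
        simp [hB, hs]
      · rw [indicator_of_notMem hs]
        convert measure_empty (μ := P)
        ext ω
        simp [hB, hs]
    simp_rw [this]
    rw [lintegral_indicator_const measurableSet_ball]
  have hint2 : ∫⁻ ω, (∫⁻ t in Metric.ball (0 : E) (2 * R), ‖F (shift t (samplePath X ω))‖ₑ) ∂P =
      M * volume (Metric.ball (0 : E) (2 * R)) := by
    rw [lintegral_lintegral_swap]
    · simp_rw [fun t ↦ lintegral_shift_samplePath hX hhom t (G := fun x ↦ ‖F x‖ₑ) hF.enorm]
      rw [setLIntegral_const, ← lintegral_map hF.enorm (measurable_samplePath hX)]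
    · exact (hF.comp ((measurable_shift_samplePath hX).comp measurable_swap)).enorm.aemeasurable
  have hQ0 : volume Q ≠ 0 := (Metric.measure_ball_pos volume _ hR0).ne'
  have hQt : volume Q ≠ ∞ := measure_ball_lt_top.ne
  have hvol : volume (Metric.ball (0 : E) (2 * R)) = 2 ^ d * volume Q := by
    rw [Measure.addHaar_ball_mul_of_pos _ _ (by norm_num)]
    congr 1
    rw [ENNReal.ofReal_pow (by norm_num)]
    simp [d]
  have hmeasB : Measurable fun ω ↦ volume {s | (s, ω) ∈ B} :=
    measurable_measure_prodMk_right hBm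
  have hmeas2 : Measurable fun ω ↦ ∫⁻ t in Metric.ball (0 : E) (2 * R),
      ‖F (shift t (samplePath X ω))‖ₑ :=
    (hF.comp ((measurable_shift_samplePath hX).comp measurable_swap)).enorm.lintegral_prod_right'
  have htot := lintegral_mono (μ := P) hpt
  rw [lintegral_const_mul _ hmeasB, lintegral_const_mul _ hmeas2, hint1, hint2, hvol] at htot
  -- $4^d$ comes from the difference bodies, $2^d$ from the ratio of the balls of radii $2R$ and
  -- $R$.
  have h8 : (4 : ℝ≥0∞) ^ d * (M * (2 ^ d * volume Q)) = (8 ^ d * M) * volume Q := by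
    rw [show (8 : ℝ≥0∞) = 4 * 2 by norm_num, mul_pow]
    ring
  rw [h8, ← mul_assoc] at htot
  exact (ENNReal.mul_le_mul_iff_left hQ0 hQt).1 htot

/-- The maximal inequality for spatial averages. -/
lemma measure_maximal_le (hX : Measurable (Function.uncurry X))
    (hhom : IsHomogeneous X P) {T : ℕ → Set E}
    (hmono : Monotone T) (hconv : ∀ n, Convex ℝ (T n))
    (hopen : ∀ n, IsOpen (T n)) (hbdd : ∀ n, Bornology.IsBounded (T n))
    (hne : ∀ n, (T n).Nonempty) {F : (E → ℝ) → ℝ} (hF : Measurable F)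
    (hFi : Integrable F (P.map (samplePath X))) {a : ℝ} (ha : 0 < a) :
    ENNReal.ofReal a * P {ω | ∃ n, a < |shiftAverage F (T n) (samplePath X ω)|} ≤
      8 ^ Module.finrank ℝ E * ∫⁻ x, ‖F x‖ₑ ∂(P.map (samplePath X)) := by
  have : {ω | ∃ n, a < |shiftAverage F (T n) (samplePath X ω)|} =
      ⋃ N, {ω | ∃ n ≤ N, a < |shiftAverage F (T n) (samplePath X ω)|} := by
    ext ω
    simp only [mem_iUnion, mem_ofPred_eq]
    exact ⟨fun ⟨n, h⟩ ↦ ⟨n, n, le_rfl, h⟩, fun ⟨_, n, _, h⟩ ↦ ⟨n, h⟩⟩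
  rw [this, Monotone.measure_iUnion, ENNReal.mul_iSup]
  · exact iSup_le fun N ↦
      measure_maximal_le_of_finite hX hhom hmono hconv hopen hbdd hne hF hFi N ha
  · exact fun N N' h ω ⟨n, hn, hω⟩ ↦ ⟨n, hn.trans h, hω⟩

end Maximal

/-! ### The pointwise ergodic theorem -/

section Ergodic

variable {E : Type*} [NormedAddCommGroup E] [NormedSpace ℝ E] [FiniteDimensional ℝ E]
  [MeasureSpace E] [BorelSpace E] [(volume : Measure E).IsAddHaarMeasure]
  {Ω : Type*} [MeasurableSpace Ω] {P : Measure Ω} [IsProbabilityMeasure P]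
  {X : E → Ω → ℝ}

lemma measurable_comp_shift_samplePath (hX : Measurable (Function.uncurry X))
    {F : (E → ℝ) → ℝ} (hF : Measurable F) (ω : Ω) :
    Measurable fun t ↦ F (shift t (samplePath X ω)) :=
  hF.comp ((measurable_shift_samplePath hX).comp (measurable_id.prodMk measurable_const))

/-- The second integral is over $s+T$, and the common part $T\cap(s+T)$ cancels. Each of the two
differences that remain has volume $|T|-|T\cap(s+T)|$. -/
lemma abs_setIntegral_sub_vadd_le {f : E → ℝ} (hf : Measurable f) {C : ℝ}
    (hC : ∀ t, |f t| ≤ C) {T : Set E} (hTo : IsOpen T) (hTb : Bornology.IsBounded T) (s : E) :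
    |(∫ t in T, f t) - ∫ t in T, f (s + t)| ≤
      2 * C * (volume.real T - volume.real (T ∩ (s +ᵥ T))) := by
  have hsb : volume (s +ᵥ T) ≠ ∞ := by
    rw [measure_vadd]
    exact hTb.measure_lt_top.ne
  have hVt : volume T ≠ ∞ := hTb.measure_lt_top.ne
  have hsm : MeasurableSet (s +ᵥ T) := (hTo.vadd s).measurableSet
  have hi : ∀ A : Set E, volume A ≠ ∞ → IntegrableOn f A := fun A hA ↦
    Measure.integrableOn_of_bounded hA hf.aestronglyMeasurable
      (Eventually.of_forall fun t ↦ hC t)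
  have h1 : ∫ t in T, f (s + t) = ∫ t in s +ᵥ T, f t := by
    have := (measurePreserving_vadd s (volume : Measure E)).setIntegral_image_emb
      (measurableEmbedding_const_vadd s) f T
    rw [image_vadd] at this
    exact this.symm
  have hreal : volume.real (s +ᵥ T) = volume.real T := by
    rw [measureReal_def, measure_vadd, measureReal_def]
  have h2 := integral_inter_add_sdiff (μ := volume) (f := f) (s := T) hsm (hi T hVt)
  have h3 := integral_inter_add_sdiff (μ := volume) (f := f) (s := s +ᵥ T) hTo.measurableSet
    (hi _ hsb)
  have hb1 := norm_setIntegral_le_of_norm_le_const (μ := volume) (s := T \ (s +ᵥ T)) (f := f)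
    (C := C) ((measure_mono sdiff_subset).trans_lt hVt.lt_top) (fun t _ ↦ hC t)
  have hb2 := norm_setIntegral_le_of_norm_le_const (μ := volume) (s := (s +ᵥ T) \ T) (f := f)
    (C := C) ((measure_mono sdiff_subset).trans_lt hsb.lt_top) (fun t _ ↦ hC t)
  have hm1 := measureReal_inter_add_sdiff (μ := volume) (s := T) hsm hVt
  have hm2 := measureReal_inter_add_sdiff (μ := volume) (s := s +ᵥ T) hTo.measurableSet hsb
  rw [inter_comm (s +ᵥ T) T] at h3 hm2
  rw [hreal] at hm2
  rw [h1, ← h2, ← h3, add_sub_add_left_eq_sub]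
  rw [Real.norm_eq_abs] at hb1 hb2
  calc _ ≤ _ + _ := abs_sub _ _
    _ ≤ C * volume.real (T \ (s +ᵥ T)) + C * volume.real ((s +ᵥ T) \ T) := add_le_add hb1 hb2
    _ = _ := by
      rw [show volume.real (T \ (s +ᵥ T)) = volume.real T - volume.real (T ∩ (s +ᵥ T)) by linarith,
        show volume.real ((s +ᵥ T) \ T) = volume.real T - volume.real (T ∩ (s +ᵥ T)) by linarith]
      ring

/-- Spatial averages of bounded coboundaries vanish asymptotically. -/
lemma tendsto_shiftAverage_coboundary (hX : Measurable (Function.uncurry X)) {T : ℕ → Set E}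
    (hconv : ∀ n, Convex ℝ (T n)) (hopen : ∀ n, IsOpen (T n))
    (hbdd : ∀ n, Bornology.IsBounded (T n)) (hne : ∀ n, (T n).Nonempty)
    {c : ℕ → E} {r : ℕ → ℝ} (hr : Tendsto r atTop atTop)
    (hball : ∀ n, Metric.ball (c n) (r n) ⊆ T n) {h : (E → ℝ) → ℝ} (hh : Measurable h)
    {C : ℝ} (hC : ∀ x, |h x| ≤ C) (s : E) (ω : Ω) :
    Tendsto (fun n ↦ shiftAverage (fun x ↦ h x - h (shift s x)) (T n) (samplePath X ω))
      atTop (𝓝 0) := by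
  set d := Module.finrank ℝ E
  -- The added 1 gives the strict inequality $\|s\|<\rho_n r_n$ and keeps $\rho_n$ positive when
  -- $s=0$.
  set ρ : ℕ → ℝ := fun n ↦ (‖s‖ + 1) / r n with hρ
  have hρlim : Tendsto ρ atTop (𝓝 0) := hr.const_div_atTop _
  have hlim : Tendsto (fun n ↦ 2 * C * (1 - (1 - ρ n) ^ d)) atTop (𝓝 0) := by
    have : Tendsto (fun n ↦ 2 * C * (1 - (1 - ρ n) ^ d)) atTop
        (𝓝 (2 * C * (1 - (1 - 0) ^ d))) :=
      ((tendsto_const_nhds.sub hρlim).pow d).const_sub 1 |>.const_mul (2 * C)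
    simpa using this
  refine squeeze_zero_norm' ?_ hlim
  filter_upwards [hρlim.eventually_le_const zero_lt_one, hr.eventually_gt_atTop 0] with n hn1 hn0
  have hρ0 : 0 < ρ n := by positivity
  have hrn : ‖s‖ < ρ n * r n := by
    rw [hρ, div_mul_cancel₀ _ hn0.ne']
    linarith
  have hV0 : volume (T n) ≠ 0 := ((hopen n).measure_pos volume (hne n)).ne'
  have hVt : volume (T n) ≠ ∞ := (hbdd n).measure_lt_top.ne
  have hVpos : 0 < volume.real (T n) := ENNReal.toReal_pos hV0 hVt
  have hC0 : 0 ≤ C := (abs_nonneg _).trans (hC 0)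
  have hvol := ENNReal.toReal_mono ((measure_mono inter_subset_left).trans_lt hVt.lt_top).ne
    (volume_inter_vadd_ge (hconv n) hρ0 hn1 (hball n) hrn)
  rw [ENNReal.toReal_mul, ENNReal.toReal_ofReal (pow_nonneg (sub_nonneg.2 hn1) _)] at hvol
  have hf := measurable_comp_shift_samplePath hX hh ω
  have hmain := abs_setIntegral_sub_vadd_le hf (fun t ↦ hC _) (hopen n) (hbdd n) s
  have hi : ∀ g : E → ℝ, Measurable g → (∀ t, |g t| ≤ C) → IntegrableOn g (T n) := fun g hg hgC ↦
    Measure.integrableOn_of_bounded hVt hg.aestronglyMeasurable (Eventually.of_forall hgC)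
  have heq : ∫ t in T n, (h (shift t (samplePath X ω)) - h (shift s (shift t (samplePath X ω)))) =
      (∫ t in T n, h (shift t (samplePath X ω))) -
        ∫ t in T n, h (shift (s + t) (samplePath X ω)) := by
    simp_rw [shift_shift]
    exact integral_sub (hi _ hf fun t ↦ hC _)
      (hi _ (hf.comp (measurable_const.add measurable_id)) fun t ↦ hC _)
  rw [shiftAverage, setAverage_eq, heq, norm_smul, norm_inv, Real.norm_eq_abs, Real.norm_eq_abs,
    abs_of_pos hVpos, inv_mul_le_iff₀ hVpos]
  refine hmain.trans ?_
  have : 2 * C * (volume.real (T n) - volume.real (T n ∩ (s +ᵥ T n))) ≤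
      2 * C * (volume.real (T n) - (1 - ρ n) ^ d * volume.real (T n)) := by
    gcongr
    exact hvol
  refine this.trans_eq ?_
  ring

/-- Functionals that behave like bounded coboundaries of the shift: their spatial averages
vanish asymptotically, and so do their integrals over invariant events. -/
structure IsNull (X : E → Ω → ℝ) (P : Measure Ω) (T : ℕ → Set E) (g : (E → ℝ) → ℝ) :
    Prop where
  measurable : Measurable g
  bounded : ∃ C, ∀ x, |g x| ≤ C
  tendsto : ∀ ω, Tendsto (fun n ↦ shiftAverage g (T n) (samplePath X ω)) atTop (𝓝 0)
  setIntegral : ∀ A, MeasurableSet[pathInvariants (P.map (samplePath X))] A →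
    ∫ x in A, g x ∂(P.map (samplePath X)) = 0

lemma IsNull.zero {T : ℕ → Set E} : IsNull X P T (fun _ ↦ 0) where
  measurable := measurable_const
  bounded := ⟨0, by simp⟩
  tendsto := by simp [shiftAverage, average]
  setIntegral := by simp

lemma integrableOn_comp_shift_samplePath (hX : Measurable (Function.uncurry X))
    {g : (E → ℝ) → ℝ} (hg : Measurable g) (hb : ∃ C, ∀ x, |g x| ≤ C) {T : Set E}
    (hTb : Bornology.IsBounded T) (ω : Ω) :
    IntegrableOn (fun t ↦ g (shift t (samplePath X ω))) T := by
  obtain ⟨C, hC⟩ := hb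
  exact Measure.integrableOn_of_bounded hTb.measure_lt_top.ne
    (measurable_comp_shift_samplePath hX hg ω).aestronglyMeasurable
    (Eventually.of_forall fun _ ↦ hC _)

lemma shiftAverage_add {F G : (E → ℝ) → ℝ} {T : Set E} {x : E → ℝ}
    (hF : IntegrableOn (fun t ↦ F (shift t x)) T) (hG : IntegrableOn (fun t ↦ G (shift t x)) T) :
    shiftAverage (fun y ↦ F y + G y) T x = shiftAverage F T x + shiftAverage G T x := by
  simp_rw [shiftAverage, setAverage_eq]
  rw [integral_add hF hG, smul_add]

lemma isProbabilityMeasure_map_samplePath (hX : Measurable (Function.uncurry X)) :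
    IsProbabilityMeasure (P.map (samplePath X)) :=
  Measure.isProbabilityMeasure_map (measurable_samplePath hX).aemeasurable

lemma IsNull.add (hX : Measurable (Function.uncurry X)) {T : ℕ → Set E}
    (hbdd : ∀ n, Bornology.IsBounded (T n)) {g g' : (E → ℝ) → ℝ}
    (hg : IsNull X P T g) (hg' : IsNull X P T g') : IsNull X P T (fun x ↦ g x + g' x) where
  measurable := hg.measurable.add hg'.measurable
  bounded := by
    obtain ⟨C, hC⟩ := hg.bounded
    obtain ⟨C', hC'⟩ := hg'.bounded
    exact ⟨C + C', fun x ↦ (abs_add_le _ _).trans (add_le_add (hC x) (hC' x))⟩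
  tendsto ω := by
    have := (hg.tendsto ω).add (hg'.tendsto ω)
    rw [add_zero] at this
    refine this.congr fun n ↦ (shiftAverage_add ?_ ?_).symm
    · exact integrableOn_comp_shift_samplePath hX hg.measurable hg.bounded (hbdd n) ω
    · exact integrableOn_comp_shift_samplePath hX hg'.measurable hg'.bounded (hbdd n) ω
  setIntegral A hA := by
    have := isProbabilityMeasure_map_samplePath (P := P) hX
    obtain ⟨C, hC⟩ := hg.bounded
    obtain ⟨C', hC'⟩ := hg'.bounded
    rw [integral_add (Integrable.of_bound hg.measurable.aestronglyMeasurable C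
        (Eventually.of_forall hC)) (Integrable.of_bound hg'.measurable.aestronglyMeasurable C'
        (Eventually.of_forall hC')),
      hg.setIntegral A hA, hg'.setIntegral A hA, add_zero]

lemma IsNull.const_mul {T : ℕ → Set E} {g : (E → ℝ) → ℝ} (a : ℝ) (hg : IsNull X P T g) :
    IsNull X P T (fun x ↦ a * g x) where
  measurable := hg.measurable.const_mul a
  bounded := by
    obtain ⟨C, hC⟩ := hg.bounded
    refine ⟨|a| * C, fun x ↦ ?_⟩
    rw [abs_mul]
    exact mul_le_mul_of_nonneg_left (hC x) (abs_nonneg a)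
  tendsto ω := by
    have := (hg.tendsto ω).const_mul a
    rw [mul_zero] at this
    refine this.congr fun n ↦ ?_
    simp_rw [shiftAverage, setAverage_eq, integral_const_mul, smul_eq_mul]
    ring
  setIntegral A hA := by
    rw [integral_const_mul, hg.setIntegral A hA, mul_zero]

/-- The generating coboundaries. Over an invariant event $A$ the integrals cancel because
$\gamma_s^{-1}B\cap A$ equals $\gamma_s^{-1}(B\cap A)$ mod null sets and the shift preserves the
path law. -/
lemma isNull_indicator_sub (hX : Measurable (Function.uncurry X)) (hhom : IsHomogeneous X P)
    {T : ℕ → Set E}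
    (hconv : ∀ n, Convex ℝ (T n)) (hopen : ∀ n, IsOpen (T n))
    (hbdd : ∀ n, Bornology.IsBounded (T n)) (hne : ∀ n, (T n).Nonempty)
    {c : ℕ → E} {r : ℕ → ℝ} (hr : Tendsto r atTop atTop)
    (hball : ∀ n, Metric.ball (c n) (r n) ⊆ T n) {B : Set (E → ℝ)} (hB : MeasurableSet B)
    (s : E) :
    IsNull X P T (fun x ↦ B.indicator 1 x - (shift s ⁻¹' B).indicator (1 : (E → ℝ) → ℝ) x) := by
  have hBm : Measurable (B.indicator (1 : (E → ℝ) → ℝ)) := measurable_one.indicator hB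
  have hle : ∀ (B : Set (E → ℝ)) x, |B.indicator (1 : (E → ℝ) → ℝ) x| ≤ 1 := by
    intro B x
    by_cases hx : x ∈ B <;> simp [hx]
  have hsB : MeasurableSet (shift s ⁻¹' B) := measurable_shift s hB
  have hBm' : Measurable ((shift s ⁻¹' B).indicator (1 : (E → ℝ) → ℝ)) :=
    measurable_one.indicator hsB
  refine ⟨hBm.sub hBm', ⟨2, fun x ↦ ?_⟩, fun ω ↦ ?_, fun A hA ↦ ?_⟩
  · exact (abs_sub _ _).trans (by linarith [hle B x, hle (shift s ⁻¹' B) x])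
  · exact tendsto_shiftAverage_coboundary hX hconv hopen hbdd hne hr hball hBm (hle B) s ω
  · have := isProbabilityMeasure_map_samplePath (P := P) hX
    rw [integral_sub, integral_indicator_one hB, integral_indicator_one hsB, sub_eq_zero,
      measureReal_restrict_apply hB, measureReal_restrict_apply hsB]
    · have h1 : (shift s ⁻¹' B ∩ A : Set (E → ℝ)) =ᵐ[P.map (samplePath X)]
          shift s ⁻¹' (B ∩ A) := by
        rw [preimage_inter]
        exact (ae_eq_refl _).inter (hA.2 s).symm
      rw [measureReal_congr h1, measureReal_def, measureReal_def,
        (measurePreserving_shift hX hhom s).measure_preimage (hB.inter hA.1).nullMeasurableSet]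
    · exact Integrable.of_bound hBm.aestronglyMeasurable 1 (Eventually.of_forall (hle B))
    · exact Integrable.of_bound hBm'.aestronglyMeasurable 1 (Eventually.of_forall (hle _))

/-- The hypothesis is orthogonality to all $1_B-1_{\gamma_t^{-1}B}$. Taking $B=\gamma_{-t}^{-1}A$
and changing variables gives $\int_A u\circ\gamma_t=\int_B u=\int_A u$ for every event $A$. -/
lemma ae_eq_comp_shift_of_setIntegral (hX : Measurable (Function.uncurry X))
    (hhom : IsHomogeneous X P) {u : (E → ℝ) → ℝ} (hui : Integrable u (P.map (samplePath X)))
    (hu : ∀ (t : E) (B : Set (E → ℝ)), MeasurableSet B →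
      ∫ x in B, u x ∂(P.map (samplePath X)) = ∫ x in shift t ⁻¹' B, u x ∂(P.map (samplePath X)))
    (t : E) : u ∘ shift t =ᵐ[P.map (samplePath X)] u := by
  have hmp := measurePreserving_shift hX hhom t
  refine Integrable.ae_eq_of_forall_setIntegral_eq _ _ (hmp.integrable_comp_of_integrable hui)
    hui fun A hA _ ↦ ?_
  have hA' : shift t ⁻¹' (shift (-t) ⁻¹' A) = A := by
    ext x
    simp [shift_shift, shift_zero]
  have hAm : MeasurableSet (shift (-t) ⁻¹' A) := measurable_shift _ hA
  have h1 := hu t _ hAm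
  rw [hA'] at h1
  rw [← h1]
  have h2 := setIntegral_map (μ := P.map (samplePath X)) (g := shift t) (f := u) hAm
    (by rw [hmp.map_eq]; exact hui.aestronglyMeasurable) hmp.measurable.aemeasurable
  rw [hmp.map_eq, hA'] at h2
  exact h2.symm

/-- Every integrable functional is the sum of an invariant one, a combination of bounded
coboundaries and an error that is small in mean. -/
lemma exists_invariant_add_isNull (hX : Measurable (Function.uncurry X))
    (hhom : IsHomogeneous X P) {T : ℕ → Set E}
    (hconv : ∀ n, Convex ℝ (T n)) (hopen : ∀ n, IsOpen (T n))
    (hbdd : ∀ n, Bornology.IsBounded (T n)) (hne : ∀ n, (T n).Nonempty)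
    {c : ℕ → E} {r : ℕ → ℝ} (hr : Tendsto r atTop atTop)
    (hball : ∀ n, Metric.ball (c n) (r n) ⊆ T n) {F : (E → ℝ) → ℝ}
    (hFi : Integrable F (P.map (samplePath X))) {ε : ℝ} (hε : 0 < ε) :
    ∃ u g : (E → ℝ) → ℝ, Measurable u ∧ Integrable u (P.map (samplePath X)) ∧
      (∀ t, u ∘ shift t =ᵐ[P.map (samplePath X)] u) ∧ IsNull X P T g ∧
      ∫⁻ x, ‖F x - (u x + g x)‖ₑ ∂(P.map (samplePath X)) ≤ ENNReal.ofReal ε := by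
  have := isProbabilityMeasure_map_samplePath (P := P) hX
  set ν := P.map (samplePath X) with hν
  have hind : ∀ B : Set (E → ℝ), MeasurableSet B → ν B ≠ ∞ := fun B _ ↦ measure_ne_top _ _
  -- `F` is only integrable; a simple function within $\varepsilon/2$ in $L^1$ brings the problem
  -- into $L^2$.
  obtain ⟨F', hFF', -⟩ := (memLp_one_iff_integrable.2 hFi).exists_simpleFunc_eLpNorm_sub_lt
    (by simp) (ε := ENNReal.ofReal (ε / 2)) (by simpa using hε)
  have hF'2 : MemLp F' 2 ν := F'.memLp_of_isFiniteMeasure 2 ν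
  let G : Set (Lp ℝ 2 ν) := {f | ∃ (t : E) (B : Set (E → ℝ)) (hB : MeasurableSet B),
    f = indicatorConstLp 2 hB (measure_ne_top ν _) (1 : ℝ) -
      indicatorConstLp 2 (measurable_shift t hB) (measure_ne_top ν _) (1 : ℝ)}
  let K : Submodule ℝ (Lp ℝ 2 ν) := Submodule.span ℝ G
  have hKnull : ∀ f ∈ K, ∃ g, IsNull X P T g ∧ f =ᵐ[ν] g := by
    intro f hf
    induction hf using Submodule.span_induction with
    | mem f hf =>
      obtain ⟨t, B, hB, rfl⟩ := hf
      refine ⟨_, isNull_indicator_sub hX hhom hconv hopen hbdd hne hr hball hB t, ?_⟩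
      filter_upwards [Lp.coeFn_sub (indicatorConstLp 2 hB (measure_ne_top ν _) (1 : ℝ))
        (indicatorConstLp 2 (measurable_shift t hB) (measure_ne_top ν _) (1 : ℝ)),
        indicatorConstLp_coeFn (p := 2) (hs := hB) (hμs := measure_ne_top ν _) (c := (1 : ℝ)),
        indicatorConstLp_coeFn (p := 2) (hs := measurable_shift t hB)
          (hμs := measure_ne_top ν _) (c := (1 : ℝ))] with x h1 h2 h3
      rw [h1, Pi.sub_apply, h2, h3]
      rfl
    | zero => exact ⟨_, IsNull.zero, Lp.coeFn_zero _ _ _⟩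
    | add f f' _ _ h h' =>
      obtain ⟨g, hg, hfg⟩ := h
      obtain ⟨g', hg', hfg'⟩ := h'
      refine ⟨_, hg.add hX hbdd hg', ?_⟩
      filter_upwards [Lp.coeFn_add f f', hfg, hfg'] with x h1 h2 h3
      rw [h1, Pi.add_apply, h2, h3]
    | smul a f _ h =>
      obtain ⟨g, hg, hfg⟩ := h
      refine ⟨_, hg.const_mul a, ?_⟩
      filter_upwards [Lp.coeFn_smul a f, hfg] with x h1 h2
      rw [h1, Pi.smul_apply, h2, smul_eq_mul]
  -- Orthogonal splitting along the closed span of the coboundaries: `u` is the invariant part. The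
  -- component `k` is only a limit of combinations of coboundaries, so a true combination `k'`
  -- replaces it at the cost of the other $\varepsilon/2$.
  obtain ⟨k, hk, u, hu, hku⟩ :=
    K.topologicalClosure.exists_add_mem_mem_orthogonal (hF'2.toLp F')
  rw [← SetLike.mem_coe, Submodule.topologicalClosure_coe, Metric.mem_closure_iff] at hk
  obtain ⟨k', hk', hdist⟩ := hk (ε / 2) (by positivity)
  obtain ⟨g, hg, hkg⟩ := hKnull k' hk'
  have hui : Integrable u ν := (Lp.memLp u).integrable (by norm_num)
  refine ⟨u, g, (Lp.stronglyMeasurable u).measurable, hui, ?_, hg, ?_⟩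
  · refine ae_eq_comp_shift_of_setIntegral hX hhom hui fun t B hB ↦ ?_
    have h1 : (indicatorConstLp 2 hB (measure_ne_top ν _) (1 : ℝ) -
        indicatorConstLp 2 (measurable_shift t hB) (measure_ne_top ν _) (1 : ℝ)) ∈
          K.topologicalClosure :=
      K.le_topologicalClosure (Submodule.subset_span ⟨t, B, hB, rfl⟩)
    have h2 := (Submodule.mem_orthogonal _ _).1 hu _ h1
    rw [inner_sub_left, L2.inner_indicatorConstLp_one, L2.inner_indicatorConstLp_one,
      sub_eq_zero] at h2
    exact h2
  · have h1 : ∀ᵐ x ∂ν, F' x - (u x + g x) = (k - k' : Lp ℝ 2 ν) x := by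
      filter_upwards [hF'2.coeFn_toLp, Lp.coeFn_add k u, Lp.coeFn_sub k k', hkg]
        with x e1 e2 e3 e4
      rw [e3, Pi.sub_apply, e4, ← e1, hku, e2, Pi.add_apply]
      ring
    have hgm := hg.measurable
    have h2 : eLpNorm (fun x ↦ F' x - (u x + g x)) 1 ν ≤ ENNReal.ofReal (ε / 2) := by
      rw [eLpNorm_congr_ae h1]
      refine (eLpNorm_le_eLpNorm_of_exponent_le (by norm_num : (1 : ℝ≥0∞) ≤ 2)
        (Lp.aestronglyMeasurable _)).trans ?_
      rw [dist_eq_norm, Lp.norm_def] at hdist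
      rw [← ENNReal.ofReal_toReal (Lp.eLpNorm_ne_top (k - k'))]
      exact ENNReal.ofReal_le_ofReal hdist.le
    rw [← eLpNorm_one_eq_lintegral_enorm]
    have h3 : (fun x ↦ F x - (u x + g x)) = (F - F') + fun x ↦ F' x - (u x + g x) := by
      funext x
      simp
    rw [h3]
    refine (eLpNorm_add_le (hFi.1.sub F'.aestronglyMeasurable)
      (F'.aestronglyMeasurable.sub (hui.1.add hgm.aestronglyMeasurable)) le_rfl).trans ?_
    calc _ ≤ ENNReal.ofReal (ε / 2) + ENNReal.ofReal (ε / 2) := add_le_add hFF'.le h2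
      _ = _ := by rw [← ENNReal.ofReal_add (by positivity) (by positivity), add_halves]

lemma invariantEvents_le (hX : Measurable (Function.uncurry X)) :
    invariantEvents X P ≤ ‹MeasurableSpace Ω› := by
  rintro _ ⟨A, hA, rfl⟩
  exact measurable_samplePath hX hA.1

/-- Since invariant events are defined mod null sets, almost sure invariance of `u` under each shift
already puts every $u^{-1}(B)$ among them. -/
lemma condExp_comp_samplePath_of_invariant (hX : Measurable (Function.uncurry X))
    {u : (E → ℝ) → ℝ} (hum : Measurable u) (hui : Integrable u (P.map (samplePath X)))
    (hu : ∀ t, u ∘ shift t =ᵐ[P.map (samplePath X)] u) :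
    P[fun ω ↦ u (samplePath X ω) | invariantEvents X P] = fun ω ↦ u (samplePath X ω) := by
  refine condExp_of_stronglyMeasurable (invariantEvents_le hX) ?_
    (hui.comp_measurable (measurable_samplePath hX))
  refine Measurable.stronglyMeasurable ?_
  intro B hB
  refine ⟨u ⁻¹' B, ⟨hum hB, fun t ↦ ?_⟩, rfl⟩
  filter_upwards [hu t] with x hx
  refine propext ?_
  change u (shift t x) ∈ B ↔ u x ∈ B
  rw [← hx]
  rfl

lemma condExp_comp_samplePath_of_isNull (hX : Measurable (Function.uncurry X)) {T : ℕ → Set E}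
    {g : (E → ℝ) → ℝ} (hg : IsNull X P T g) :
    P[fun ω ↦ g (samplePath X ω) | invariantEvents X P] =ᵐ[P] 0 := by
  obtain ⟨C, hC⟩ := hg.bounded
  have hpath := measurable_samplePath hX
  refine (ae_eq_condExp_of_forall_setIntegral_eq (invariantEvents_le hX)
    (Integrable.of_bound (hg.measurable.comp hpath).aestronglyMeasurable C
      (Eventually.of_forall fun _ ↦ hC _)) (fun _ _ _ ↦ integrableOn_zero) ?_
    aestronglyMeasurable_zero).symm
  rintro _ ⟨A, hA, rfl⟩ -
  have h := hg.setIntegral A hA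
  rw [setIntegral_map hA.1 hg.measurable.aestronglyMeasurable hpath.aemeasurable] at h
  simp only [integral_zero]
  exact h.symm

/-- The pointwise ergodic theorem for homogeneous fields. -/
theorem ae_tendsto_shiftAverage (hX : Measurable (Function.uncurry X))
    (hhom : IsHomogeneous X P) {T : ℕ → Set E} (hmono : Monotone T)
    (hconv : ∀ n, Convex ℝ (T n)) (hopen : ∀ n, IsOpen (T n))
    (hbdd : ∀ n, Bornology.IsBounded (T n)) (hne : ∀ n, (T n).Nonempty)
    {c : ℕ → E} {r : ℕ → ℝ} (hr : Tendsto r atTop atTop)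
    (hball : ∀ n, Metric.ball (c n) (r n) ⊆ T n) {F : (E → ℝ) → ℝ} (hF : Measurable F)
    (hFi : Integrable F (P.map (samplePath X))) :
    ∀ᵐ ω ∂P, Tendsto (fun n ↦ shiftAverage F (T n) (samplePath X ω)) atTop
      (𝓝 (P[fun ω ↦ F (samplePath X ω) | invariantEvents X P] ω)) := by
  have hpath := measurable_samplePath hX
  set L := P[fun ω ↦ F (samplePath X ω) | invariantEvents X P] with hL
  -- The three errors, each at most `a`, are the average of the coboundary part, the average of the
  -- remainder `e`, and the conditional expectation of `e`. The first is eventually small for every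
  -- $\omega$; the other two fail with probability $O(\varepsilon/a)$, for $\varepsilon$ arbitrary.
  have key : ∀ a : ℝ, 0 < a → ∀ᵐ ω ∂P,
      ∀ᶠ n in atTop, |shiftAverage F (T n) (samplePath X ω) - L ω| ≤ 3 * a := by
    intro a ha
    rw [ae_iff]
    set B := {ω | ¬ ∀ᶠ n in atTop, |shiftAverage F (T n) (samplePath X ω) - L ω| ≤ 3 * a}
    have hbound : ∀ ε : ℝ, 0 < ε → ENNReal.ofReal a * P B ≤
        (8 ^ Module.finrank ℝ E + 1) * ENNReal.ofReal ε := by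
      intro ε hε
      obtain ⟨u, g, hum, hui, hu, hg, hle⟩ :=
        exists_invariant_add_isNull hX hhom hconv hopen hbdd hne hr hball hFi hε
      obtain ⟨C, hC⟩ := hg.bounded
      have := isProbabilityMeasure_map_samplePath (P := P) hX
      have hgi : Integrable g (P.map (samplePath X)) :=
        Integrable.of_bound hg.measurable.aestronglyMeasurable C (Eventually.of_forall hC)
      set e : (E → ℝ) → ℝ := fun x ↦ F x - (u x + g x) with he
      have hem : Measurable e := hF.sub (hum.add hg.measurable)
      have hei : Integrable e (P.map (samplePath X)) := hFi.sub (hui.add hgi)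
      set Le := P[fun ω ↦ e (samplePath X ω) | invariantEvents X P]
      have hLe : L =ᵐ[P] fun ω ↦ u (samplePath X ω) + Le ω := by
        have hFe : (fun ω ↦ F (samplePath X ω)) =
            ((fun ω ↦ u (samplePath X ω)) + fun ω ↦ g (samplePath X ω)) +
              fun ω ↦ e (samplePath X ω) := by
          funext ω
          simp [he]
        have hu' := hui.comp_measurable hpath
        have hg' := hgi.comp_measurable hpath
        have he' := hei.comp_measurable hpath
        have h1 := condExp_add (hu'.add hg') he' (invariantEvents X P)
        have h2 := condExp_add hu' hg' (invariantEvents X P)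
        have h3 := condExp_comp_samplePath_of_isNull hX hg
        have h4 := condExp_comp_samplePath_of_invariant hX hum hui hu
        rw [hL, hFe]
        filter_upwards [h1, h2, h3] with ω e1 e2 e3
        refine e1.trans ?_
        rw [Pi.add_apply]
        congr 1
        refine e2.trans ?_
        have h4' := congrFun h4 ω
        exact (congrArg₂ (fun a b : ℝ ↦ a + b) h4' e3).trans (add_zero _)
      -- Invariance holds almost surely for each fixed $t$. Fubini gives it, for almost every
      -- $\omega$, at almost every $t\in T_n$, so the average is exactly `u`.
      have hinv : ∀ᵐ ω ∂P, ∀ n, shiftAverage u (T n) (samplePath X ω) = u (samplePath X ω) := by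
        refine ae_all_iff.2 fun n ↦ ?_
        have h1 : ∀ᵐ t ∂(volume.restrict (T n)), ∀ᵐ ω ∂P,
            u (shift t (samplePath X ω)) = u (samplePath X ω) :=
          Eventually.of_forall fun t ↦ ae_of_ae_map hpath.aemeasurable (hu t)
        rw [Measure.ae_ae_comm] at h1
        · filter_upwards [h1] with ω hω
          rw [shiftAverage, average_congr hω, setAverage_const]
          · exact ((hopen n).measure_pos volume (hne n)).ne'
          · exact (hbdd n).measure_lt_top.ne
        · exact measurableSet_eq_fun (hum.comp (measurable_shift_samplePath hX))
            (hum.comp (hpath.comp measurable_snd))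
      have hintu : ∀ᵐ ω ∂P, ∀ n, IntegrableOn (fun t ↦ u (shift t (samplePath X ω))) (T n) := by
        refine ae_all_iff.2 fun n ↦ ?_
        have : IsFiniteMeasure (volume.restrict (T n)) :=
          ⟨by simpa using (hbdd n).measure_lt_top⟩
        have := ae_integrable_shift_samplePath hX hhom (volume.restrict (T n)) 0 hum hui
        simp_rw [shift_zero] at this
        exact this
      have hinte : ∀ᵐ ω ∂P, ∀ n, IntegrableOn (fun t ↦ e (shift t (samplePath X ω))) (T n) := by
        refine ae_all_iff.2 fun n ↦ ?_
        have : IsFiniteMeasure (volume.restrict (T n)) :=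
          ⟨by simpa using (hbdd n).measure_lt_top⟩
        have := ae_integrable_shift_samplePath hX hhom (volume.restrict (T n)) 0 hem hei
        simp_rw [shift_zero] at this
        exact this
      set B1 := {ω | ∃ n, a < |shiftAverage e (T n) (samplePath X ω)|}
      set B2 := {ω | ENNReal.ofReal a ≤ ‖Le ω‖ₑ}
      have hBsub : B ≤ᵐ[P] (B1 ∪ B2 : Set Ω) := by
        filter_upwards [hLe, hinv, hintu, hinte] with ω h1 h2 h3 h4 hω
        by_contra hcon
        have hcon' : ω ∉ B1 ∪ B2 := hcon
        simp only [mem_union, not_or, B1, B2, mem_ofPred_eq, not_exists, not_lt, not_le] at hcon'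
        refine hω ?_
        have h5 : |Le ω| < a := by
          have := hcon'.2
          rwa [Real.enorm_eq_ofReal_abs, ENNReal.ofReal_lt_ofReal_iff ha] at this
        filter_upwards [(hg.tendsto ω).abs.eventually_le_const (by simpa using ha : |(0 : ℝ)| < a)]
          with n hn
        have h6 : shiftAverage F (T n) (samplePath X ω) =
            shiftAverage u (T n) (samplePath X ω) + shiftAverage g (T n) (samplePath X ω) +
              shiftAverage e (T n) (samplePath X ω) := by
          have hgint := integrableOn_comp_shift_samplePath hX hg.measurable hg.bounded (hbdd n) ω
          rw [← shiftAverage_add (h3 n) hgint, ← shiftAverage_add ((h3 n).add hgint) (h4 n)]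
          congr 1
          funext x
          simp [he]
        have h7 := hcon'.1 n
        rw [h6, h1, h2]
        rw [abs_le] at hn h7 ⊢
        rw [abs_lt] at h5
        constructor <;> linarith [hn.1, hn.2, h7.1, h7.2, h5.1, h5.2]
      have hB1 := measure_maximal_le hX hhom hmono hconv hopen hbdd hne hem hei ha
      -- Markov's inequality and the $L^1$-contractivity of conditional expectation.
      have hB2 : ENNReal.ofReal a * P B2 ≤ ∫⁻ x, ‖e x‖ₑ ∂(P.map (samplePath X)) := by
        refine (mul_meas_ge_le_lintegral₀
          integrable_condExp.aestronglyMeasurable.enorm _).trans ?_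
        rw [← eLpNorm_one_eq_lintegral_enorm]
        refine (eLpNorm_condExp_le_eLpNorm _ le_rfl).trans_eq ?_
        rw [eLpNorm_one_eq_lintegral_enorm, lintegral_map hem.enorm hpath]
      calc ENNReal.ofReal a * P B ≤ ENNReal.ofReal a * (P B1 + P B2) := by
            gcongr
            exact (measure_mono_ae hBsub).trans (measure_union_le _ _)
        _ = ENNReal.ofReal a * P B1 + ENNReal.ofReal a * P B2 := mul_add _ _ _
        _ ≤ 8 ^ Module.finrank ℝ E * ∫⁻ x, ‖e x‖ₑ ∂(P.map (samplePath X)) +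
            ∫⁻ x, ‖e x‖ₑ ∂(P.map (samplePath X)) := add_le_add hB1 hB2
        _ = (8 ^ Module.finrank ℝ E + 1) * ∫⁻ x, ‖e x‖ₑ ∂(P.map (samplePath X)) := by ring
        _ ≤ _ := by gcongr
    have hlim : Tendsto (fun ε : ℝ ↦ (8 ^ Module.finrank ℝ E + 1) * ENNReal.ofReal ε) (𝓝[>] 0)
        (𝓝 0) := by
      have h1 : Tendsto (fun ε : ℝ ↦ ENNReal.ofReal ε) (𝓝[>] 0) (𝓝 0) := by
        have := (ENNReal.continuous_ofReal.tendsto 0).mono_left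
          (nhdsWithin_le_nhds (s := Ioi (0 : ℝ)))
        simpa using this
      have h2 := ENNReal.Tendsto.const_mul (a := (8 ^ Module.finrank ℝ E + 1 : ℝ≥0∞)) h1
        (Or.inr (by finiteness))
      simpa using h2
    have h0 : ENNReal.ofReal a * P B ≤ 0 :=
      ge_of_tendsto hlim (eventually_mem_nhdsWithin.mono fun ε hε ↦ hbound ε hε)
    have := mul_eq_zero.1 (le_zero_iff.1 h0)
    exact this.resolve_left (by simpa using ha)
  have hall : ∀ᵐ ω ∂P, ∀ j : ℕ, ∀ᶠ n in atTop,
      |shiftAverage F (T n) (samplePath X ω) - L ω| ≤ 3 * (1 / ((j : ℝ) + 1)) :=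
    ae_all_iff.2 fun j ↦ key _ (by positivity)
  filter_upwards [hall] with ω hω
  rw [Metric.tendsto_nhds]
  intro δ hδ
  obtain ⟨j, hj⟩ := exists_nat_one_div_lt (show 0 < δ / 3 by positivity)
  filter_upwards [hω j] with n hn
  rw [Real.dist_eq]
  linarith

end Ergodic

/-! ### Lindeberg's theorem for weighted row sums, and Ottaviani's inequality -/

section Array

/-- Factors are exchanged one at a time; the others have modulus at most 1. -/
lemma norm_prod_sub_prod_le {ι : Type*} (s : Finset ι) (a b : ι → ℂ) (ha : ∀ i ∈ s, ‖a i‖ ≤ 1)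
    (hb : ∀ i ∈ s, ‖b i‖ ≤ 1) :
    ‖∏ i ∈ s, a i - ∏ i ∈ s, b i‖ ≤ ∑ i ∈ s, ‖a i - b i‖ := by
  classical
  induction s using Finset.induction_on with
  | empty => simp
  | insert j s hj ih =>
    rw [Finset.prod_insert hj, Finset.prod_insert hj, Finset.sum_insert hj]
    have h1 : ‖∏ i ∈ s, b i‖ ≤ 1 := by
      rw [norm_prod]
      exact Finset.prod_le_one (fun _ _ ↦ norm_nonneg _)
        fun i hi ↦ hb i (Finset.mem_insert_of_mem hi)
    have h2 := ih (fun i hi ↦ ha i (Finset.mem_insert_of_mem hi))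
      fun i hi ↦ hb i (Finset.mem_insert_of_mem hi)
    have h3 : a j * ∏ i ∈ s, a i - b j * ∏ i ∈ s, b i =
        a j * (∏ i ∈ s, a i - ∏ i ∈ s, b i) + (a j - b j) * ∏ i ∈ s, b i := by ring
    rw [h3]
    refine (norm_add_le _ _).trans ?_
    rw [norm_mul, norm_mul, add_comm]
    refine add_le_add (mul_le_of_le_one_right (norm_nonneg _) h1) ?_
    exact (mul_le_of_le_one_left (norm_nonneg _) (ha j (Finset.mem_insert_self _ _))).trans h2

lemma norm_exp_mul_I_sub_le_pow_three {x : ℝ} (hx : |x| ≤ 1) :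
    ‖Complex.exp (x * Complex.I) - (1 + x * Complex.I - x ^ 2 / 2)‖ ≤ |x| ^ 3 := by
  have hn : ‖(x : ℂ) * Complex.I‖ = |x| := by simp
  have h := Complex.exp_bound (x := x * Complex.I) (by rwa [hn]) (n := 3) (by norm_num)
  rw [hn] at h
  have h2 : ∑ m ∈ Finset.range 3, ((x : ℂ) * Complex.I) ^ m / m.factorial =
      1 + x * Complex.I - x ^ 2 / 2 := by
    simp only [Finset.sum_range_succ, Finset.sum_range_zero, mul_pow, Nat.factorial,
      Complex.I_sq]
    push_cast
    ring
  rw [h2] at h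
  refine h.trans (mul_le_of_le_one_right (by positivity) ?_)
  norm_num [Nat.factorial]

lemma norm_exp_mul_I_sub_le_sq {x : ℝ} (hx : 1 ≤ |x|) :
    ‖Complex.exp (x * Complex.I) - (1 + x * Complex.I - x ^ 2 / 2)‖ ≤ 4 * x ^ 2 := by
  have h1 : ‖(1 : ℂ) + x * Complex.I - x ^ 2 / 2‖ ≤ 1 + |x| + x ^ 2 / 2 := by
    refine (norm_sub_le _ _).trans (add_le_add ((norm_add_le _ _).trans ?_) ?_)
    · simp
    · simp
  refine (norm_sub_le _ _).trans ?_
  rw [Complex.norm_exp_ofReal_mul_I]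
  have : x ^ 2 = |x| ^ 2 := (sq_abs x).symm
  nlinarith

variable {Ω : Type*} [MeasurableSpace Ω] {Q : Measure Ω} [IsProbabilityMeasure Q]

/-- The part of the second moment of `ξ` coming from the values larger than `ε`. -/
noncomputable def tailMoment (Q : Measure Ω) (ξ : Ω → ℝ) (ε : ℝ) : ℝ :=
  ∫ ω, {ω | ε < |ξ ω|}.indicator (fun ω ↦ ξ ω ^ 2) ω ∂Q

/-- Lindeberg's split at $|\xi|=\varepsilon$. Below it the cubic Taylor error is at most
$C^3\varepsilon\,\xi^2$; above it the quadratic bound $4C^2\xi^2$ feeds the tail moment. The bound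
depends on the weight only through $C$, hence is uniform over a row. -/
lemma norm_integral_exp_sub_le {ξ : Ω → ℝ} (hξ : Measurable ξ) (hξ2 : MemLp ξ 2 Q)
    (hmean : ∫ ω, ξ ω ∂Q = 0) {w C ε : ℝ} (hw : |w| ≤ C) (hε : 0 < ε) (hCε : C * ε ≤ 1) :
    ‖∫ ω, Complex.exp ((w * ξ ω : ℝ) * Complex.I) ∂Q -
      ((1 - w ^ 2 * (∫ ω, ξ ω ^ 2 ∂Q) / 2 : ℝ) : ℂ)‖ ≤
      C ^ 3 * ε * (∫ ω, ξ ω ^ 2 ∂Q) + 4 * C ^ 2 * tailMoment Q ξ ε := by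
  have hC : 0 ≤ C := (abs_nonneg _).trans hw
  have hi1 : Integrable ξ Q := hξ2.integrable (by norm_num)
  have hi2 : Integrable (fun ω ↦ ξ ω ^ 2) Q := hξ2.integrable_sq
  have hi3 : Integrable ({ω | ε < |ξ ω|}.indicator (fun ω ↦ ξ ω ^ 2)) Q :=
    hi2.indicator (measurableSet_lt measurable_const (measurable_norm.comp hξ))
  have hie : Integrable (fun ω ↦ Complex.exp ((w * ξ ω : ℝ) * Complex.I)) Q := by
    refine Integrable.of_bound (by fun_prop) 1 (Eventually.of_forall fun ω ↦ ?_)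
    rw [Complex.norm_exp_ofReal_mul_I]
  have hlin : Integrable (fun ω ↦ (1 : ℂ) + (w * ξ ω : ℝ) * Complex.I -
      ((w * ξ ω : ℝ) : ℂ) ^ 2 / 2) Q := by
    refine ((integrable_const _).add ((hi1.const_mul w).ofReal.mul_const _)).sub ?_
    have := ((hi2.const_mul (w ^ 2)).ofReal (𝕜 := ℂ)).div_const 2
    refine this.congr (Eventually.of_forall fun ω ↦ ?_)
    change ((w ^ 2 * ξ ω ^ 2 : ℝ) : ℂ) / 2 = _
    push_cast
    ring
  have heq : ∫ ω, ((1 : ℂ) + (w * ξ ω : ℝ) * Complex.I - ((w * ξ ω : ℝ) : ℂ) ^ 2 / 2) ∂Q =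
      ((1 - w ^ 2 * (∫ ω, ξ ω ^ 2 ∂Q) / 2 : ℝ) : ℂ) := by
    have e1 : ∀ ω, (1 : ℂ) + (w * ξ ω : ℝ) * Complex.I - ((w * ξ ω : ℝ) : ℂ) ^ 2 / 2 =
        (((1 : ℝ) - w ^ 2 / 2 * ξ ω ^ 2 : ℝ) : ℂ) + ((w * ξ ω : ℝ) : ℂ) * Complex.I := by
      intro ω
      push_cast
      ring
    simp_rw [e1]
    rw [integral_add, integral_mul_const, integral_complex_ofReal, integral_complex_ofReal,
      integral_const_mul, hmean, integral_sub (integrable_const _) (hi2.const_mul _),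
      integral_const_mul]
    · simp
      ring
    · exact ((integrable_const _).sub (hi2.const_mul _)).ofReal
    · exact (hi1.const_mul w).ofReal.mul_const _
  rw [← heq, ← integral_sub hie hlin]
  refine (norm_integral_le_integral_norm _).trans ?_
  rw [tailMoment, ← integral_const_mul, ← integral_const_mul,
    ← integral_add (hi2.const_mul _) (hi3.const_mul _)]
  refine integral_mono (hie.sub hlin).norm ((hi2.const_mul _).add (hi3.const_mul _)) fun ω ↦ ?_
  have hwx : |w * ξ ω| ≤ C * |ξ ω| := by
    rw [abs_mul]
    gcongr
  have hwx2 : (w * ξ ω) ^ 2 ≤ C ^ 2 * ξ ω ^ 2 := by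
    rw [← sq_abs, ← sq_abs (ξ ω), ← mul_pow]
    gcongr
  by_cases hω : ε < |ξ ω|
  · have e1 : {ω | ε < |ξ ω|}.indicator (fun ω ↦ ξ ω ^ 2) ω = ξ ω ^ 2 :=
      indicator_of_mem (show ω ∈ {ω | ε < |ξ ω|} from hω) _
    have e2 : 0 ≤ C ^ 3 * ε * ξ ω ^ 2 := by positivity
    simp only [e1]
    rcases le_total |w * ξ ω| 1 with h | h
    · refine (norm_exp_mul_I_sub_le_pow_three h).trans ?_
      have h3 : |w * ξ ω| ^ 3 ≤ (w * ξ ω) ^ 2 := by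
        rw [← sq_abs (w * ξ ω)]
        exact pow_le_pow_of_le_one (abs_nonneg _) h (by norm_num)
      nlinarith [sq_nonneg (ξ ω), mul_nonneg (sq_nonneg C) (sq_nonneg (ξ ω))]
    · refine (norm_exp_mul_I_sub_le_sq h).trans ?_
      linarith
  · have e1 : {ω | ε < |ξ ω|}.indicator (fun ω ↦ ξ ω ^ 2) ω = 0 :=
      indicator_of_notMem (show ω ∉ {ω | ε < |ξ ω|} from hω) _
    have hω' : |ξ ω| ≤ ε := not_lt.1 hω
    simp only [e1]
    have h : |w * ξ ω| ≤ C * ε := hwx.trans (by gcongr)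
    refine (norm_exp_mul_I_sub_le_pow_three (h.trans hCε)).trans ?_
    calc |w * ξ ω| ^ 3 = |w * ξ ω| * (w * ξ ω) ^ 2 := by rw [← sq_abs (w * ξ ω)]; ring
      _ ≤ (C * ε) * (C ^ 2 * ξ ω ^ 2) := by gcongr
      _ = C ^ 3 * ε * ξ ω ^ 2 + 4 * C ^ 2 * 0 := by ring

/-- Triangular arrays of row-wise independent centred variables, with the variances `1 / k n`
in the `n`-th row, that satisfy the Lindeberg condition. -/
structure IsLindebergArray {k : ℕ → ℕ} (ξ : ∀ n, Fin (k n) → Ω → ℝ) (Q : Measure Ω) :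
    Prop where
  measurable : ∀ n r, Measurable (ξ n r)
  indep : ∀ n, iIndepFun (ξ n) Q
  memLp : ∀ᶠ n in atTop, ∀ r, MemLp (ξ n r) 2 Q
  mean : ∀ᶠ n in atTop, ∀ r, ∫ ω, ξ n r ω ∂Q = 0
  integral_sq : ∀ᶠ n in atTop, ∀ r, ∫ ω, ξ n r ω ^ 2 ∂Q = 1 / k n
  lindeberg : ∀ ε : ℝ, 0 < ε → Tendsto (fun n ↦ ∑ r, tailMoment Q (ξ n r) ε) atTop (𝓝 0)

/-- The central limit theorem for weighted sums over the rows of a triangular array. -/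
lemma IsLindebergArray.tendsto_charFun {k : ℕ → ℕ} (hk : Tendsto k atTop atTop)
    {ξ : ∀ n, Fin (k n) → Ω → ℝ} (hξ : IsLindebergArray ξ Q) (w : ∀ n, Fin (k n) → ℝ) {C : ℝ}
    (hw : ∀ n r, |w n r| ≤ C) {v : ℝ}
    (hv : Tendsto (fun n ↦ (∑ r, w n r ^ 2) / k n) atTop (𝓝 v)) (u : ℝ) :
    Tendsto (fun n ↦ charFun (Q.map fun ω ↦ ∑ r, w n r * ξ n r ω) u) atTop
      (𝓝 (Complex.exp (-(v * u ^ 2 / 2) : ℝ))) := by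
  set φ : ∀ n, Fin (k n) → ℂ := fun n r ↦
    ∫ ω, Complex.exp ((u * w n r * ξ n r ω : ℝ) * Complex.I) ∂Q with hφ
  -- The characteristic function of a Gaussian summand with the same variance as $w\xi$. The product
  -- of these is explicit.
  set ψ : ∀ n, Fin (k n) → ℂ := fun n r ↦ Complex.exp ((-((u * w n r) ^ 2 / (2 * k n)) : ℝ) : ℂ)
    with hψ
  set D : ℝ := |u| * |C| with hD
  have hD0 : 0 ≤ D := by positivity
  have hwD : ∀ n r, |u * w n r| ≤ D := fun n r ↦ by
    rw [abs_mul]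
    exact mul_le_mul_of_nonneg_left ((hw n r).trans (le_abs_self C)) (abs_nonneg u)
  have hprod : ∀ n, charFun (Q.map fun ω ↦ ∑ r, w n r * ξ n r ω) u = ∏ r, φ n r := by
    intro n
    have hind : iIndepFun (fun r ω ↦ w n r * ξ n r ω) Q :=
      (hξ.indep n).comp (fun r x ↦ w n r * x) fun r ↦ measurable_const_mul _
    rw [hind.charFun_map_fun_sum_eq_prod
      fun r ↦ ((hξ.measurable n r).const_mul _).aemeasurable, Finset.prod_apply]
    refine Finset.prod_congr rfl fun r _ ↦ ?_
    rw [charFun_apply_real, integral_map ((hξ.measurable n r).const_mul _).aemeasurable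
      (by fun_prop)]
    refine integral_congr_ae (Eventually.of_forall fun ω ↦ ?_)
    simp only
    congr 2
    push_cast
    ring
  have hψprod : Tendsto (fun n ↦ ∏ r, ψ n r) atTop (𝓝 (Complex.exp (-(v * u ^ 2 / 2) : ℝ))) := by
    have h1 : ∀ n, ∏ r, ψ n r =
        Complex.exp ((-((∑ r, w n r ^ 2) / k n * u ^ 2 / 2) : ℝ) : ℂ) := by
      intro n
      rw [hψ, ← Complex.exp_sum, ← Complex.ofReal_sum]
      congr 2
      rw [Finset.sum_neg_distrib, Finset.sum_div, Finset.sum_mul, Finset.sum_div]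
      congr 1
      refine Finset.sum_congr rfl fun r _ ↦ ?_
      rw [mul_pow]
      field_simp
    simp_rw [h1]
    refine (Complex.continuous_exp.tendsto _).comp
      ((Complex.continuous_ofReal.tendsto _).comp ?_)
    exact ((hv.mul_const _).div_const _).neg
  -- Three errors below $\delta/3$, summed over the row: $D^3\varepsilon$ from the cubic term, the
  -- Lindeberg tail, and $D^4/k_n$ from replacing $1+x$ by $e^x$.
  have hdiff : Tendsto (fun n ↦ ∏ r, φ n r - ∏ r, ψ n r) atTop (𝓝 0) := by
    rw [Metric.tendsto_nhds]
    intro δ hδ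
    obtain ⟨ε, hε0, hε1, hε2⟩ : ∃ ε : ℝ, 0 < ε ∧ D * ε ≤ 1 ∧ D ^ 3 * ε < δ / 3 := by
      have h1 : Tendsto (fun ε : ℝ ↦ D * ε) (𝓝[>] 0) (𝓝 0) := by
        have : Tendsto (fun ε : ℝ ↦ D * ε) (𝓝 0) (𝓝 (D * 0)) := tendsto_id.const_mul D
        rw [mul_zero] at this
        exact this.mono_left nhdsWithin_le_nhds
      have h2 : Tendsto (fun ε : ℝ ↦ D ^ 3 * ε) (𝓝[>] 0) (𝓝 0) := by
        have : Tendsto (fun ε : ℝ ↦ D ^ 3 * ε) (𝓝 0) (𝓝 (D ^ 3 * 0)) := tendsto_id.const_mul _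
        rw [mul_zero] at this
        exact this.mono_left nhdsWithin_le_nhds
      obtain ⟨ε, h⟩ := (eventually_mem_nhdsWithin.and ((h1.eventually_le_const one_pos).and
        (h2.eventually_lt_const (show 0 < δ / 3 by positivity)))).exists
      exact ⟨ε, h⟩
    have hk' : Tendsto (fun n ↦ (k n : ℝ)) atTop atTop :=
      tendsto_natCast_atTop_atTop.comp hk
    have hL : Tendsto (fun n ↦ 4 * D ^ 2 * ∑ r, tailMoment Q (ξ n r) ε) atTop (𝓝 0) := by
      have := (hξ.lindeberg ε hε0).const_mul (4 * D ^ 2)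
      rwa [mul_zero] at this
    have hK : Tendsto (fun n ↦ D ^ 4 / (k n : ℝ)) atTop (𝓝 0) := hk'.const_div_atTop _
    filter_upwards [hξ.memLp, hξ.mean, hξ.integral_sq, hk'.eventually_ge_atTop (max 1 (D ^ 2)),
      hL.eventually_lt_const (show 0 < δ / 3 by positivity),
      hK.eventually_lt_const (show 0 < δ / 3 by positivity)] with n hn1 hn2 hn3 hn4 hn5 hn6
    have hkpos : (0 : ℝ) < k n := zero_lt_one.trans_le ((le_max_left _ _).trans hn4)
    have hkD : D ^ 2 ≤ k n := (le_max_right _ _).trans hn4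
    have hterm : ∀ r, ‖φ n r - ψ n r‖ ≤ D ^ 3 * ε * (1 / k n) +
        4 * D ^ 2 * tailMoment Q (ξ n r) ε + D ^ 4 / k n * (1 / k n) := by
      intro r
      have h1 := norm_integral_exp_sub_le (hξ.measurable n r) (hn1 r) (hn2 r) (hwD n r) hε0 hε1
      rw [hn3 r] at h1
      set x : ℝ := -((u * w n r) ^ 2 / (2 * k n)) with hx
      have hw2 : (u * w n r) ^ 2 ≤ D ^ 2 := by
        rw [← sq_abs]
        have := hwD n r
        gcongr
      have hxabs : |x| ≤ D ^ 2 / (2 * k n) := by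
        rw [hx, abs_neg, abs_of_nonneg (by positivity)]
        gcongr
      have hx1 : |x| ≤ 1 := hxabs.trans (by rw [div_le_one (by positivity)]; linarith)
      have h2 := Real.abs_exp_sub_one_sub_id_le hx1
      have h3 : x ^ 2 ≤ D ^ 4 / k n * (1 / k n) := by
        rw [← sq_abs]
        calc |x| ^ 2 ≤ (D ^ 2 / (2 * k n)) ^ 2 := by gcongr
          _ = D ^ 4 / k n * (1 / k n) / 4 := by field_simp; ring
          _ ≤ _ := by
            have : 0 ≤ D ^ 4 / k n * (1 / k n) := by positivity
            linarith
      have h4 : ‖((1 - (u * w n r) ^ 2 * (1 / (k n : ℝ)) / 2 : ℝ) : ℂ) - ψ n r‖ ≤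
          D ^ 4 / k n * (1 / k n) := by
        rw [hψ]
        simp only
        rw [← Complex.ofReal_exp, ← Complex.ofReal_sub, Complex.norm_real, Real.norm_eq_abs,
          abs_sub_comm]
        refine le_trans (le_of_eq ?_) (h2.trans h3)
        congr 1
        rw [hx]
        field_simp
        ring
      calc ‖φ n r - ψ n r‖ ≤ ‖φ n r - ((1 - (u * w n r) ^ 2 * (1 / (k n : ℝ)) / 2 : ℝ) : ℂ)‖ +
            ‖((1 - (u * w n r) ^ 2 * (1 / (k n : ℝ)) / 2 : ℝ) : ℂ) - ψ n r‖ :=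
            norm_sub_le_norm_sub_add_norm_sub _ _ _
        _ ≤ _ := add_le_add h1 h4
    have hφ1 : ∀ r ∈ Finset.univ, ‖φ n r‖ ≤ 1 := by
      intro r _
      refine (norm_integral_le_of_norm_le_const (C := 1) (Eventually.of_forall fun ω ↦ ?_)).trans
        (by simp)
      rw [Complex.norm_exp_ofReal_mul_I]
    have hψ1 : ∀ r ∈ Finset.univ, ‖ψ n r‖ ≤ 1 := by
      intro r _
      rw [hψ]
      simp only
      rw [← Complex.ofReal_exp, Complex.norm_real, Real.norm_eq_abs, Real.abs_exp,
        Real.exp_le_one_iff]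
      have : 0 ≤ (u * w n r) ^ 2 / (2 * k n) := by positivity
      linarith
    rw [dist_zero_right]
    calc _ ≤ ∑ r, ‖φ n r - ψ n r‖ := norm_prod_sub_prod_le _ _ _ hφ1 hψ1
      _ ≤ ∑ r, (D ^ 3 * ε * (1 / k n) + 4 * D ^ 2 * tailMoment Q (ξ n r) ε +
          D ^ 4 / k n * (1 / k n)) := Finset.sum_le_sum fun r _ ↦ hterm r
      _ = D ^ 3 * ε + 4 * D ^ 2 * ∑ r, tailMoment Q (ξ n r) ε + D ^ 4 / k n := by
        rw [Finset.sum_add_distrib, Finset.sum_add_distrib, Finset.sum_const,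
          Finset.sum_const, Finset.card_univ, Fintype.card_fin, nsmul_eq_mul, nsmul_eq_mul,
          ← Finset.mul_sum]
        field_simp
      _ < δ := by linarith
  simp_rw [hprod]
  have := hdiff.add hψprod
  simpa using this

/-- Partial sums of a row. -/
def cumSum {k : ℕ} (ξ : Fin k → Ω → ℝ) (j : ℕ) (ω : Ω) : ℝ :=
  ∑ r ∈ Finset.univ.filter (fun r : Fin k ↦ (r : ℕ) < j), ξ r ω

lemma measurable_cumSum {k : ℕ} {ξ : Fin k → Ω → ℝ} (hξ : ∀ r, Measurable (ξ r)) (j : ℕ) :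
    Measurable (cumSum ξ j) :=
  Finset.measurable_sum _ fun r _ ↦ hξ r

lemma cumSum_sub_cumSum {k : ℕ} (ξ : Fin k → Ω → ℝ) {a b : ℕ} (hab : a ≤ b) (ω : Ω) :
    cumSum ξ b ω - cumSum ξ a ω =
      ∑ r ∈ Finset.univ.filter (fun r : Fin k ↦ a ≤ (r : ℕ) ∧ (r : ℕ) < b), ξ r ω := by
  rw [cumSum, cumSum, sub_eq_iff_eq_add, ← Finset.sum_union]
  · refine Finset.sum_congr ?_ fun _ _ ↦ rfl
    ext r
    simp only [Finset.mem_filter, Finset.mem_univ, true_and, Finset.mem_union]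
    omega
  · rw [Finset.disjoint_left]
    intro r
    simp only [Finset.mem_filter, Finset.mem_univ, true_and]
    omega

/-- Ottaviani's maximal inequality. -/
lemma measure_exists_cumSum_le {k : ℕ} {ξ : Fin k → Ω → ℝ} (hξ : ∀ r, Measurable (ξ r))
    (hind : iIndepFun ξ Q) {a b : ℕ} {ε : ℝ}
    (hvar : ∀ j, a ≤ j → j ≤ b → Q {ω | ε ≤ |cumSum ξ b ω - cumSum ξ j ω|} ≤ 1 / 2) :
    Q {ω | ∃ j, a ≤ j ∧ j ≤ b ∧ 2 * ε < |cumSum ξ j ω - cumSum ξ a ω|} ≤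
      2 * Q {ω | ε ≤ |cumSum ξ b ω - cumSum ξ a ω|} := by
  classical
  -- `A j` says that level $2\varepsilon$ is first exceeded at $j$, and depends on the indices below
  -- $j$. `G j` says that the rest moves by less than $\varepsilon$, and depends on the indices from
  -- $j$ on. So they are independent, `G j` has probability at least $1/2$, and the disjoint events
  -- `A j ∩ G j` force the final increment to be at least $\varepsilon$.
  set A : ℕ → Set Ω := fun j ↦ {ω | 2 * ε < |cumSum ξ j ω - cumSum ξ a ω| ∧
    ∀ i, a ≤ i → i < j → |cumSum ξ i ω - cumSum ξ a ω| ≤ 2 * ε} with hA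
  set G : ℕ → Set Ω := fun j ↦ {ω | ε ≤ |cumSum ξ b ω - cumSum ξ j ω|}ᶜ with hG
  have hle : ∀ r, (inferInstance : MeasurableSpace ℝ).comap (ξ r) ≤ ‹MeasurableSpace Ω› :=
    fun r ↦ (hξ r).comap_le
  have hcs : ∀ j, Measurable (cumSum ξ j) := measurable_cumSum hξ
  have hGm : ∀ j, MeasurableSet (G j) := fun j ↦
    (measurableSet_le measurable_const (measurable_norm.comp ((hcs b).sub (hcs j)))).compl
  have hAm' : ∀ j, a ≤ j → MeasurableSet[⨆ r ∈ {r : Fin k | (r : ℕ) < j},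
      (inferInstance : MeasurableSpace ℝ).comap (ξ r)] (A j) := by
    intro j haj
    have hm : ∀ i ≤ j, Measurable[⨆ r ∈ {r : Fin k | (r : ℕ) < j},
        (inferInstance : MeasurableSpace ℝ).comap (ξ r)] (cumSum ξ i) := by
      intro i hij
      refine Finset.measurable_sum _ fun r hr ↦ ?_
      have hr' : (r : ℕ) < j := ((Finset.mem_filter.1 hr).2).trans_le hij
      have : (inferInstance : MeasurableSpace ℝ).comap (ξ r) ≤ ⨆ r ∈ {r : Fin k | (r : ℕ) < j},
          (inferInstance : MeasurableSpace ℝ).comap (ξ r) :=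
        le_iSup₂_of_le r hr' le_rfl
      exact (comap_measurable (ξ r)).mono this le_rfl
    have : A j = {ω | 2 * ε < |cumSum ξ j ω - cumSum ξ a ω|} ∩
        ⋂ i, ⋂ (_ : a ≤ i), ⋂ (_ : i < j), {ω | |cumSum ξ i ω - cumSum ξ a ω| ≤ 2 * ε} := by
      ext ω
      simp [hA]
    rw [this]
    refine MeasurableSet.inter ?_ (MeasurableSet.iInter fun i ↦ MeasurableSet.iInter fun _ ↦
      MeasurableSet.iInter fun hij ↦ ?_)
    · exact measurableSet_lt measurable_const
        (measurable_norm.comp ((hm j le_rfl).sub (hm a haj)))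
    · exact measurableSet_le (measurable_norm.comp ((hm i hij.le).sub (hm a haj)))
        measurable_const
  have hAm : ∀ j, a ≤ j → MeasurableSet (A j) := fun j hj ↦
    (iSup₂_le fun r _ ↦ hle r : (⨆ r ∈ {r : Fin k | (r : ℕ) < j},
      (inferInstance : MeasurableSpace ℝ).comap (ξ r)) ≤ _) _ (hAm' j hj)
  have hindep : ∀ j, a ≤ j → j ≤ b → Q (A j ∩ G j) = Q (A j) * Q (G j) := by
    intro j haj hjb
    have h := indep_iSup_of_disjoint hle hind.iIndep
      (S := {r : Fin k | (r : ℕ) < j}) (T := {r : Fin k | j ≤ (r : ℕ)})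
      (Set.disjoint_left.2 fun r h1 h2 ↦ by
        simp only [mem_ofPred_eq] at h1 h2
        omega)
    refine (Indep_iff _ _ _).1 h _ _ (hAm' j haj) ?_
    have hm : Measurable[⨆ r ∈ {r : Fin k | j ≤ (r : ℕ)},
        (inferInstance : MeasurableSpace ℝ).comap (ξ r)]
        (fun ω ↦ cumSum ξ b ω - cumSum ξ j ω) := by
      simp_rw [cumSum_sub_cumSum ξ hjb]
      refine Finset.measurable_sum _ fun r hr ↦ ?_
      have hr' : j ≤ (r : ℕ) := (Finset.mem_filter.1 hr).2.1
      have : (inferInstance : MeasurableSpace ℝ).comap (ξ r) ≤ ⨆ r ∈ {r : Fin k | j ≤ (r : ℕ)},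
          (inferInstance : MeasurableSpace ℝ).comap (ξ r) :=
        le_iSup₂_of_le r hr' le_rfl
      exact (comap_measurable (ξ r)).mono this le_rfl
    exact (measurableSet_le measurable_const (measurable_norm.comp hm)).compl
  have hGhalf : ∀ j, a ≤ j → j ≤ b → 1 / 2 ≤ Q (G j) := by
    intro j haj hjb
    have hm : MeasurableSet {ω | ε ≤ |cumSum ξ b ω - cumSum ξ j ω|} :=
      measurableSet_le measurable_const (measurable_norm.comp ((hcs b).sub (hcs j)))
    change 1 / 2 ≤ Q {ω | ε ≤ |cumSum ξ b ω - cumSum ξ j ω|}ᶜ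
    rw [prob_compl_eq_one_sub hm]
    have h12 : (1 : ℝ≥0∞) - 1 / 2 = 1 / 2 := by
      rw [one_div, ENNReal.one_sub_inv_two]
    have := hvar j haj hjb
    calc (1 : ℝ≥0∞) / 2 = 1 - 1 / 2 := h12.symm
      _ ≤ _ := tsub_le_tsub_left this 1
  have hcover : {ω | ∃ j, a ≤ j ∧ j ≤ b ∧ 2 * ε < |cumSum ξ j ω - cumSum ξ a ω|} ⊆
      ⋃ j ∈ Finset.Icc a b, A j := by
    rintro ω hω
    have hω' : ∃ j, a ≤ j ∧ j ≤ b ∧ 2 * ε < |cumSum ξ j ω - cumSum ξ a ω| := hω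
    have hspec := Nat.find_spec hω'
    refine mem_iUnion₂.2 ⟨Nat.find hω', Finset.mem_Icc.2 ⟨hspec.1, hspec.2.1⟩, hspec.2.2,
      fun i hai hij ↦ ?_⟩
    by_contra! hcon
    exact Nat.find_min hω' hij ⟨hai, hij.le.trans hspec.2.1, hcon⟩
  have hdisj : (↑(Finset.Icc a b) : Set ℕ).PairwiseDisjoint fun j ↦ A j ∩ G j := by
    have hlt : ∀ i j, a ≤ i → i < j → Disjoint (A i ∩ G i) (A j ∩ G j) := by
      intro i j hai hij
      refine Set.disjoint_left.2 fun ω h1 h2 ↦ ?_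
      exact absurd h1.1.1 (not_lt.2 (h2.1.2 i hai hij))
    intro i hi j hj hij
    have hi' := Finset.mem_Icc.1 (Finset.mem_coe.1 hi)
    have hj' := Finset.mem_Icc.1 (Finset.mem_coe.1 hj)
    rcases lt_or_gt_of_ne hij with h | h
    · exact hlt i j hi'.1 h
    · exact (hlt j i hj'.1 h).symm
  have hsub : (⋃ j ∈ Finset.Icc a b, A j ∩ G j) ⊆
      {ω | ε ≤ |cumSum ξ b ω - cumSum ξ a ω|} := by
    intro ω hω
    obtain ⟨j, -, hAj, hGj⟩ := mem_iUnion₂.1 hω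
    have h1 : 2 * ε < |cumSum ξ j ω - cumSum ξ a ω| := hAj.1
    have h2 : |cumSum ξ b ω - cumSum ξ j ω| < ε := not_le.1 hGj
    change ε ≤ |cumSum ξ b ω - cumSum ξ a ω|
    have h3 : |cumSum ξ j ω - cumSum ξ a ω| ≤
        |cumSum ξ b ω - cumSum ξ a ω| + |cumSum ξ b ω - cumSum ξ j ω| := by
      have := abs_sub (cumSum ξ b ω - cumSum ξ a ω) (cumSum ξ b ω - cumSum ξ j ω)
      rwa [sub_sub_sub_cancel_left] at this
    linarith
  calc _ ≤ Q (⋃ j ∈ Finset.Icc a b, A j) := measure_mono hcover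
    _ ≤ ∑ j ∈ Finset.Icc a b, Q (A j) := measure_biUnion_finset_le _ _
    _ ≤ ∑ j ∈ Finset.Icc a b, 2 * Q (A j ∩ G j) := by
      refine Finset.sum_le_sum fun j hj ↦ ?_
      have hj' := Finset.mem_Icc.1 hj
      rw [hindep j hj'.1 hj'.2]
      calc Q (A j) = 2 * (Q (A j) * (1 / 2)) := by
            rw [mul_comm (Q (A j)), ← mul_assoc, one_div,
              ENNReal.mul_inv_cancel (by simp) (by simp), one_mul]
        _ ≤ _ := by
          gcongr
          exact hGhalf j hj'.1 hj'.2
    _ = 2 * Q (⋃ j ∈ Finset.Icc a b, A j ∩ G j) := by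
      rw [← Finset.mul_sum, measure_biUnion_finset hdisj fun j hj ↦
        (hAm j (Finset.mem_Icc.1 hj).1).inter (hGm j)]
    _ ≤ _ := by gcongr

end Array

/-! ### Polygons of partial sums and their finite-dimensional distributions -/

section Polygon

lemma polygon_def (k : ℕ) (s : ℕ → ℝ) (t : I) :
    polygon k s t =
      s 0 + ∑ j ∈ Finset.range k, (s (j + 1) - s j) * max 0 (min 1 (k * (t : ℝ) - j)) :=
  rfl

lemma continuous_polygon (k : ℕ) : Continuous fun s : ℕ → ℝ ↦ polygon k s := by
  let ramp : ℕ → C(I, ℝ) := fun j ↦ ⟨fun t ↦ max 0 (min 1 (k * (t : ℝ) - j)), by fun_prop⟩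
  have : (fun s : ℕ → ℝ ↦ polygon k s) = fun s ↦ s 0 • (1 : C(I, ℝ)) +
      ∑ j ∈ Finset.range k, (s (j + 1) - s j) • ramp j := by
    funext s
    ext t
    simp [polygon_def, ramp]
  rw [this]
  fun_prop

/-- At a grid point the cell to its right is chosen, except at $t=1$, where the cap $k-1$ selects
the last cell. The maximality clause serves to compare a coarse grid with a fine one. -/
lemma exists_vertex {k : ℕ} (hk : 0 < k) (t : I) :
    ∃ j < k, (j : ℝ) ≤ k * (t : ℝ) ∧ k * (t : ℝ) ≤ j + 1 ∧
      ∀ i : ℕ, i < k → (i : ℝ) ≤ k * (t : ℝ) → i ≤ j := by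
  have h0 : 0 ≤ k * (t : ℝ) := mul_nonneg (Nat.cast_nonneg k) t.2.1
  have h1 : k * (t : ℝ) ≤ k := mul_le_of_le_one_right (Nat.cast_nonneg k) t.2.2
  refine ⟨min ⌊k * (t : ℝ)⌋₊ (k - 1), by omega, ?_, ?_, fun i hi hit ↦ ?_⟩
  · exact (Nat.cast_le.2 (min_le_left _ _)).trans (Nat.floor_le h0)
  · rcases le_total ⌊k * (t : ℝ)⌋₊ (k - 1) with h | h
    · rw [min_eq_left h]
      exact (Nat.lt_floor_add_one _).le
    · rw [min_eq_right h, Nat.cast_sub (Nat.succ_le_of_lt hk)]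
      simpa using h1
  · exact le_min (Nat.le_floor hit) (by omega)

/-- The polygon with vertices $(j/k,\,j)$ is the line $t\mapsto kt$. -/
lemma sum_ramp {k : ℕ} (t : I) :
    ∑ r ∈ Finset.range k, max 0 (min 1 (k * (t : ℝ) - r)) = k * (t : ℝ) := by
  rcases k.eq_zero_or_pos with rfl | hk
  · simp
  obtain ⟨j, hj, h1, h2, -⟩ := exists_vertex hk t
  have h := polygon_apply (fun i ↦ (i : ℝ)) hj t h1 h2
  rw [polygon_def] at h
  simpa using h

/-- Every ramp is 0 or 1, and so contributes nothing, except possibly the one with index $\lfloor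
a\rfloor$. -/
lemma sum_ramp_sub_sq_le (k : ℕ) (a : ℝ) :
    ∑ r ∈ Finset.range k, (max 0 (min 1 (a - r)) - max 0 (min 1 (a - r)) ^ 2) ≤ 1 := by
  calc _ ≤ ∑ r ∈ Finset.range k, (if ⌊a⌋₊ = r then (1 : ℝ) else 0) := by
        refine Finset.sum_le_sum fun r _ ↦ ?_
        have hx0 : 0 ≤ max 0 (min 1 (a - (r : ℝ))) := le_max_left _ _
        have hx1 : max 0 (min 1 (a - (r : ℝ))) ≤ 1 := max_le zero_le_one (min_le_left _ _)
        split_ifs with h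
        · nlinarith
        · rcases le_or_gt (a - r) 0 with h1 | h1
          · rw [max_eq_left ((min_le_right _ _).trans h1)]
            simp
          · have h2 : 1 ≤ a - r := by
              by_contra! h2
              refine h ((Nat.floor_eq_iff (by linarith [Nat.cast_nonneg (α := ℝ) r])).2 ⟨?_, ?_⟩ : ⌊a⌋₊ = r)
              · linarith
              · linarith
            rw [min_eq_left h2, max_eq_right zero_le_one]
            simp
    _ ≤ 1 := by
        rw [Finset.sum_ite_eq]
        split_ifs <;> norm_num

/-- This is where the covariance $\min(s,t)$ comes from. For $s\le t$ the product of the ramps lies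
between the square of the ramp at $s$ and that ramp itself, and the two outer sums differ by at most
1. -/
lemma abs_sum_ramp_mul_ramp_sub_le (k : ℕ) (s t : I) :
    |(∑ r ∈ Finset.range k, max 0 (min 1 (k * (s : ℝ) - r)) * max 0 (min 1 (k * (t : ℝ) - r))) -
      k * min (s : ℝ) (t : ℝ)| ≤ 1 := by
  wlog hst : (s : ℝ) ≤ t generalizing s t
  · have := this t s (le_of_not_ge hst)
    rw [min_comm] at this
    simpa only [mul_comm] using this
  rw [min_eq_left hst]
  have hle : ∀ r : ℕ, max 0 (min 1 (k * (s : ℝ) - r)) ≤ max 0 (min 1 (k * (t : ℝ) - r)) := by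
    intro r
    gcongr
  have h0 : ∀ (u : I) (r : ℕ), 0 ≤ max 0 (min 1 (k * (u : ℝ) - r)) := fun u r ↦ le_max_left _ _
  have h1 : ∀ (u : I) (r : ℕ), max 0 (min 1 (k * (u : ℝ) - r)) ≤ 1 :=
    fun u r ↦ max_le zero_le_one (min_le_left _ _)
  have hup : ∑ r ∈ Finset.range k,
      max 0 (min 1 (k * (s : ℝ) - r)) * max 0 (min 1 (k * (t : ℝ) - r)) ≤ k * (s : ℝ) := by
    refine (Finset.sum_le_sum fun r _ ↦ ?_).trans_eq (sum_ramp s)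
    exact mul_le_of_le_one_right (h0 s r) (h1 t r)
  have hlow : ∑ r ∈ Finset.range k, max 0 (min 1 (k * (s : ℝ) - r)) ^ 2 ≤
      ∑ r ∈ Finset.range k,
        max 0 (min 1 (k * (s : ℝ) - r)) * max 0 (min 1 (k * (t : ℝ) - r)) := by
    refine Finset.sum_le_sum fun r _ ↦ ?_
    rw [sq]
    exact mul_le_mul_of_nonneg_left (hle r) (h0 s r)
  have hsq := sum_ramp_sub_sq_le k (k * (s : ℝ))
  rw [Finset.sum_sub_distrib, sum_ramp] at hsq
  rw [abs_le]
  constructor <;> linarith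

/-- The paths `polygon k s` are close to coarser polygons if `s` does not fluctuate too much
between the coarse grid points. -/
lemma dist_polygon_le {k q : ℕ} (hq : 0 < q) (hqk : q ≤ k) {s : ℕ → ℝ} {δ : ℝ}
    (h : ∀ i < q, ∀ j, k * i / q ≤ j → j ≤ k * (i + 1) / q → |s j - s (k * i / q)| ≤ δ) :
    dist (polygon k s) (polygon q fun i ↦ s (k * min i q / q)) ≤ 3 * δ := by
  have hk : 0 < k := hq.trans_le hqk
  have hδ : 0 ≤ δ := (abs_nonneg _).trans
    (h 0 hq (k * 0 / q) le_rfl (Nat.div_le_div_right (by simp)))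
  refine (ContinuousMap.dist_le (by positivity)).2 fun t ↦ ?_
  obtain ⟨j, hjk, hj1, hj2, hjmax⟩ := exists_vertex hk t
  obtain ⟨i, hiq, hi1, hi2, -⟩ := exists_vertex hq t
  have hq' : (0 : ℝ) < q := Nat.cast_pos.2 hq
  have hk' : (0 : ℝ) < k := Nat.cast_pos.2 hk
  have haj : k * i / q ≤ j := by
    refine hjmax _ (Nat.div_lt_of_lt_mul ?_) ?_
    · rw [mul_comm q]
      exact Nat.mul_lt_mul_of_pos_left hiq hk
    · refine Nat.cast_div_le.trans ?_
      rw [div_le_iff₀ hq']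
      push_cast
      nlinarith
  have hjb : j ≤ k * (i + 1) / q := by
    rw [Nat.le_div_iff_mul_le hq]
    have : (j : ℝ) * q ≤ k * (i + 1) := by nlinarith
    exact_mod_cast this
  have hab : k * i / q ≤ k * (i + 1) / q := haj.trans hjb
  have hsj : |s j - s (k * i / q)| ≤ 2 * δ := (h i hiq j haj hjb).trans (by linarith)
  have hsb : |s (k * (i + 1) / q) - s (k * i / q)| ≤ δ := h i hiq _ hab le_rfl
  -- The vertex $j+1$ may lie just beyond the block of $j$. Since $q\le k$ it is then in the next
  -- block, which costs a second $\delta$. The fine polygon is thus within $2\delta$ of the block's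
  -- initial value and the coarse one within $\delta$, whence $3\delta$.
  have hsj1 : |s (j + 1) - s (k * i / q)| ≤ 2 * δ := by
    rcases Nat.lt_or_ge j (k * (i + 1) / q) with hlt | hge
    · exact (h i hiq (j + 1) (haj.trans (Nat.le_succ j)) hlt).trans (by linarith)
    · have hjeq : j = k * (i + 1) / q := le_antisymm hjb hge
      have hiq1 : i + 1 < q := by
        by_contra! hcon
        have : i + 1 = q := le_antisymm hiq hcon
        rw [this, Nat.mul_div_cancel _ hq] at hjeq
        omega
      have hstep : j + 1 ≤ k * (i + 1 + 1) / q := by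
        rw [Nat.le_div_iff_mul_le hq]
        have h1 : j * q ≤ k * (i + 1) := (Nat.le_div_iff_mul_le hq).1 hjb
        calc (j + 1) * q = j * q + q := by ring
          _ ≤ k * (i + 1) + k := add_le_add h1 hqk
          _ = k * (i + 1 + 1) := by ring
      have h2 := h (i + 1) hiq1 (j + 1) (hjeq ▸ Nat.le_succ j) hstep
      calc |s (j + 1) - s (k * i / q)| ≤ |s (j + 1) - s (k * (i + 1) / q)| +
            |s (k * (i + 1) / q) - s (k * i / q)| := abs_sub_le _ _ _
        _ ≤ 2 * δ := by linarith
  rw [polygon_apply s hjk t hj1 hj2, polygon_apply _ hiq t hi1 hi2, Real.dist_eq,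
    min_eq_left hiq.le, min_eq_left (Nat.succ_le_of_lt hiq)]
  set A := s (k * i / q)
  set x := k * (t : ℝ) - j with hx
  set y := q * (t : ℝ) - i with hy
  have hx0 : 0 ≤ x := by linarith
  have hx1 : x ≤ 1 := by linarith
  have hy0 : 0 ≤ y := by linarith
  have hy1 : y ≤ 1 := by linarith
  rw [abs_le] at hsj hsb hsj1 ⊢
  constructor <;> nlinarith

variable {Ω : Type*} [MeasurableSpace Ω] {Q : Measure Ω} [IsProbabilityMeasure Q]

lemma cumSum_zero {k : ℕ} (ξ : Fin k → Ω → ℝ) (ω : Ω) : cumSum ξ 0 ω = 0 := by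
  simp [cumSum]

/-- Values of the polygon are linear in the row, with weights in $[0,1]$, so the weighted limit
theorem covers all finite-dimensional distributions. -/
lemma polygon_cumSum_apply {k : ℕ} (ξ : Fin k → Ω → ℝ) (ω : Ω) (t : I) :
    polygon k (fun j ↦ cumSum ξ j ω) t =
      ∑ r : Fin k, max 0 (min 1 (k * (t : ℝ) - (r : ℕ))) * ξ r ω := by
  rw [polygon_def, cumSum_zero, zero_add, Finset.sum_range]
  refine Finset.sum_congr rfl fun r _ ↦ ?_
  rw [cumSum_sub_cumSum ξ (Nat.le_succ _), mul_comm]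
  congr 1
  have : Finset.univ.filter (fun r' : Fin k ↦ (r : ℕ) ≤ (r' : ℕ) ∧ (r' : ℕ) < (r : ℕ) + 1) =
      {r} := by
    ext r'
    simp only [Finset.mem_filter, Finset.mem_univ, true_and, Finset.mem_singleton, Fin.ext_iff]
    omega
  rw [this, Finset.sum_singleton]

lemma measurable_polygon_cumSum {k : ℕ} {ξ : Fin k → Ω → ℝ} (hξ : ∀ r, Measurable (ξ r)) :
    Measurable fun ω ↦ polygon k fun j ↦ cumSum ξ j ω :=
  (continuous_polygon k).measurable.comp (measurable_pi_lambda _ fun j ↦ measurable_cumSum hξ j)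

/-- The finite-dimensional distributions of the random polygons converge to those of Wiener
measure. -/
lemma IsLindebergArray.tendsto_charFun_polygon {k : ℕ → ℕ} (hk : Tendsto k atTop atTop)
    {ξ : ∀ n, Fin (k n) → Ω → ℝ} (hξ : IsLindebergArray ξ Q) {ι : Type*} [Fintype ι]
    (t : ι → I) (θ : ι → ℝ) :
    Tendsto (fun n ↦ charFun (Q.map fun ω ↦
        ∑ i, θ i * polygon (k n) (fun j ↦ cumSum (ξ n) j ω) (t i)) 1) atTop
      (𝓝 (Complex.exp (-((∑ i, ∑ j, θ i * θ j * min (t i : ℝ) (t j : ℝ)) / 2) : ℝ))) := by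
  set w : ∀ n, Fin (k n) → ℝ := fun n r ↦
    ∑ i, θ i * max 0 (min 1 (k n * (t i : ℝ) - (r : ℕ))) with hw
  have hsum : ∀ n ω, ∑ i, θ i * polygon (k n) (fun j ↦ cumSum (ξ n) j ω) (t i) =
      ∑ r, w n r * ξ n r ω := by
    intro n ω
    simp_rw [polygon_cumSum_apply, hw, Finset.mul_sum, Finset.sum_mul]
    rw [Finset.sum_comm]
    simp_rw [mul_assoc]
  have hbound : ∀ n r, |w n r| ≤ ∑ i, |θ i| := by
    intro n r
    refine (Finset.abs_sum_le_sum_abs _ _).trans (Finset.sum_le_sum fun i _ ↦ ?_)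
    rw [abs_mul]
    refine mul_le_of_le_one_right (abs_nonneg _) ?_
    rw [abs_of_nonneg (le_max_left _ _)]
    exact max_le zero_le_one (min_le_left _ _)
  have hv : Tendsto (fun n ↦ (∑ r, w n r ^ 2) / k n) atTop
      (𝓝 (∑ i, ∑ j, θ i * θ j * min (t i : ℝ) (t j : ℝ))) := by
    have h1 : ∀ n, (∑ r, w n r ^ 2) / k n = ∑ i, ∑ j, θ i * θ j *
        ((∑ r ∈ Finset.range (k n), max 0 (min 1 (k n * (t i : ℝ) - r)) *
          max 0 (min 1 (k n * (t j : ℝ) - r))) / k n) := by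
      intro n
      have h2 : ∀ r : Fin (k n), w n r ^ 2 = ∑ i, ∑ j, θ i * θ j *
          (max 0 (min 1 (k n * (t i : ℝ) - (r : ℕ))) *
            max 0 (min 1 (k n * (t j : ℝ) - (r : ℕ)))) := by
        intro r
        rw [hw, sq, Finset.sum_mul_sum]
        refine Finset.sum_congr rfl fun i _ ↦ Finset.sum_congr rfl fun j _ ↦ ?_
        ring
      simp_rw [h2]
      rw [Finset.sum_comm, Finset.sum_div]
      refine Finset.sum_congr rfl fun i _ ↦ ?_
      rw [Finset.sum_comm, Finset.sum_div]
      refine Finset.sum_congr rfl fun j _ ↦ ?_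
      rw [← Finset.mul_sum, mul_div_assoc, Finset.sum_range]
    simp_rw [h1]
    refine tendsto_finsetSum _ fun i _ ↦ tendsto_finsetSum _ fun j _ ↦
      Tendsto.const_mul _ ?_
    have hk' : Tendsto (fun n ↦ (k n : ℝ)) atTop atTop := tendsto_natCast_atTop_atTop.comp hk
    have hlim : Tendsto (fun n ↦ 1 / (k n : ℝ)) atTop (𝓝 0) := hk'.const_div_atTop 1
    refine tendsto_iff_dist_tendsto_zero.2 (squeeze_zero' (Eventually.of_forall fun _ ↦
      dist_nonneg) ?_ hlim)
    filter_upwards [hk'.eventually_gt_atTop 0] with n hn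
    have := abs_sum_ramp_mul_ramp_sub_le (k n) (t i) (t j)
    rw [Real.dist_eq, div_sub' hn.ne', abs_div, abs_of_pos hn]
    gcongr
  have := hξ.tendsto_charFun hk w hbound hv 1
  simp_rw [hsum]
  simpa using this

end Polygon

/-! ### Tightness of the random polygons -/

section Tightness

/-- A sequence of finite measures is tight if, up to arbitrarily small thickenings, it is
eventually concentrated on compact sets. -/
lemma isTightMeasureSet_range_of_cthickening {S : Type*} [MetricSpace S] [CompleteSpace S]
    [SecondCountableTopology S] [MeasurableSpace S] [BorelSpace S] (μ : ℕ → Measure S)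
    [∀ n, IsFiniteMeasure (μ n)]
    (h : ∀ ε : ℝ, 0 < ε → ∀ η : ℝ≥0∞, 0 < η → ∃ K : Set S, IsCompact K ∧
      ∀ᶠ n in atTop, μ n (Metric.cthickening ε K)ᶜ ≤ η) :
    IsTightMeasureSet (range μ) := by
  -- The finitely many exceptional $n$ are absorbed by adding compact sets, as each single measure
  -- is tight.
  have hall : ∀ ε : ℝ, 0 < ε → ∀ η : ℝ≥0∞, 0 < η → ∃ K : Set S, IsCompact K ∧
      ∀ n, μ n (Metric.cthickening ε K)ᶜ ≤ η := by
    intro ε hε η hη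
    obtain ⟨K, hK, hev⟩ := h ε hε η hη
    obtain ⟨N, hN⟩ := eventually_atTop.1 hev
    have hsingle : ∀ n, ∃ L : Set S, IsCompact L ∧ μ n Lᶜ ≤ η := by
      intro n
      obtain ⟨L, hL, hle⟩ := isTightMeasureSet_iff_exists_isCompact_measure_compl_le.1
        (isTightMeasureSet_singleton (μ := μ n)) η hη
      exact ⟨L, hL, hle _ rfl⟩
    choose L hL hLle using hsingle
    refine ⟨K ∪ ⋃ n ∈ Finset.range N, L n,
      hK.union ((Finset.range N).isCompact_biUnion fun n _ ↦ hL n), fun n ↦ ?_⟩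
    rcases lt_or_ge n N with hn | hn
    · refine (measure_mono (compl_subset_compl.2 ?_)).trans (hLle n)
      refine Subset.trans ?_ (Metric.self_subset_cthickening _)
      exact (subset_biUnion_of_mem (u := L) (Finset.mem_coe.2 (Finset.mem_range.2 hn))).trans
        subset_union_right
    · refine (measure_mono (compl_subset_compl.2 ?_)).trans (hN n hn)
      exact Metric.cthickening_subset_of_subset _ subset_union_left
  rw [isTightMeasureSet_iff_exists_isCompact_measure_compl_le]
  intro η hη
  obtain ⟨δ, hδ0, hδ⟩ := ENNReal.exists_pos_sum_of_countable' hη.ne' ℕ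
  choose K hK hKle using fun j : ℕ ↦ hall (1 / ((j : ℝ) + 1)) (by positivity) (δ j) (hδ0 j)
  -- Closed and totally bounded in a complete space, hence compact; the missed masses sum to at most
  -- $\eta$.
  refine ⟨⋂ j : ℕ, Metric.cthickening (1 / ((j : ℝ) + 1)) (K j), ?_, ?_⟩
  · refine TotallyBounded.isCompact_of_isClosed ?_
      (isClosed_iInter fun j ↦ Metric.isClosed_cthickening)
    rw [Metric.totallyBounded_iff]
    intro ε hε
    obtain ⟨j, hj⟩ := exists_nat_one_div_lt (show 0 < ε / 2 by positivity)
    obtain ⟨t, htf, ht⟩ := Metric.totallyBounded_iff.1 (hK j).totallyBounded (ε / 2)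
      (by positivity)
    refine ⟨t, htf, fun x hx ↦ ?_⟩
    have hx' := mem_iInter.1 hx j
    rw [(hK j).cthickening_eq_biUnion_closedBall (by positivity)] at hx'
    obtain ⟨y, hy, hxy⟩ := mem_iUnion₂.1 hx'
    obtain ⟨z, hz, hyz⟩ := mem_iUnion₂.1 (ht hy)
    refine mem_iUnion₂.2 ⟨z, hz, ?_⟩
    rw [Metric.mem_ball] at hyz ⊢
    rw [Metric.mem_closedBall] at hxy
    linarith [dist_triangle x y z]
  · rintro _ ⟨n, rfl⟩
    rw [compl_iInter]
    exact (measure_iUnion_le _).trans ((ENNReal.tsum_le_tsum fun j ↦ hKle j n).trans hδ.le)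

/-- Markov for the fourth moment. With $v=1/q$ the tail is $O(q^{-2})$, so the sum over $q$ blocks
vanishes as $q\to\infty$; a second-moment bound would only give $O(1)$. -/
lemma exists_gaussianReal_tail_le :
    ∃ C : ℝ, 0 ≤ C ∧ ∀ (v : ℝ≥0) (ε : ℝ), 0 < ε →
      gaussianReal 0 v {x | ε ≤ |x|} ≤ ENNReal.ofReal (C * v ^ 2 / ε ^ 4) := by
  have hint : Integrable (fun x : ℝ ↦ x ^ 4) (gaussianReal 0 1) := by
    have h := (memLp_id_gaussianReal (μ := 0) (v := 1) 4).integrable_norm_pow (by norm_num)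
    refine h.congr (Eventually.of_forall fun x ↦ ?_)
    simp only [id, Real.norm_eq_abs]
    exact (Even.pow_abs (by decide) x)
  refine ⟨∫ x, x ^ 4 ∂(gaussianReal 0 1), integral_nonneg fun x ↦ by positivity,
    fun v ε hε ↦ ?_⟩
  have hmap : gaussianReal 0 v = (gaussianReal 0 1).map (Real.sqrt v * ·) := by
    rw [gaussianReal_map_const_mul]
    congr 1
    · simp
    · ext
      simp
  have hms : MeasurableSet {x : ℝ | ε ≤ |x|} := measurableSet_le measurable_const measurable_norm
  rw [hmap, Measure.map_apply (measurable_const_mul _) hms]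
  have hsub : (Real.sqrt v * ·) ⁻¹' {x : ℝ | ε ≤ |x|} ⊆ {x | ε ^ 4 ≤ v ^ 2 * x ^ 4} := by
    intro x hx
    have hx' : ε ≤ |Real.sqrt v * x| := hx
    have h1 : ε ^ 4 ≤ |Real.sqrt v * x| ^ 4 := by gcongr
    rw [Even.pow_abs (by decide), mul_pow, show (Real.sqrt v) ^ 4 = ((Real.sqrt v) ^ 2) ^ 2 by ring,
      Real.sq_sqrt v.coe_nonneg] at h1
    exact h1
  refine (measure_mono hsub).trans ?_
  have hmk := mul_meas_ge_le_integral_of_nonneg (μ := gaussianReal 0 1)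
    (f := fun x : ℝ ↦ (v : ℝ) ^ 2 * x ^ 4) (Eventually.of_forall fun x ↦ by positivity)
    (hint.const_mul _) (ε ^ 4)
  rw [integral_const_mul] at hmk
  rw [← ENNReal.ofReal_toReal (measure_ne_top (gaussianReal 0 1) _)]
  refine ENNReal.ofReal_le_ofReal ?_
  rw [le_div_iff₀ (by positivity), mul_comm]
  refine hmk.trans_eq ?_
  ring

variable {Ω : Type*} [MeasurableSpace Ω] {Q : Measure Ω} [IsProbabilityMeasure Q]

lemma card_filter_Fin {k a b : ℕ} (hb : b ≤ k) :
    (Finset.univ.filter fun r : Fin k ↦ a ≤ (r : ℕ) ∧ (r : ℕ) < b).card = b - a := by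
  rw [← Nat.card_Ico, ← Finset.card_map Fin.valEmbedding]
  congr 1
  ext x
  simp only [Finset.mem_map, Finset.mem_filter, Finset.mem_univ, true_and, Fin.valEmbedding_apply,
    Finset.mem_Ico]
  constructor
  · rintro ⟨r, hr, rfl⟩
    exact hr
  · intro hx
    exact ⟨⟨x, hx.2.trans_le hb⟩, hx, rfl⟩

/-- Chebyshev's inequality for the increments of the partial sums of a row. -/
lemma measure_cumSum_sub_ge_le {k : ℕ} {ξ : Fin k → Ω → ℝ} (hind : iIndepFun ξ Q)
    (h2 : ∀ r, MemLp (ξ r) 2 Q) (hmean : ∀ r, ∫ ω, ξ r ω ∂Q = 0)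
    (hsq : ∀ r, ∫ ω, ξ r ω ^ 2 ∂Q = 1 / k) {a b : ℕ} (hab : a ≤ b) (hb : b ≤ k) {ε : ℝ}
    (hε : 0 < ε) :
    Q {ω | ε ≤ |cumSum ξ b ω - cumSum ξ a ω|} ≤
      ENNReal.ofReal (((b - a : ℕ) : ℝ) / k / ε ^ 2) := by
  set s := Finset.univ.filter fun r : Fin k ↦ a ≤ (r : ℕ) ∧ (r : ℕ) < b with hs
  have hfun : (fun ω ↦ cumSum ξ b ω - cumSum ξ a ω) = ∑ r ∈ s, ξ r := by
    funext ω
    rw [cumSum_sub_cumSum ξ hab, Finset.sum_apply]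
  have hmem : MemLp (∑ r ∈ s, ξ r) 2 Q := memLp_finsetSum' s fun r _ ↦ h2 r
  have hmean' : ∫ ω, (∑ r ∈ s, ξ r) ω ∂Q = 0 := by
    simp_rw [Finset.sum_apply]
    rw [integral_finsetSum _ fun r _ ↦ (h2 r).integrable (by norm_num)]
    exact Finset.sum_eq_zero fun r _ ↦ hmean r
  have hvar : Var[∑ r ∈ s, ξ r; Q] = ((b - a : ℕ) : ℝ) / k := by
    rw [IndepFun.variance_sum (fun r _ ↦ h2 r) fun i _ j _ hij ↦ hind.indepFun hij]
    have : ∀ r ∈ s, Var[ξ r; Q] = 1 / k := by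
      intro r _
      rw [variance_of_integral_eq_zero (h2 r).aemeasurable (hmean r), hsq r]
    rw [Finset.sum_congr rfl this, Finset.sum_const, card_filter_Fin hb, nsmul_eq_mul]
    ring
  have h := meas_ge_le_variance_div_sq hmem hε
  rw [hmean', hvar] at h
  refine le_trans (le_of_eq ?_) h
  congr 1
  ext ω
  simp only [mem_ofPred_eq, sub_zero]
  rw [← hfun]

lemma tendsto_div_block {k : ℕ → ℕ} (hk : Tendsto k atTop atTop) {q : ℕ} (hq : 0 < q) (i : ℕ) :
    Tendsto (fun n ↦ ((k n * i / q : ℕ) : ℝ) / k n) atTop (𝓝 ((i : ℝ) / q)) := by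
  have hk' : Tendsto (fun n ↦ (k n : ℝ)) atTop atTop := tendsto_natCast_atTop_atTop.comp hk
  have hlim : Tendsto (fun n ↦ (i : ℝ) / q - 1 / (k n : ℝ)) atTop (𝓝 ((i : ℝ) / q)) := by
    have := (hk'.const_div_atTop 1).const_sub ((i : ℝ) / q)
    rwa [sub_zero] at this
  have hq' : (0 : ℝ) < q := Nat.cast_pos.2 hq
  refine tendsto_of_tendsto_of_tendsto_of_le_of_le' hlim tendsto_const_nhds ?_ ?_
  · filter_upwards [hk'.eventually_gt_atTop 0] with n hn
    rw [le_div_iff₀ hn, sub_mul, one_div_mul_cancel hn.ne', sub_le_iff_le_add,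
      div_mul_eq_mul_div, div_le_iff₀ hq']
    have : k n * i < (k n * i / q + 1) * q := Nat.lt_mul_of_div_lt (Nat.lt_succ_self _) hq
    have h2 : ((k n * i : ℕ) : ℝ) < (((k n * i / q + 1) * q : ℕ) : ℝ) := by exact_mod_cast this
    push_cast at h2
    linarith
  · filter_upwards [hk'.eventually_gt_atTop 0] with n hn
    rw [div_le_iff₀ hn]
    refine Nat.cast_div_le.trans_eq ?_
    push_cast
    ring

/-- Gaussian bound for the limits of the tails of block sums. -/
lemma IsLindebergArray.eventually_measure_block_lt {k : ℕ → ℕ} (hk : Tendsto k atTop atTop)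
    {ξ : ∀ n, Fin (k n) → Ω → ℝ} (hξ : IsLindebergArray ξ Q) {q : ℕ} (hq : 0 < q) {i : ℕ}
    (hi : i < q) {ε : ℝ} {c : ℝ≥0∞}
    (hc : gaussianReal 0 (1 / q) {x | ε ≤ |x|} < c) :
    ∀ᶠ n in atTop, Q {ω | ε ≤ |cumSum (ξ n) (k n * (i + 1) / q) ω -
      cumSum (ξ n) (k n * i / q) ω|} < c := by
  set a : ℕ → ℕ := fun n ↦ k n * i / q with ha
  set b : ℕ → ℕ := fun n ↦ k n * (i + 1) / q with hb
  have hab : ∀ n, a n ≤ b n := fun n ↦ Nat.div_le_div_right (Nat.mul_le_mul_left _ (Nat.le_succ i))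
  have hbk : ∀ n, b n ≤ k n := fun n ↦
    Nat.div_le_of_le_mul (by rw [mul_comm q]; exact Nat.mul_le_mul_left _ hi)
  -- A block increment is a weighted row sum with 0–1 weights and limiting variance $1/q$; the
  -- portmanteau theorem for a closed set then bounds its tail.
  set w : ∀ n, Fin (k n) → ℝ := fun n r ↦ if a n ≤ (r : ℕ) ∧ (r : ℕ) < b n then 1 else 0 with hw
  have hsum : ∀ n ω, cumSum (ξ n) (b n) ω - cumSum (ξ n) (a n) ω = ∑ r, w n r * ξ n r ω := by
    intro n ω
    rw [cumSum_sub_cumSum _ (hab n), Finset.sum_filter]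
    refine Finset.sum_congr rfl fun r _ ↦ ?_
    simp only [hw]
    split_ifs <;> simp
  have hwb : ∀ n r, |w n r| ≤ 1 := by
    intro n r
    simp only [hw]
    split_ifs <;> simp
  have hq' : (0 : ℝ) < q := Nat.cast_pos.2 hq
  have hv : Tendsto (fun n ↦ (∑ r, w n r ^ 2) / k n) atTop (𝓝 (1 / q)) := by
    have h1 : ∀ n, (∑ r, w n r ^ 2) / (k n : ℝ) = (b n : ℝ) / k n - (a n : ℝ) / k n := by
      intro n
      have : ∀ r, w n r ^ 2 = if a n ≤ (r : ℕ) ∧ (r : ℕ) < b n then 1 else 0 := by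
        intro r
        simp only [hw]
        split_ifs <;> simp
      simp_rw [this]
      rw [Finset.sum_boole, card_filter_Fin (hbk n), Nat.cast_sub (hab n), sub_div]
    simp_rw [h1]
    have := (tendsto_div_block hk hq (i + 1)).sub (tendsto_div_block hk hq i)
    convert this using 2
    push_cast
    field_simp
    ring
  have hmeas : ∀ n, Measurable fun ω ↦ ∑ r, w n r * ξ n r ω := fun n ↦
    Finset.measurable_sum _ fun r _ ↦ (hξ.measurable n r).const_mul _
  let ν : ℕ → ProbabilityMeasure ℝ := fun n ↦ ⟨Q.map fun ω ↦ ∑ r, w n r * ξ n r ω,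
    Measure.isProbabilityMeasure_map (hmeas n).aemeasurable⟩
  let γ : ProbabilityMeasure ℝ := ⟨gaussianReal 0 (1 / q), inferInstance⟩
  have hconv : Tendsto ν atTop (𝓝 γ) := by
    refine ProbabilityMeasure.tendsto_of_tendsto_charFun fun u ↦ ?_
    have h := hξ.tendsto_charFun hk w hwb hv u
    have h2 : charFun (γ : Measure ℝ) u = Complex.exp (-(1 / (q : ℝ) * u ^ 2 / 2) : ℝ) := by
      change charFun (gaussianReal 0 (1 / q)) u = _
      rw [charFun_gaussianReal]
      congr 1
      push_cast
      ring
    rw [h2]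
    exact h
  have hclosed : IsClosed {x : ℝ | ε ≤ |x|} := isClosed_le continuous_const continuous_abs
  have hlim := ProbabilityMeasure.limsup_measure_closed_le_of_tendsto hconv hclosed
  have hev := eventually_lt_of_limsup_lt (hlim.trans_lt hc)
  filter_upwards [hev] with n hn
  refine lt_of_eq_of_lt ?_ hn
  change _ = Q.map (fun ω ↦ ∑ r, w n r * ξ n r ω) _
  rw [Measure.map_apply (hmeas n) hclosed.measurableSet]
  congr 1
  ext ω
  simp only [mem_ofPred_eq, mem_preimage]
  rw [← hsum]

lemma abs_le_mul_of_block {s : ℕ → ℝ} {k q : ℕ} {δ : ℝ} (h0 : s 0 = 0)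
    (h : ∀ i < q, ∀ j, k * i / q ≤ j → j ≤ k * (i + 1) / q → |s j - s (k * i / q)| ≤ δ)
    {i : ℕ} (hi : i ≤ q) : |s (k * i / q)| ≤ i * δ := by
  induction i with
  | zero => simp [h0]
  | succ i ih =>
    have h1 := ih (Nat.le_of_succ_le hi)
    have h2 := h i hi (k * (i + 1) / q)
      (Nat.div_le_div_right (Nat.mul_le_mul_left _ (Nat.le_succ i))) le_rfl
    have h3 := abs_add_le (s (k * (i + 1) / q) - s (k * i / q)) (s (k * i / q))
    rw [sub_add_cancel] at h3
    push_cast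
    linarith

/-- Tightness of the random polygons. -/
lemma IsLindebergArray.isTightMeasureSet {k : ℕ → ℕ} (hk : Tendsto k atTop atTop)
    {ξ : ∀ n, Fin (k n) → Ω → ℝ} (hξ : IsLindebergArray ξ Q) :
    IsTightMeasureSet
      (range fun n ↦ Q.map fun ω ↦ polygon (k n) fun j ↦ cumSum (ξ n) j ω) := by
  have : ∀ n, IsFiniteMeasure (Q.map fun ω ↦ polygon (k n) fun j ↦ cumSum (ξ n) j ω) :=
    fun n ↦ inferInstance
  obtain ⟨C, hC0, hC⟩ := exists_gaussianReal_tail_le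
  refine isTightMeasureSet_range_of_cthickening _ fun ε₀ hε₀ η₀ hη₀ ↦ ?_
  obtain ⟨η, hη, hηle⟩ : ∃ η : ℝ, 0 < η ∧ ENNReal.ofReal η ≤ η₀ := by
    rcases eq_or_ne η₀ ∞ with rfl | h
    · exact ⟨1, one_pos, le_top⟩
    · exact ⟨η₀.toReal, ENNReal.toReal_pos hη₀.ne' h, ENNReal.ofReal_toReal_le⟩
  -- Ottaviani controls oscillations of size $2\varepsilon$ in each block, and the polygons then
  -- differ by at most $3\cdot 2\varepsilon=\varepsilon_0$.
  set ε : ℝ := ε₀ / 6 with hεdef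
  have hε : 0 < ε := by positivity
  -- $q>4/\varepsilon^2$ gives the probability $1/2$ in Ottaviani's hypothesis, by Chebyshev with
  -- variance at most $1/q+1/k_n\le 2/q$. The last bound makes the Gaussian tail smaller than
  -- $\eta/(2q)$; Ottaviani's factor 2 and the $q$ blocks turn this into $\eta$.
  obtain ⟨q, hq1⟩ := exists_nat_gt (max 1 (max (4 / ε ^ 2) (2 * C / (η * ε ^ 4))))
  have hq1' : (1 : ℝ) < q := (le_max_left _ _).trans_lt hq1
  have hq2 : 4 / ε ^ 2 < q := ((le_max_left _ _).trans (le_max_right _ _)).trans_lt hq1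
  have hq3 : 2 * C / (η * ε ^ 4) < q := ((le_max_right _ _).trans (le_max_right _ _)).trans_lt hq1
  have hq' : (0 : ℝ) < q := by linarith
  have hq : 0 < q := Nat.cast_pos.1 hq'
  let K : Set C(I, ℝ) := (fun s : ℕ → ℝ ↦ polygon q s) ''
    (Set.pi univ fun _ ↦ Icc (-(q * (2 * ε))) (q * (2 * ε)))
  have hK : IsCompact K := (isCompact_univ_pi fun _ ↦ isCompact_Icc).image (continuous_polygon q)
  refine ⟨K, hK, ?_⟩
  have hgauss : gaussianReal 0 (1 / q) {x | ε ≤ |x|} < ENNReal.ofReal (η / (2 * q)) := by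
    refine (hC (1 / q) ε hε).trans_lt ?_
    rw [ENNReal.ofReal_lt_ofReal_iff (by positivity)]
    rw [div_lt_iff₀ (by positivity)] at hq3
    push_cast
    rw [div_lt_div_iff₀ (by positivity) (by positivity)]
    calc C * (1 / (q : ℝ)) ^ 2 * (2 * q) = 2 * C / q := by field_simp
      _ < η * ε ^ 4 := by
        rw [div_lt_iff₀ hq']
        linarith
  have hblocks : ∀ᶠ n in atTop, ∀ i ∈ Finset.range q,
      Q {ω | ε ≤ |cumSum (ξ n) (k n * (i + 1) / q) ω - cumSum (ξ n) (k n * i / q) ω|} <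
        ENNReal.ofReal (η / (2 * q)) :=
    (Finset.eventually_all _).2 fun i hi ↦
      hξ.eventually_measure_block_lt hk hq (Finset.mem_range.1 hi) hgauss
  filter_upwards [hblocks, hξ.memLp, hξ.mean, hξ.integral_sq, hk.eventually_ge_atTop q]
    with n hn h2 hmean hsq hqk
  have hkpos : (0 : ℝ) < k n := Nat.cast_pos.2 (hq.trans_le hqk)
  have hqk' : (q : ℝ) ≤ k n := by exact_mod_cast hqk
  have hclosed : IsClosed (Metric.cthickening ε₀ K) := Metric.isClosed_cthickening
  rw [Measure.map_apply (measurable_polygon_cumSum (hξ.measurable n))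
    hclosed.measurableSet.compl]
  set D : ℕ → Set Ω := fun i ↦ {ω | ∃ j, k n * i / q ≤ j ∧ j ≤ k n * (i + 1) / q ∧
    2 * ε < |cumSum (ξ n) j ω - cumSum (ξ n) (k n * i / q) ω|} with hD
  have hsub : (fun ω ↦ polygon (k n) fun j ↦ cumSum (ξ n) j ω) ⁻¹' (Metric.cthickening ε₀ K)ᶜ ⊆
      ⋃ i ∈ Finset.range q, D i := by
    intro ω hω
    by_contra hcon
    have hcon' : ∀ i < q, ∀ j, k n * i / q ≤ j → j ≤ k n * (i + 1) / q →
        |cumSum (ξ n) j ω - cumSum (ξ n) (k n * i / q) ω| ≤ 2 * ε := by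
      intro i hi j hj1 hj2
      by_contra! hlt
      exact hcon (mem_iUnion₂.2 ⟨i, Finset.mem_range.2 hi, j, hj1, hj2, hlt⟩)
    refine hω ?_
    have hdist := dist_polygon_le (s := fun j ↦ cumSum (ξ n) j ω) hq hqk hcon'
    -- The truncation `min i q` keeps every coordinate, not only those with $i\le q$, inside the
    -- compact box that defines `K`.
    refine Metric.mem_cthickening_of_dist_le _
      (polygon q fun i ↦ cumSum (ξ n) (k n * min i q / q) ω) _ _ ⟨_, ?_, rfl⟩
      (hdist.trans (by rw [hεdef]; linarith))
    intro i _
    have h1 := abs_le_mul_of_block (s := fun j ↦ cumSum (ξ n) j ω) (cumSum_zero _ _) hcon'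
      (min_le_right i q)
    have h3 : ((min i q : ℕ) : ℝ) * (2 * ε) ≤ q * (2 * ε) := by
      gcongr
      exact min_le_right i q
    exact abs_le.1 (h1.trans h3)
  have hDle : ∀ i ∈ Finset.range q, Q (D i) ≤ 2 * ENNReal.ofReal (η / (2 * q)) := by
    intro i hi
    have hbk : k n * (i + 1) / q ≤ k n := Nat.div_le_of_le_mul (by
      rw [mul_comm q]
      exact Nat.mul_le_mul_left _ (Finset.mem_range.1 hi))
    refine (measure_exists_cumSum_le (hξ.measurable n) (hξ.indep n) fun j hj1 hj2 ↦ ?_).trans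
      (mul_le_mul_right (hn i hi).le 2)
    refine (measure_cumSum_sub_ge_le (hξ.indep n) h2 hmean hsq hj2 hbk hε).trans ?_
    have hlen : (((k n * (i + 1) / q - j : ℕ) : ℕ) : ℝ) ≤ k n / q + 1 := by
      have h1 : ((k n * (i + 1) / q - j : ℕ) : ℝ) ≤
          ((k n * (i + 1) / q : ℕ) : ℝ) - ((k n * i / q : ℕ) : ℝ) := by
        rw [Nat.cast_sub hj2]
        have : ((k n * i / q : ℕ) : ℝ) ≤ j := by exact_mod_cast hj1
        linarith
      have h4 : ((k n * (i + 1) / q : ℕ) : ℝ) ≤ k n * (i + 1) / q := by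
        refine Nat.cast_div_le.trans_eq ?_
        push_cast
        ring
      have h5 : (k n : ℝ) * i / q ≤ ((k n * i / q : ℕ) : ℝ) + 1 := by
        rw [div_le_iff₀ hq']
        have : k n * i < (k n * i / q + 1) * q := Nat.lt_mul_of_div_lt (Nat.lt_succ_self _) hq
        have h6 : ((k n * i : ℕ) : ℝ) < (((k n * i / q + 1) * q : ℕ) : ℝ) := by
          exact_mod_cast this
        push_cast at h6
        linarith
      have h7 : (k n : ℝ) * (i + 1) / q = k n * i / q + k n / q := by ring
      linarith
    rw [show (1 : ℝ≥0∞) / 2 = ENNReal.ofReal (1 / 2) by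
      rw [ENNReal.ofReal_div_of_pos (by norm_num)]; simp]
    refine ENNReal.ofReal_le_ofReal ?_
    rw [div_lt_iff₀ (by positivity)] at hq2
    rw [div_div, div_le_iff₀ (by positivity)]
    have h8 : (k n : ℝ) / q * q = k n := div_mul_cancel₀ _ hq'.ne'
    have h9 : 0 ≤ (k n : ℝ) / q := by positivity
    have h10 : 1 ≤ (k n : ℝ) / q := by rwa [one_le_div hq']
    have h11 : (k n : ℝ) / q * 4 ≤ k n * ε ^ 2 := by
      calc (k n : ℝ) / q * 4 ≤ (k n : ℝ) / q * (q * ε ^ 2) := by gcongr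
        _ = k n * ε ^ 2 := by rw [← mul_assoc, h8]
    linarith
  calc _ ≤ Q (⋃ i ∈ Finset.range q, D i) := measure_mono hsub
    _ ≤ ∑ i ∈ Finset.range q, Q (D i) := measure_biUnion_finset_le _ _
    _ ≤ ∑ i ∈ Finset.range q, 2 * ENNReal.ofReal (η / (2 * q)) := Finset.sum_le_sum hDle
    _ = ENNReal.ofReal η := by
      rw [Finset.sum_const, Finset.card_range, nsmul_eq_mul, ← ENNReal.ofReal_natCast,
        show (2 : ℝ≥0∞) = ENNReal.ofReal 2 by simp, ← ENNReal.ofReal_mul (by norm_num),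
        ← ENNReal.ofReal_mul (by positivity)]
      congr 1
      field_simp
    _ ≤ η₀ := hηle

end Tightness

/-! ### Identification of the limit and the functional limit theorem -/

section WienerMeasure

/-- The variance of `∑ i, θ i * B (t i)` for a standard Brownian motion `B`. -/
noncomputable def brownianForm {ι : Type} [Fintype ι] (t : ι → I) (θ : ι → ℝ) : ℝ :=
  ∑ i, ∑ j, θ i * θ j * min (t i : ℝ) (t j : ℝ)

/-- The finite-dimensional distributions of `μ` have the characteristic functions of those of
Wiener measure. -/
def HasWienerCharFun (μ : Measure C(I, ℝ)) : Prop :=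
  ∀ (ι : Type) [Fintype ι] (t : ι → I) (θ : ι → ℝ),
    charFun (μ.map fun x ↦ ∑ i, θ i * x (t i)) 1 =
      Complex.exp (-(brownianForm t θ / 2) : ℝ)

lemma continuous_sum_eval {ι : Type*} [Fintype ι] (t : ι → I) (θ : ι → ℝ) :
    Continuous fun x : C(I, ℝ) ↦ ∑ i, θ i * x (t i) := by
  fun_prop

/-- The polygons through the values at `i / q` of a path. -/
lemma tendsto_polygon_eval (x : C(I, ℝ)) :
    Tendsto (fun q : ℕ ↦ polygon (q + 1) fun i ↦ x (projIcc 0 1 zero_le_one (i / (q + 1 : ℕ) : ℝ)))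
      atTop (𝓝 x) := by
  rw [Metric.tendsto_nhds]
  intro ε hε
  obtain ⟨δ, hδ, hx⟩ := Metric.uniformContinuous_iff.1
    (CompactSpace.uniformContinuous_of_continuous x.continuous) (ε / 2) (by positivity)
  obtain ⟨N, hN⟩ := exists_nat_one_div_lt hδ
  filter_upwards [eventually_ge_atTop N] with q hq
  refine lt_of_le_of_lt ((ContinuousMap.dist_le (by positivity)).2 fun t ↦ ?_)
    (half_lt_self hε)
  obtain ⟨j, hj, h1, h2, -⟩ := exists_vertex (Nat.succ_pos q) t
  rw [polygon_apply _ hj t h1 h2]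
  have hq0 : (0 : ℝ) < ((q + 1 : ℕ) : ℝ) := by positivity
  have hδ' : 1 / ((q + 1 : ℕ) : ℝ) < δ := by
    refine lt_of_le_of_lt ?_ hN
    push_cast
    gcongr
  have hclose : ∀ i : ℕ, i ≤ q + 1 → |(i : ℝ) - (q + 1 : ℕ) * (t : ℝ)| ≤ 1 →
      |x (projIcc 0 1 zero_le_one (i / (q + 1 : ℕ) : ℝ)) - x t| ≤ ε / 2 := by
    intro i hi hit
    refine le_of_lt ?_
    rw [← Real.dist_eq]
    refine hx ?_
    have hmem : (i / (q + 1 : ℕ) : ℝ) ∈ Icc (0 : ℝ) 1 :=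
      ⟨by positivity, (div_le_one hq0).2 (by exact_mod_cast hi)⟩
    rw [projIcc_of_mem _ hmem, Subtype.dist_eq, Real.dist_eq]
    refine lt_of_le_of_lt ?_ hδ'
    have : (i / (q + 1 : ℕ) : ℝ) - t = (i - (q + 1 : ℕ) * (t : ℝ)) / (q + 1 : ℕ) := by
      field_simp
    change |(i / (q + 1 : ℕ) : ℝ) - t| ≤ _
    rw [this, abs_div, abs_of_pos hq0]
    gcongr
  have ha := hclose j hj.le (abs_le.2 ⟨by linarith, by linarith⟩)
  have hb := hclose (j + 1) hj (abs_le.2 ⟨by push_cast at *; linarith, by push_cast at *; linarith⟩)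
  rw [Real.dist_eq]
  set a := x (projIcc 0 1 zero_le_one (j / (q + 1 : ℕ) : ℝ)) with ha'
  set b := x (projIcc 0 1 zero_le_one ((j + 1 : ℕ) / (q + 1 : ℕ) : ℝ)) with hb'
  set u := ((q + 1 : ℕ) : ℝ) * (t : ℝ) - j with hu
  have hu0 : 0 ≤ u := by linarith
  have hu1 : u ≤ 1 := by linarith
  rw [abs_le] at ha hb ⊢
  constructor <;> nlinarith

/-- A finite measure on `C[0,1]` is determined by the characteristic functions of its
finite-dimensional distributions. -/
lemma ext_of_charFun_eval {μ ν : Measure C(I, ℝ)} [IsFiniteMeasure μ] [IsFiniteMeasure ν]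
    (h : ∀ (ι : Type) [Fintype ι] (t : ι → I) (θ : ι → ℝ),
      charFun (μ.map fun x ↦ ∑ i, θ i * x (t i)) 1 =
        charFun (ν.map fun x ↦ ∑ i, θ i * x (t i)) 1) : μ = ν := by
  -- Cramér–Wold: every linear functional on $\mathbb R^\iota$ is a combination of coordinates.
  have hfdd : ∀ (ι : Type) [Fintype ι] (t : ι → I),
      μ.map (fun (x : C(I, ℝ)) (i : ι) ↦ x (t i)) =
        ν.map (fun (x : C(I, ℝ)) (i : ι) ↦ x (t i)) := by
    intro ι _ t
    have hm : Measurable fun (x : C(I, ℝ)) (i : ι) ↦ x (t i) :=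
      Continuous.measurable (by fun_prop)
    refine Measure.ext_of_charFunDual (funext fun L ↦ ?_)
    classical
    have key := h ι t fun i ↦ L (Pi.single i 1)
    have hL : (fun x : C(I, ℝ) ↦ ∑ i, L (Pi.single i 1) * x (t i)) =
        L ∘ fun (x : C(I, ℝ)) (i : ι) ↦ x (t i) := by
      funext x
      simp only [Function.comp]
      conv_rhs => rw [← Finset.univ_sum_single (fun i ↦ x (t i))]
      rw [map_sum]
      refine Finset.sum_congr rfl fun i _ ↦ ?_
      rw [mul_comm, ← smul_eq_mul, ← map_smul, ← Pi.single_smul, smul_eq_mul, mul_one]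
    rw [hL, ← Measure.map_map L.continuous.measurable hm,
      ← Measure.map_map L.continuous.measurable hm] at key
    rw [charFunDual_eq_charFun_map_one, charFunDual_eq_charFun_map_one]
    exact key
  refine ext_of_forall_integral_eq_of_IsFiniteMeasure fun f ↦ ?_
  -- A bounded continuous functional of a path is the limit of its values at interpolating polygons,
  -- which depend on finitely many coordinates of the path.
  have hlim : ∀ (ρ : Measure C(I, ℝ)) [IsFiniteMeasure ρ], Tendsto (fun q : ℕ ↦ ∫ x : C(I, ℝ),
      f (polygon (q + 1) fun i ↦ x (projIcc 0 1 zero_le_one (i / (q + 1 : ℕ) : ℝ))) ∂ρ) atTop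
      (𝓝 (∫ x, f x ∂ρ)) := by
    intro ρ _
    refine tendsto_integral_of_dominated_convergence (fun _ ↦ ‖f‖) (fun q ↦ ?_)
      (integrable_const _) (fun q ↦ Eventually.of_forall fun x ↦ f.norm_coe_le_norm _)
      (Eventually.of_forall fun x ↦ (f.continuous.tendsto x).comp (tendsto_polygon_eval x))
    refine Continuous.aestronglyMeasurable ?_
    have hc : Continuous fun (x : C(I, ℝ)) (i : ℕ) ↦
        x (projIcc 0 1 zero_le_one (i / (q + 1 : ℕ) : ℝ)) := by
      fun_prop
    exact f.continuous.comp ((continuous_polygon (q + 1)).comp hc)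
  refine tendsto_nhds_unique (hlim μ) ((hlim ν).congr fun q ↦ ?_)
  let t : Fin (q + 2) → I := fun i ↦ projIcc 0 1 zero_le_one ((i : ℕ) / (q + 1 : ℕ) : ℝ)
  -- `Fin.ofNat` reduces modulo $q+2$, which is harmless: a polygon with $q+1$ cells reads only the
  -- vertices $0,\dots,q+1$.
  let G : (Fin (q + 2) → ℝ) → ℝ := fun y ↦ f (polygon (q + 1) fun i ↦ y (Fin.ofNat (q + 2) i))
  have hG : Continuous G := by
    have hc : Continuous fun (y : Fin (q + 2) → ℝ) (i : ℕ) ↦ y (Fin.ofNat (q + 2) i) := by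
      fun_prop
    exact f.continuous.comp ((continuous_polygon (q + 1)).comp hc)
  have hm : Measurable fun (x : C(I, ℝ)) (i : Fin (q + 2)) ↦ x (t i) :=
    Continuous.measurable (by fun_prop)
  have hGx : ∀ x : C(I, ℝ),
      f (polygon (q + 1) fun i ↦ x (projIcc 0 1 zero_le_one (i / (q + 1 : ℕ) : ℝ))) =
        G fun i ↦ x (t i) := by
    intro x
    refine congrArg f ?_
    ext u
    have hval : ∀ j, j < q + 2 → ((Fin.ofNat (q + 2) j : Fin (q + 2)) : ℕ) = j :=
      fun j hj ↦ Nat.mod_eq_of_lt hj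
    obtain ⟨j, hj, h1, h2, -⟩ := exists_vertex (Nat.succ_pos q) u
    rw [polygon_apply _ hj u h1 h2, polygon_apply _ hj u h1 h2]
    simp only [t]
    rw [hval j (by omega), hval (j + 1) (by omega)]
  simp_rw [hGx]
  rw [← integral_map hm.aemeasurable hG.aestronglyMeasurable,
    ← integral_map hm.aemeasurable hG.aestronglyMeasurable, hfdd]

lemma HasWienerCharFun.ext {μ ν : Measure C(I, ℝ)} [IsFiniteMeasure μ] [IsFiniteMeasure ν]
    (hμ : HasWienerCharFun μ) (hν : HasWienerCharFun ν) : μ = ν :=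
  ext_of_charFun_eval fun ι _ t θ ↦ (hμ ι t θ).trans (hν ι t θ).symm

variable {W : Measure C(I, ℝ)} [IsProbabilityMeasure W]

/-- Positivity is read off from the modulus of a characteristic function being at most 1. -/
lemma HasWienerCharFun.brownianForm_nonneg (hW : HasWienerCharFun W) {ι : Type} [Fintype ι]
    (t : ι → I) (θ : ι → ℝ) : 0 ≤ brownianForm t θ := by
  have : IsProbabilityMeasure (W.map fun x ↦ ∑ i, θ i * x (t i)) :=
    Measure.isProbabilityMeasure_map (continuous_sum_eval t θ).aemeasurable
  have h := norm_charFun_le_one (μ := W.map fun x ↦ ∑ i, θ i * x (t i)) 1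
  rw [hW, Complex.norm_exp, Complex.ofReal_re, Real.exp_le_one_iff] at h
  linarith

/-- The hypothesis gives characteristic functions at 1 only; replacing $\theta$ by $u\theta$ gives
them at every $u$. -/
lemma HasWienerCharFun.map_sum_eval (hW : HasWienerCharFun W) {ι : Type} [Fintype ι]
    (t : ι → I) (θ : ι → ℝ) :
    W.map (fun x ↦ ∑ i, θ i * x (t i)) = gaussianReal 0 (brownianForm t θ).toNNReal := by
  have : IsProbabilityMeasure (W.map fun x ↦ ∑ i, θ i * x (t i)) :=
    Measure.isProbabilityMeasure_map (continuous_sum_eval t θ).aemeasurable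
  refine Measure.ext_of_charFun (funext fun u ↦ ?_)
  have h := hW ι t fun i ↦ u * θ i
  have hform : brownianForm t (fun i ↦ u * θ i) = u ^ 2 * brownianForm t θ := by
    simp only [brownianForm, Finset.mul_sum]
    refine Finset.sum_congr rfl fun i _ ↦ Finset.sum_congr rfl fun j _ ↦ ?_
    ring
  have hmap : W.map (fun x ↦ ∑ i, u * θ i * x (t i)) =
      (W.map fun x ↦ ∑ i, θ i * x (t i)).map (u * ·) := by
    rw [Measure.map_map (measurable_const_mul u) (continuous_sum_eval t θ).measurable]
    congr 1
    funext x
    simp only [Function.comp, Finset.mul_sum, mul_assoc]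
  rw [hmap, charFun_map_mul, mul_one, hform] at h
  rw [h, charFun_gaussianReal, Real.coe_toNNReal _ (hW.brownianForm_nonneg t θ)]
  congr 1
  push_cast
  ring

lemma HasWienerCharFun.moments (hW : HasWienerCharFun W) {ι : Type} [Fintype ι]
    (t : ι → I) (θ : ι → ℝ) :
    MemLp (fun x : C(I, ℝ) ↦ ∑ i, θ i * x (t i)) 2 W ∧
      ∫ x : C(I, ℝ), ∑ i, θ i * x (t i) ∂W = 0 ∧
      Var[fun x : C(I, ℝ) ↦ ∑ i, θ i * x (t i); W] = brownianForm t θ := by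
  have hc := (continuous_sum_eval t θ).aemeasurable (μ := W)
  have hlaw := hW.map_sum_eval t θ
  refine ⟨?_, ?_, ?_⟩
  · change MemLp (id ∘ fun x : C(I, ℝ) ↦ ∑ i, θ i * x (t i)) 2 W
    rw [← memLp_map_measure_iff (by fun_prop) hc, hlaw]
    exact memLp_id_gaussianReal 2
  · have := integral_map hc (f := fun y : ℝ ↦ y) (by fun_prop)
    rw [← this, hlaw]
    exact integral_id_gaussianReal
  · have := variance_map (X := (id : ℝ → ℝ)) (by fun_prop) hc
    change Var[id ∘ fun x : C(I, ℝ) ↦ ∑ i, θ i * x (t i); W] = _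
    rw [← this, hlaw, variance_id_gaussianReal, Real.coe_toNNReal _ (hW.brownianForm_nonneg t θ)]

lemma HasWienerCharFun.isWienerMeasure (hW : HasWienerCharFun W) : IsWienerMeasure W where
  isGaussianProcess := by
    refine ⟨fun J ↦ ⟨isGaussian_of_map_eq_gaussianReal fun L ↦ ?_⟩⟩
    classical
    have hm : Measurable fun x : C(I, ℝ) ↦ J.restrict (x ·) :=
      measurable_pi_lambda _ fun i ↦ Continuous.measurable (by fun_prop)
    refine ⟨0, (brownianForm (fun j : J ↦ (j : I)) fun j ↦ L (Pi.single j 1)).toNNReal, ?_⟩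
    rw [Measure.map_map L.continuous.measurable hm, ← hW.map_sum_eval]
    congr 1
    funext x
    simp only [Function.comp]
    conv_lhs => rw [← Finset.univ_sum_single (J.restrict (x ·))]
    rw [map_sum]
    refine Finset.sum_congr rfl fun i _ ↦ ?_
    rw [mul_comm, ← smul_eq_mul, ← map_smul, ← Pi.single_smul, smul_eq_mul, mul_one]
    rfl
  mean_eq_zero t := by
    simpa using (hW.moments (fun _ : Unit ↦ t) fun _ ↦ 1).2.1
  -- Polarization: the variances of $x(s)$, $x(t)$ and $x(s)+x(t)$ are known.
  covariance_eq_min s t := by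
    have hs := hW.moments (fun _ : Unit ↦ s) fun _ ↦ 1
    have ht := hW.moments (fun _ : Unit ↦ t) fun _ ↦ 1
    have hst := hW.moments ![s, t] fun _ ↦ 1
    simp only [brownianForm, Finset.univ_unique, Finset.sum_singleton, one_mul, min_self,
      Fin.sum_univ_two, Matrix.cons_val_zero, Matrix.cons_val_one] at hs ht hst
    have h := variance_add hs.1 ht.1
    have h' : Var[(fun x : C(I, ℝ) ↦ x s) + fun x ↦ x t; W] = _ := hst.2.2
    rw [h', hs.2.2, ht.2.2, min_comm (t : ℝ)] at h
    linarith

/-- Characteristic functions of linear images depend continuously on the measure. -/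
lemma continuous_charFun_map {S : Type*} [TopologicalSpace S] [MeasurableSpace S]
    [OpensMeasurableSpace S] {L : S → ℝ} (hL : Continuous L) :
    Continuous fun ν : ProbabilityMeasure S ↦ charFun ((ν : Measure S).map L) 1 := by
  have h1 := ProbabilityMeasure.continuous_map (Ω := S) hL
  have h2 : Continuous fun ν : ProbabilityMeasure ℝ ↦ charFun (ν : Measure ℝ) 1 := by
    refine continuous_iff_continuousAt.2 fun ν ↦ ?_
    have := (ProbabilityMeasure.tendsto_iff_forall_integral_rclike_tendsto ℂ).1
      (tendsto_id (x := 𝓝 ν)) (BoundedContinuousFunction.innerProbChar 1)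
    simpa only [ContinuousAt, id, charFun_eq_integral_innerProbChar] using this
  exact h2.comp h1

variable {Ω : Type*} [MeasurableSpace Ω] {Q : Measure Ω} [IsProbabilityMeasure Q]

/-- The functional central limit theorem for arrays satisfying the Lindeberg condition. -/
theorem IsLindebergArray.tendsto_wiener {k : ℕ → ℕ} (hk : Tendsto k atTop atTop)
    {ξ : ∀ n, Fin (k n) → Ω → ℝ} (hξ : IsLindebergArray ξ Q)
    (μ : ℕ → ProbabilityMeasure C(I, ℝ))
    (hμ : ∀ n, (μ n : Measure C(I, ℝ)) =
      Q.map fun ω ↦ polygon (k n) fun j ↦ cumSum (ξ n) j ω) :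
    ∃ W : ProbabilityMeasure C(I, ℝ), HasWienerCharFun (W : Measure C(I, ℝ)) ∧
      Tendsto μ atTop (𝓝 W) := by
  have htight := hξ.isTightMeasureSet hk
  have hcomp : IsCompact (closure (range μ)) := by
    refine isCompact_closure_of_isTightMeasureSet (htight.subset ?_)
    rintro _ ⟨_, ⟨n, rfl⟩, rfl⟩
    exact ⟨n, (hμ n).symm⟩
  have hmem : ∀ n, μ n ∈ closure (range μ) := fun n ↦ subset_closure (mem_range_self n)
  -- Every cluster point inherits the limiting characteristic functions, so there is at most one;
  -- Prokhorov compactness gives at least one, and hence convergence.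
  have hclust : ∀ W : ProbabilityMeasure C(I, ℝ), MapClusterPt W atTop μ →
      HasWienerCharFun (W : Measure C(I, ℝ)) := by
    intro W hW ι _ t θ
    have hcont := continuous_charFun_map (continuous_sum_eval t θ)
    have h1 := hW.continuousAt_comp hcont.continuousAt
    have h2 := hξ.tendsto_charFun_polygon hk t θ
    have h3 : Tendsto ((fun ν : ProbabilityMeasure C(I, ℝ) ↦
        charFun ((ν : Measure C(I, ℝ)).map fun x ↦ ∑ i, θ i * x (t i)) 1) ∘ μ) atTop
        (𝓝 (Complex.exp (-(brownianForm t θ / 2) : ℝ))) := by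
      refine h2.congr fun n ↦ ?_
      simp only [Function.comp]
      rw [hμ n, Measure.map_map (continuous_sum_eval t θ).measurable
        (measurable_polygon_cumSum (hξ.measurable n))]
      rfl
    exact eq_of_nhds_neBot (ClusterPt.mono h1 h3)
  obtain ⟨W, -, hW⟩ := hcomp.exists_mapClusterPt (f := atTop) (u := μ)
    (tendsto_principal.2 (Eventually.of_forall hmem))
  refine ⟨W, hclust W hW, hcomp.tendsto_nhds_of_unique_mapClusterPt (Eventually.of_forall hmem)
    fun W' _ hW' ↦ ?_⟩
  have heq : (W' : Measure C(I, ℝ)) = W := (hclust W' hW').ext (hclust W hW)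
  exact Subtype.ext heq

end WienerMeasure

/-! ### Random samples from a fixed function -/

section RandomSampling

variable {E Ω : Type*} [MeasurableSpace E] [MeasurableSpace Ω] {Q : Measure Ω}
  [IsProbabilityMeasure Q]

/-- A deviation above $2K$ from a mean of size at most $K$ forces $|x|>K\ge|M|$, so tails of the
centred values are controlled by tails of the raw ones. -/
lemma sq_sub_le_of_large {x M K L : ℝ} (hM : |M| ≤ K) (hL : 2 * K ≤ L) (hx : L < |x - M|) :
    K < |x| ∧ (x - M) ^ 2 ≤ 4 * x ^ 2 := by
  have h1 : |x - M| ≤ |x| + |M| := abs_sub _ _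
  have h2 : K < |x| := by linarith
  refine ⟨h2, ?_⟩
  have h3 : |x - M| ≤ |2 * x| := by
    rw [abs_mul, abs_two]
    linarith
  have := sq_le_sq' (by linarith [abs_nonneg (x - M), abs_nonneg (2 * x)]) h3
  rw [sq_abs, sq_abs] at this
  linarith

/-- Standardized random samples from a function with convergent moments satisfy the Lindeberg
condition. -/
theorem isLindebergArray_of_sample {k : ℕ → ℕ} (hkpos : ∀ n, 0 < k n)
    (hk : Tendsto k atTop atTop) {τ : ∀ n, Fin (k n) → Ω → E}
    (hτ : ∀ n r, Measurable (τ n r)) {ρ : ℕ → Measure E} (hρ : ∀ n r, Q.map (τ n r) = ρ n)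
    (hind : ∀ n, iIndepFun (τ n) Q) {f : E → ℝ} (hf : Measurable f)
    (hf2 : ∀ n, MemLp f 2 (ρ n)) {M V : ℕ → ℝ} (hM : ∀ n, M n = ∫ t, f t ∂ρ n)
    (hV : ∀ n, V n = ∫ t, (f t - M n) ^ 2 ∂ρ n) {a v : ℝ} (ha : Tendsto M atTop (𝓝 a))
    (hv0 : 0 < v) (hv : Tendsto V atTop (𝓝 v)) {g : ℕ → ℝ}
    (hg : ∀ K : ℕ, Tendsto
      (fun n ↦ ∫ t, {t | (K : ℝ) < |f t|}.indicator (fun t ↦ f t ^ 2) t ∂ρ n) atTop (𝓝 (g K)))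
    (hg0 : ∀ δ : ℝ, 0 < δ → ∃ᶠ K in atTop, g K < δ) :
    IsLindebergArray (fun n r ω ↦ (f (τ n r ω) - M n) / √(k n * V n)) Q := by
  have hprob : ∀ n, IsProbabilityMeasure (ρ n) := fun n ↦ by
    rw [← hρ n ⟨0, hkpos n⟩]
    exact Measure.isProbabilityMeasure_map (hτ n _).aemeasurable
  have hfi : ∀ n, Integrable f (ρ n) := fun n ↦ (hf2 n).integrable (by norm_num)
  have hcomp : ∀ n r (h : E → ℝ), Measurable h → ∫ ω, h (τ n r ω) ∂Q = ∫ t, h t ∂ρ n := by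
    intro n r h hh
    rw [← hρ n r, integral_map (hτ n r).aemeasurable hh.aestronglyMeasurable]
  have hsqi : ∀ n, Integrable (fun t ↦ (f t - M n) ^ 2) (ρ n) := fun n ↦
    ((hf2 n).sub (memLp_const (M n))).integrable_sq
  have hVev : ∀ᶠ n in atTop, 0 < V n := hv.eventually_const_lt hv0
  have hk0 : ∀ n, (0 : ℝ) < k n := fun n ↦ Nat.cast_pos.2 (hkpos n)
  -- Where $V_n=0$ the division returns 0, so square integrability and centring hold for every $n$;
  -- only the variance needs $V_n>0$, which holds eventually.
  refine ⟨fun n r ↦ ((hf.comp (hτ n r)).sub_const _).div_const _, fun n ↦ ?_,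
    Eventually.of_forall fun n r ↦ ?_, Eventually.of_forall fun n r ↦ ?_, ?_, fun ε hε ↦ ?_⟩
  · exact (hind n).comp (fun _ t ↦ (f t - M n) / √(k n * V n))
      fun _ ↦ (hf.sub_const _).div_const _
  · have h1 : MemLp (fun t ↦ (f t - M n) / √(k n * V n)) 2 (Q.map (τ n r)) := by
      rw [hρ]
      simp_rw [div_eq_mul_inv]
      exact ((hf2 n).sub (memLp_const (M n))).mul_const _
    exact h1.comp_of_map (hτ n r).aemeasurable
  · rw [hcomp n r (fun t ↦ (f t - M n) / √(k n * V n)) ((hf.sub_const _).div_const _),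
      integral_div, integral_sub (hfi n) (integrable_const _), integral_const, ← hM]
    simp
  · filter_upwards [hVev] with n hn r
    rw [hcomp n r (fun t ↦ ((f t - M n) / √(k n * V n)) ^ 2)
      (((hf.sub_const _).div_const _).pow_const 2)]
    simp_rw [div_pow]
    rw [integral_div, ← hV, Real.sq_sqrt (mul_pos (hk0 n) hn).le]
    field_simp
  have hL : Tendsto (fun n ↦ ε * √(k n * V n)) atTop atTop :=
    (Real.tendsto_sqrt_atTop.comp
      ((tendsto_natCast_atTop_atTop.comp hk).atTop_mul_pos hv0 hv)).const_mul_atTop hε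
  -- The truncation level $\varepsilon\sqrt{k_nV_n}$ tends to infinity, so it eventually exceeds
  -- $2K$ for any fixed $K$. The factor $1/k_n$ cancels against the $k_n$ terms of a row.
  have htail : ∀ n r, 0 < V n → ∀ K : ℕ, |M n| ≤ K → 2 * (K : ℝ) ≤ ε * √(k n * V n) →
      tailMoment Q (fun ω ↦ (f (τ n r ω) - M n) / √(k n * V n)) ε ≤
        4 * (∫ t, {t | (K : ℝ) < |f t|}.indicator (fun t ↦ f t ^ 2) t ∂ρ n) / (k n * V n) := by
    intro n r hn K hMK hLK
    have hkV : 0 < k n * V n := mul_pos (hk0 n) hn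
    have hs : 0 < √(k n * V n) := Real.sqrt_pos.2 hkV
    have hmeas : Measurable fun t ↦ (f t - M n) / √(k n * V n) := (hf.sub_const _).div_const _
    have hset : MeasurableSet {t | ε < |(f t - M n) / √(k n * V n)|} :=
      measurableSet_lt measurable_const hmeas.abs
    have hset' : MeasurableSet {t | (K : ℝ) < |f t|} := measurableSet_lt measurable_const hf.abs
    have h1 := hcomp n r ({t | ε < |(f t - M n) / √(k n * V n)|}.indicator
      fun t ↦ ((f t - M n) / √(k n * V n)) ^ 2) ((hmeas.pow_const 2).indicator hset)
    have h2 : tailMoment Q (fun ω ↦ (f (τ n r ω) - M n) / √(k n * V n)) ε =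
        ∫ t, {t | ε < |(f t - M n) / √(k n * V n)|}.indicator
          (fun t ↦ ((f t - M n) / √(k n * V n)) ^ 2) t ∂ρ n := h1
    rw [h2, mul_div_assoc, mul_comm (4 : ℝ), div_mul_eq_mul_div, mul_div_assoc,
      ← integral_mul_const]
    refine integral_mono_of_nonneg (Eventually.of_forall fun t ↦
      indicator_nonneg (fun _ _ ↦ sq_nonneg _) t)
      (((hf2 n).integrable_sq.indicator hset').mul_const _) (Eventually.of_forall fun t ↦ ?_)
    by_cases ht : ε < |(f t - M n) / √(k n * V n)|
    · have ht' := ht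
      rw [abs_div, abs_of_pos hs, lt_div_iff₀ hs] at ht'
      obtain ⟨hK, hle⟩ := sq_sub_le_of_large hMK hLK ht'
      simp only [indicator, mem_ofPred_eq, ht, hK, if_true]
      rw [div_pow, Real.sq_sqrt hkV.le, ← mul_div_assoc]
      gcongr
      linarith
    · simp only [indicator, mem_ofPred_eq, ht, if_false]
      have : 0 ≤ if (K : ℝ) < |f t| then f t ^ 2 else 0 := by
        split_ifs
        · positivity
        · exact le_rfl
      positivity
  have hnonneg : ∀ n, 0 ≤ ∑ r, tailMoment Q (fun ω ↦ (f (τ n r ω) - M n) / √(k n * V n)) ε :=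
    fun n ↦ Finset.sum_nonneg fun r _ ↦ integral_nonneg fun ω ↦
      indicator_nonneg (fun _ _ ↦ sq_nonneg _) ω
  rw [Metric.tendsto_nhds]
  intro δ hδ
  -- `K` must make the limiting tail $4g(K)/v$ less than $\delta$ and exceed $|a|$, so that
  -- eventually $|M_n|\le K$.
  obtain ⟨K, hKg, hKa⟩ := ((hg0 (δ * v / 4) (by positivity)).and_eventually
    (tendsto_natCast_atTop_atTop.eventually_gt_atTop |a|)).exists
  have hlim : Tendsto (fun n ↦
      4 * (∫ t, {t | (K : ℝ) < |f t|}.indicator (fun t ↦ f t ^ 2) t ∂ρ n) / V n) atTop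
      (𝓝 (4 * g K / v)) := ((hg K).const_mul 4).div hv hv0.ne'
  have hltδ : 4 * g K / v < δ := by
    rw [div_lt_iff₀ hv0]
    linarith
  filter_upwards [hVev, ha.abs.eventually_lt_const hKa, hL.eventually_ge_atTop (2 * (K : ℝ)),
    hlim.eventually_lt_const hltδ] with n hn hMn hLn hlt
  rw [dist_zero_right, Real.norm_eq_abs, abs_of_nonneg (hnonneg n)]
  refine lt_of_le_of_lt ?_ hlt
  refine (Finset.sum_le_sum fun r _ ↦ htail n r hn K hMn.le hLn).trans_eq ?_
  rw [Finset.sum_const, Finset.card_univ, Fintype.card_fin, nsmul_eq_mul]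
  have := hk0 n
  field_simp

end RandomSampling

/-! ### Conditional tails -/

section CondExp

variable {Ω : Type*} {m mΩ : MeasurableSpace Ω} {P : Measure Ω} [IsProbabilityMeasure P]

/-- Conditional expectations of the tails of an integrable nonnegative variable. -/
lemma ae_frequently_condExp_tail_lt (hm : m ≤ mΩ) {f : Ω → ℝ} (hf : Measurable f)
    (hf2 : MemLp f 2 P) :
    ∀ᵐ ω ∂P, ∀ δ : ℝ, 0 < δ → ∃ᶠ K : ℕ in atTop,
      (P[{ω | (K : ℝ) < |f ω|}.indicator (fun ω ↦ f ω ^ 2) | m]) ω < δ := by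
  set h : ℕ → Ω → ℝ := fun K ↦ {ω | (K : ℝ) < |f ω|}.indicator fun ω ↦ f ω ^ 2 with hh
  have hset : ∀ K : ℕ, MeasurableSet {ω | (K : ℝ) < |f ω|} := fun K ↦
    measurableSet_lt measurable_const hf.abs
  have hi : ∀ K, Integrable (h K) P := fun K ↦ hf2.integrable_sq.indicator (hset K)
  have h0 : ∀ K ω, 0 ≤ h K ω := fun K ω ↦ indicator_nonneg (fun _ _ ↦ sq_nonneg _) ω
  have hint : Tendsto (fun K ↦ ∫ ω, h K ω ∂P) atTop (𝓝 0) := by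
    have := tendsto_integral_of_dominated_convergence (F := h) (f := fun _ ↦ (0 : ℝ))
      (μ := P) (fun ω ↦ f ω ^ 2) (fun K ↦ (hi K).aestronglyMeasurable) hf2.integrable_sq
      (fun K ↦ Eventually.of_forall fun ω ↦ by
        rw [Real.norm_of_nonneg (h0 K ω)]
        exact indicator_le_self' (fun _ _ ↦ sq_nonneg _) ω)
      (Eventually.of_forall fun ω ↦ by
        refine tendsto_const_nhds.congr' ?_
        filter_upwards [tendsto_natCast_atTop_atTop.eventually_ge_atTop |f ω|] with K hK
        exact (indicator_of_notMem (by simpa using hK) _).symm)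
    simpa using this
  have hpos : ∀ K, 0 ≤ᵐ[P] P[h K | m] := fun K ↦ condExp_nonneg (Eventually.of_forall (h0 K))
  have hlint : ∀ K, ∫⁻ ω, ENNReal.ofReal ((P[h K | m]) ω) ∂P =
      ENNReal.ofReal (∫ ω, h K ω ∂P) := by
    intro K
    rw [← integral_condExp hm, ofReal_integral_eq_lintegral_ofReal integrable_condExp (hpos K)]
  have hmeas : ∀ K, Measurable fun ω ↦ ENNReal.ofReal ((P[h K | m]) ω) := fun K ↦
    ((stronglyMeasurable_condExp.mono hm).measurable).ennreal_ofReal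
  -- Fatou's lemma yields smallness for infinitely many $K$, which is all the Lindeberg condition
  -- needs.
  have hfatou : ∫⁻ ω, liminf (fun K ↦ ENNReal.ofReal ((P[h K | m]) ω)) atTop ∂P = 0 := by
    refine le_antisymm ((lintegral_liminf_le hmeas).trans ?_) zero_le
    simp_rw [hlint]
    have := (ENNReal.continuous_ofReal.tendsto 0).comp hint
    rw [ENNReal.ofReal_zero] at this
    exact this.liminf_eq.le
  rw [lintegral_eq_zero_iff (Measurable.liminf hmeas)] at hfatou
  filter_upwards [hfatou] with ω hω δ hδ
  have hlt : liminf (fun K ↦ ENNReal.ofReal ((P[h K | m]) ω)) atTop < ENNReal.ofReal δ := by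
    rw [hω]
    exact ENNReal.ofReal_pos.2 hδ
  exact (frequently_lt_of_liminf_lt (by isBoundedDefault) hlt).mono fun K hK ↦
    (ENNReal.ofReal_lt_ofReal_iff hδ).1 hK

end CondExp

/-! ### From the random field to the array, and from conditional to joint convergence -/

section RandomField

lemma setAverage_eq_integral_cond {E : Type*} [MeasureSpace E] (T : Set E) (f : E → ℝ) :
    ⨍ t in T, f t = ∫ t, f t ∂(ProbabilityTheory.cond volume T) := by
  rw [average, Measure.restrict_apply_univ, ProbabilityTheory.cond]

variable {E : Type*} [NormedAddCommGroup E] [NormedSpace ℝ E] [FiniteDimensional ℝ E]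
  [MeasureSpace E] [BorelSpace E] [(volume : Measure E).IsAddHaarMeasure]
  {Ω : Type*} [MeasurableSpace Ω] {P : Measure Ω} [IsProbabilityMeasure P]
  {X : E → Ω → ℝ}

/-- The boundary of a convex set is null. This allows open sets in the ergodic theorem although no
measurability of the sets $T_n$ is assumed. -/
lemma cond_volume_interior {T : Set E} (hT : Convex ℝ T) :
    ProbabilityTheory.cond volume (interior T) = ProbabilityTheory.cond (volume : Measure E) T := by
  have h : interior T =ᵐ[(volume : Measure E)] T :=
    interior_ae_eq_of_null_frontier (hT.addHaar_frontier volume)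
  rw [ProbabilityTheory.cond, ProbabilityTheory.cond, measure_congr h, Measure.restrict_congr_set h]

lemma measurable_spatialMean (hX : Measurable (Function.uncurry X)) (T : Set E) :
    Measurable (spatialMean X T) := by
  have h : Measurable fun p : Ω × E ↦ X p.2 p.1 := hX.comp measurable_swap
  have : spatialMean X T = fun ω ↦ (volume.real T)⁻¹ * ∫ t in T, X t ω := by
    funext ω
    rw [spatialMean, setAverage_eq, smul_eq_mul]
  rw [this]
  exact (h.stronglyMeasurable.integral_prod_right' (ν := volume.restrict T)).measurable.const_mul _

lemma measurable_spatialVar (hX : Measurable (Function.uncurry X)) (T : Set E) :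
    Measurable (spatialVar X T) := by
  have h : Measurable fun p : Ω × E ↦ (X p.2 p.1 - spatialMean X T p.1) ^ 2 :=
    ((hX.comp measurable_swap).sub ((measurable_spatialMean hX T).comp measurable_fst)).pow_const 2
  have : spatialVar X T = fun ω ↦
      (volume.real T)⁻¹ * ∫ t in T, (X t ω - spatialMean X T ω) ^ 2 := by
    funext ω
    rw [spatialVar, setAverage_eq, smul_eq_mul]
  rw [this]
  exact (h.stronglyMeasurable.integral_prod_right' (ν := volume.restrict T)).measurable.const_mul _

lemma measurable_brokenLine (hX : Measurable (Function.uncurry X)) (T : Set E) {k : ℕ}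
    {Ω' : Type*} [MeasurableSpace Ω'] {τ : Fin k → Ω' → E} (hτ : ∀ r, Measurable (τ r)) :
    Measurable (brokenLine X T τ : Ω × Ω' → C(I, ℝ)) := by
  refine (continuous_polygon k).measurable.comp (measurable_pi_lambda _ fun j ↦ ?_)
  refine Measurable.div ?_ ?_
  · exact Finset.measurable_sum _ fun r _ ↦
      (hX.comp (((hτ r).comp measurable_snd).prodMk measurable_fst)).sub
        ((measurable_spatialMean hX T).comp measurable_fst)
  · exact (((measurable_spatialVar hX T).comp measurable_fst).const_mul _).sqrt

lemma brokenLine_eq_polygon_cumSum (X : E → Ω → ℝ) (T : Set E) {k : ℕ} {Ω' : Type*}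
    (τ : Fin k → Ω' → E) (ω : Ω) (ω' : Ω') :
    brokenLine X T τ (ω, ω') = polygon k fun j ↦ cumSum
      (fun r ω' ↦ (X (τ r ω') ω - spatialMean X T ω) / √(k * spatialVar X T ω)) j ω' := by
  simp only [brokenLine, partialSum, cumSum, Finset.sum_div]

/-- The spatial averages of a function of the values of the field converge along an increasing
sequence of convex sets. -/
lemma ae_tendsto_integral_cond (hX : Measurable (Function.uncurry X)) (hhom : IsHomogeneous X P)
    {T : ℕ → Set E} (hmono : Monotone T) (hconv : ∀ n, Convex ℝ (T n))
    (hbdd : ∀ n, Bornology.IsBounded (T n)) (hpos : ∀ n, volume (T n) ≠ 0) {c : ℕ → E}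
    {r : ℕ → ℝ} (hr : Tendsto r atTop atTop) (hball : ∀ n, Metric.ball (c n) (r n) ⊆ T n)
    {h : ℝ → ℝ} (hh : Measurable h) (hi : Integrable (fun ω ↦ h (X 0 ω)) P) :
    ∀ᵐ ω ∂P, (∀ n, Integrable (fun t ↦ h (X t ω)) (ProbabilityTheory.cond volume (T n))) ∧
      Tendsto (fun n ↦ ∫ t, h (X t ω) ∂(ProbabilityTheory.cond volume (T n))) atTop
        (𝓝 ((P[fun ω ↦ h (X 0 ω) | invariantEvents X P]) ω)) := by
  have hF : Measurable fun x : E → ℝ ↦ h (x 0) := hh.comp (measurable_pi_apply 0)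
  have hFi : Integrable (fun x : E → ℝ ↦ h (x 0)) (P.map (samplePath X)) :=
    (integrable_map_measure hF.aestronglyMeasurable (measurable_samplePath hX).aemeasurable).2 hi
  have hne : ∀ n, (interior (T n)).Nonempty := by
    intro n
    rw [nonempty_iff_ne_empty]
    intro h0
    have h := measure_congr (interior_ae_eq_of_null_frontier ((hconv n).addHaar_frontier volume))
    rw [h0, measure_empty] at h
    exact hpos n h.symm
  have hlim := ae_tendsto_shiftAverage hX hhom (T := fun n ↦ interior (T n))
    (fun _ _ hij ↦ interior_mono (hmono hij)) (fun n ↦ (hconv n).interior)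
    (fun _ ↦ isOpen_interior) (fun n ↦ (hbdd n).subset interior_subset) hne hr
    (fun n ↦ Metric.isOpen_ball.subset_interior_iff.2 (hball n)) hF hFi
  have hint : ∀ᵐ ω ∂P, ∀ n,
      Integrable (fun t ↦ h (X t ω)) (ProbabilityTheory.cond volume (T n)) := by
    refine ae_all_iff.2 fun n ↦ ?_
    have := cond_isProbabilityMeasure_of_finite (hpos n) (hbdd n).measure_lt_top.ne
    filter_upwards [ae_integrable_shift_samplePath hX hhom
      (ProbabilityTheory.cond volume (T n)) 0 hF hFi] with ω hω
    simpa [shift, samplePath] using hω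
  filter_upwards [hlim, hint] with ω hω hω'
  refine ⟨hω', hω.congr fun n ↦ ?_⟩
  rw [shiftAverage, setAverage_eq_integral_cond, cond_volume_interior (hconv n)]
  simp [shift, samplePath]

/-- For almost every realization of the field, the standardized samples form an array satisfying
the Lindeberg condition. -/
theorem ae_isLindebergArray (hX : Measurable (Function.uncurry X)) (hhom : IsHomogeneous X P)
    (hsq : MemLp (X 0) 2 P) (hvar : ∀ᵐ ω ∂P, 0 < Var[X 0; P | invariantEvents X P] ω)
    {T : ℕ → Set E} (hmono : Monotone T) (hconv : ∀ n, Convex ℝ (T n))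
    (hbdd : ∀ n, Bornology.IsBounded (T n)) {c : ℕ → E} {r : ℕ → ℝ} (hr : Tendsto r atTop atTop)
    (hball : ∀ n, Metric.ball (c n) (r n) ⊆ T n) {k : ℕ → ℕ} (hkpos : ∀ n, 0 < k n)
    (hk : Tendsto k atTop atTop) {Ω' : Type*} [MeasurableSpace Ω'] {Q : Measure Ω'}
    [IsProbabilityMeasure Q] {τ : ∀ n, Fin (k n) → Ω' → E} (hτ : ∀ n i, Measurable (τ n i))
    (hunif : ∀ n i, pdf.IsUniform (τ n i) (T n) Q volume) (hind : ∀ n, iIndepFun (τ n) Q) :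
    ∀ᵐ ω ∂P, IsLindebergArray (fun n i ω' ↦
      (X (τ n i ω') ω - spatialMean X (T n) ω) / √(k n * spatialVar X (T n) ω)) Q := by
  -- For small $n$ the radius `r n` may be nonpositive, so positive volume is taken from the uniform
  -- laws: conditioning on a null set gives the zero measure.
  have hpos : ∀ n, volume (T n) ≠ 0 := by
    intro n h0
    have h := hunif n ⟨0, hkpos n⟩
    have hp : IsProbabilityMeasure (Q.map (τ n ⟨0, hkpos n⟩)) :=
      Measure.isProbabilityMeasure_map (hτ n _).aemeasurable
    rw [h, ProbabilityTheory.cond, Measure.restrict_eq_zero.2 h0, smul_zero] at hp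
    exact hp.ne_zero _ rfl
  have hcond : ∀ n, IsProbabilityMeasure (ProbabilityTheory.cond (volume : Measure E) (T n)) :=
    fun n ↦ cond_isProbabilityMeasure_of_finite (hpos n) (hbdd n).measure_lt_top.ne
  have hX0 : Measurable (X 0) := hX.comp (measurable_const.prodMk measurable_id)
  have hsec : ∀ ω, Measurable fun t ↦ X t ω := fun ω ↦
    hX.comp (measurable_id.prodMk measurable_const)
  have hmean := ae_tendsto_integral_cond hX hhom hmono hconv hbdd hpos hr hball measurable_id
    (hsq.integrable (by norm_num))
  have hsecond := ae_tendsto_integral_cond hX hhom hmono hconv hbdd hpos hr hball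
    (measurable_id.pow_const 2) hsq.integrable_sq
  have htail : ∀ᵐ ω ∂P, ∀ K : ℕ, Tendsto (fun n ↦
      ∫ t, {t | (K : ℝ) < |X t ω|}.indicator (fun t ↦ X t ω ^ 2) t
        ∂(ProbabilityTheory.cond volume (T n))) atTop
      (𝓝 ((P[{ω | (K : ℝ) < |X 0 ω|}.indicator (fun ω ↦ X 0 ω ^ 2) |
        invariantEvents X P]) ω)) := by
    refine ae_all_iff.2 fun K ↦ ?_
    have hset : MeasurableSet {x : ℝ | (K : ℝ) < |x|} :=
      measurableSet_lt measurable_const measurable_norm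
    have := ae_tendsto_integral_cond hX hhom hmono hconv hbdd hpos hr hball
      (h := {x : ℝ | (K : ℝ) < |x|}.indicator fun x ↦ x ^ 2)
      ((measurable_id.pow_const 2).indicator hset)
      (hsq.integrable_sq.indicator (hX0 hset))
    exact this.mono fun ω hω ↦ hω.2
  filter_upwards [hmean, hsecond, htail, hvar,
    ae_frequently_condExp_tail_lt (invariantEvents_le (P := P) hX) hX0 hsq,
    condVar_ae_eq_condExp_sq_sub_sq_condExp (invariantEvents_le (P := P) hX) hsq]
    with ω hω₁ hω₂ hω₃ hω₄ hω₅ hω₆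
  have hmem : ∀ n, MemLp (fun t ↦ X t ω) 2 (ProbabilityTheory.cond volume (T n)) := fun n ↦
    (memLp_two_iff_integrable_sq (hsec ω).aestronglyMeasurable).2 (hω₂.1 n)
  have hMeq : ∀ n, spatialMean X (T n) ω = ∫ t, X t ω ∂(ProbabilityTheory.cond volume (T n)) :=
    fun n ↦ setAverage_eq_integral_cond _ _
  have hVeq : ∀ n, spatialVar X (T n) ω =
      ∫ t, (X t ω - spatialMean X (T n) ω) ^ 2 ∂(ProbabilityTheory.cond volume (T n)) :=
    fun n ↦ setAverage_eq_integral_cond _ _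
  have hMlim : Tendsto (fun n ↦ spatialMean X (T n) ω) atTop
      (𝓝 ((P[X 0 | invariantEvents X P]) ω)) := by
    simp_rw [hMeq]
    exact hω₁.2
  refine isLindebergArray_of_sample hkpos hk hτ hunif hind (hsec ω) hmem hMeq hVeq hMlim hω₄ ?_
    hω₃ hω₅
  rw [hω₆]
  -- $V_n$ is the spatial mean of $X^2$ minus $M_n^2$, and the conditional variance has the same
  -- form.
  have hlim : Tendsto (fun n ↦ ∫ t, X t ω ^ 2 ∂(ProbabilityTheory.cond volume (T n)) -
      spatialMean X (T n) ω ^ 2) atTop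
      (𝓝 ((P[fun ω ↦ X 0 ω ^ 2 | invariantEvents X P]) ω -
        (P[X 0 | invariantEvents X P]) ω ^ 2)) := hω₂.2.sub (hMlim.pow 2)
  refine hlim.congr fun n ↦ ?_
  have hvar' := variance_eq_sub (hmem n)
  rw [variance_eq_integral (hsec ω).aemeasurable, ← hMeq] at hvar'
  rw [hVeq]
  exact hvar'.symm

/-- Convergence in distribution conditionally on almost every `ω` implies convergence in
distribution. -/
lemma tendstoInDistribution_prod {S Ω' : Type*} [TopologicalSpace S] [MeasurableSpace S]
    [OpensMeasurableSpace S] [MeasurableSpace Ω'] {Q : Measure Ω'} [IsProbabilityMeasure Q]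
    {Z : ℕ → Ω × Ω' → S} (hZ : ∀ n, Measurable (Z n)) {W : ProbabilityMeasure S}
    (h : ∀ᵐ ω ∂P, TendstoInDistribution (fun n ω' ↦ Z n (ω, ω')) atTop id (fun _ ↦ Q)
      (W : Measure S)) :
    TendstoInDistribution Z atTop id (fun _ ↦ P.prod Q) (W : Measure S) := by
  refine ⟨fun n ↦ (hZ n).aemeasurable, aemeasurable_id,
    ProbabilityMeasure.tendsto_iff_forall_integral_tendsto.2 fun F ↦ ?_⟩
  have hFm : ∀ n, Measurable fun p ↦ F (Z n p) := fun n ↦ F.continuous.measurable.comp (hZ n)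
  have hFi : ∀ n, Integrable (fun p ↦ F (Z n p)) (P.prod Q) := fun n ↦
    Integrable.of_bound (hFm n).aestronglyMeasurable ‖F‖
      (Eventually.of_forall fun p ↦ F.norm_coe_le_norm _)
  have hlim : Tendsto (fun n ↦ ∫ ω, ∫ ω', F (Z n (ω, ω')) ∂Q ∂P) atTop
      (𝓝 (∫ _, (∫ x, F x ∂((W : Measure S).map id)) ∂P)) := by
    refine tendsto_integral_of_dominated_convergence (fun _ ↦ ‖F‖)
      (fun n ↦ (hFi n).integral_prod_left.aestronglyMeasurable) (integrable_const _)
      (fun n ↦ Eventually.of_forall fun ω ↦ ?_) ?_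
    · refine (norm_integral_le_of_norm_le_const
        (Eventually.of_forall fun ω' ↦ F.norm_coe_le_norm _)).trans_eq ?_
      simp
    · filter_upwards [h] with ω hω
      have := (ProbabilityMeasure.tendsto_iff_forall_integral_tendsto.1 hω.tendsto) F
      refine this.congr fun n ↦ ?_
      exact integral_map ((hZ n).comp measurable_prodMk_left).aemeasurable
        F.continuous.measurable.aestronglyMeasurable
  rw [integral_const, probReal_univ, one_smul] at hlim
  refine hlim.congr fun n ↦ ?_
  rw [← integral_prod _ (hFi n)]
  exact (integral_map (hZ n).aemeasurable F.continuous.measurable.aestronglyMeasurable).symm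

end RandomField

end RandomizedFCLT

end

/-! ### The theorem -/

theorem mainTheorem5 {m : ℕ}
    {ΩX : Type*} [MeasurableSpace ΩX] (PX : Measure ΩX) [IsProbabilityMeasure PX]
    {Ωτ : Type*} [MeasurableSpace Ωτ] (Pτ : Measure Ωτ) [IsProbabilityMeasure Pτ]
    -- the random field: bi-measurable, homogeneous, with finite second moment and a.s. positive
    -- conditional variance given the shift-invariant events
    (X : EuclideanSpace ℝ (Fin m) → ΩX → ℝ)
    (hX_meas : Measurable (Function.uncurry X))
    (hX_hom : RandomizedFCLT.IsHomogeneous X PX)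
    (hX_sq : MemLp (X 0) 2 PX)
    (hX_var : ∀ᵐ ω ∂PX, 0 < Var[X 0; PX | RandomizedFCLT.invariantEvents X PX] ω)
    -- increasing bounded convex sets containing balls with radii tending to infinity
    (T : ℕ → Set (EuclideanSpace ℝ (Fin m)))
    (hT_mono : Monotone T)
    (hT_convex : ∀ n, Convex ℝ (T n))
    (hT_bdd : ∀ n, Bornology.IsBounded (T n))
    (c : ℕ → EuclideanSpace ℝ (Fin m)) (r : ℕ → ℝ)
    (hr : Tendsto r atTop atTop)
    (hT_ball : ∀ n, Metric.ball (c n) (r n) ⊆ T n)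
    -- sample sizes
    (k : ℕ → ℕ) (hk_pos : ∀ n, 0 < k n) (hk_mono : Monotone k) (hk : Tendsto k atTop atTop)
    -- for each `n`, `k n` independent random points uniformly distributed on `T n`
    (τ : (n : ℕ) → Fin (k n) → Ωτ → EuclideanSpace ℝ (Fin m))
    (hτ_meas : ∀ n i, Measurable (τ n i))
    (hτ_unif : ∀ n i, pdf.IsUniform (τ n i) (T n) Pτ volume)
    (hτ_indep : ∀ n, iIndepFun (τ n) Pτ) :
    ∃ W : ProbabilityMeasure C(unitInterval, ℝ),
      RandomizedFCLT.IsWienerMeasure (W : Measure C(unitInterval, ℝ)) ∧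
      (∀ᵐ ω ∂PX, TendstoInDistribution
        (fun n ω' ↦ RandomizedFCLT.brokenLine X (T n) (τ n) (ω, ω')) atTop
        id (fun _ ↦ Pτ) (W : Measure C(unitInterval, ℝ))) ∧
      TendstoInDistribution
        (fun n p ↦ RandomizedFCLT.brokenLine X (T n) (τ n) p) atTop
        id (fun _ ↦ PX.prod Pτ) (W : Measure C(unitInterval, ℝ)) := by
  have hae := RandomizedFCLT.ae_isLindebergArray hX_meas hX_hom hX_sq hX_var hT_mono hT_convex
    hT_bdd hr hT_ball hk_pos hk hτ_meas hτ_unif hτ_indep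
  have hZ : ∀ n, Measurable (RandomizedFCLT.brokenLine X (T n) (τ n)) := fun n ↦
    RandomizedFCLT.measurable_brokenLine hX_meas (T n) (hτ_meas n)
  have hZω : ∀ n ω, Measurable fun ω' ↦ RandomizedFCLT.brokenLine X (T n) (τ n) (ω, ω') :=
    fun n ω ↦ (hZ n).comp measurable_prodMk_left
  have hconv : ∀ᵐ ω ∂PX, ∃ W : ProbabilityMeasure C(unitInterval, ℝ),
      RandomizedFCLT.HasWienerCharFun (W : Measure C(unitInterval, ℝ)) ∧
      TendstoInDistribution (fun n ω' ↦ RandomizedFCLT.brokenLine X (T n) (τ n) (ω, ω')) atTop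
        id (fun _ ↦ Pτ) (W : Measure C(unitInterval, ℝ)) := by
    filter_upwards [hae] with ω hω
    obtain ⟨W, hW, hlim⟩ := hω.tendsto_wiener hk
      (fun n ↦ ⟨Pτ.map fun ω' ↦ RandomizedFCLT.brokenLine X (T n) (τ n) (ω, ω'),
        Measure.isProbabilityMeasure_map (hZω n ω).aemeasurable⟩)
      (fun n ↦ by simp_rw [RandomizedFCLT.brokenLine_eq_polygon_cumSum]; rfl)
    have hid : (⟨(W : Measure C(unitInterval, ℝ)).map id,
        Measure.isProbabilityMeasure_map aemeasurable_id⟩ :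
        ProbabilityMeasure C(unitInterval, ℝ)) = W :=
      ProbabilityMeasure.toMeasure_injective Measure.map_id
    refine ⟨W, hW, fun n ↦ (hZω n ω).aemeasurable, aemeasurable_id, ?_⟩
    rw [← hid] at hlim
    exact hlim
  -- The limit at one good $\omega_0$ serves as Wiener measure; uniqueness identifies the limits at
  -- almost all other $\omega$ with it.
  obtain ⟨ω₀, W, hW, -⟩ := hconv.exists
  have ha : ∀ᵐ ω ∂PX, TendstoInDistribution
      (fun n ω' ↦ RandomizedFCLT.brokenLine X (T n) (τ n) (ω, ω')) atTop
      id (fun _ ↦ Pτ) (W : Measure C(unitInterval, ℝ)) := by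
    filter_upwards [hconv] with ω hω
    obtain ⟨W', hW', hlim⟩ := hω
    have heq : (W' : Measure C(unitInterval, ℝ)) = W := hW'.ext hW
    have heq' : W' = W := Subtype.ext heq
    rwa [heq'] at hlim
  exact ⟨W, hW.isWienerMeasure, ha, RandomizedFCLT.tendstoInDistribution_prod hZ ha⟩
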